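/- Let $T>0$, $\zeta\in C^2([0,T])$, $\nu\in\mathbb R$, $p,h\in C^0([0,T];H^2(\mathbb R))$, and let $\theta\in C_c^\infty(\mathbb R)$ be an even probability density. Let $R>0$ and let $\varphi^R\in C^\infty(\mathbb R)$ be even, nondecreasing on $[0,\infty)$, with $\varphi^R(x)=x^2$ for $|x|\le R$ and $\varphi^R(x)=(R+1)^2$ for $|x|\ge R+2$. All functions are real-valued. Put $$F(t,x)=\frac1{1+\theta(x-\zeta(t))},\qquad G(t,x)=-\frac{\dot\zeta(t)\,\theta'(x-\zeta(t))}{1+\theta(x-\zeta(t))},$$ and $$E_2(T)=C^0([0,T];H^2(\mathbb R)),\qquad E_1(T)=C^0([0,T];H^2(\mathbb R))\cap C^1([0,T];L^2(\mathbb R)),$$ $$E_0(T)=C^0([0,T];H^4(\mathbb R))\cap C^1([0,T];H^2(\mathbb R))\cap C^2([0,T];L^2(\mathbb R)).$$ For $u_0\in H^4(\mathbb R)$, $u_1\in H^2(\mathbb R)$, $g\in E_2(T)$ let $\mathcal A_T(u_0,u_1,g)$ be the unique solution $u\in E_0(T)$ of $$u_{tt}+F\,u_{xxxx}+G\,u_t=g,\qquad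 u(0,\cdot)=u_0,\quad u_t(0,\cdot)=u_1,$$ and denote again by $$\mathcal A_T: H^2(\mathbb R)\times L^2(\mathbb R)\times L^2([0,T];L^2(\mathbb R))\to E_1(T)$$ its unique continuous extension. For $u_0\in H^2(\mathbb R)$, $u_1\in L^2(\mathbb R)$ fixed, let $\mathcal B_T(g)=\mathcal A_T(u_0,u_1,g)$. Let $\mathcal C_{T,R}:E_1(T)\to E_2(T)$ be the map $$\mathcal C_{T,R}(v)=\Bigl(\bigl[(\varphi^R(v\star\theta')-\nu p)\,(v\star\theta'')\bigr]\star\theta+h\Bigr)F,$$ where $\star$ is the convolution in $x$. Then these maps are well defined (the solution and its continuous extension exist and are unique, and $\mathcal C_{T,R}$ takes its values in $E_2(T)$), and for all $u_0\in H^2(\mathbb R)$ and $u_1\in L^2(\mathbb R)$ the map $\mathcal B_T\mathcal C_{T,R}:E_1(T)\to E_1(T)$ has a fixed point. -/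

import Mathlib

open MeasureTheory Set Filter Topology
open scoped ContDiff

noncomputable section

namespace Beam

/-! ### Sobolev spaces on the real line -/

/-- The real Hilbert space `L²(ℝ)`. -/
abbrev L2 : Type := Lp ℝ 2 (volume : Measure ℝ)

/-- `g ∈ L²(ℝ)` is the weak derivative of order `j` of `f ∈ L²(ℝ)`. -/
def IsWeakDeriv (j : ℕ) (f g : L2) : Prop :=
  ∀ φ : ℝ → ℝ, ContDiff ℝ ∞ φ → HasCompactSupport φ →
    ∫ x, f x * iteratedDeriv j φ x = (-1) ^ j * ∫ x, g x * φ x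

theorem integrable_mul_test (f : L2) {φ : ℝ → ℝ} (hφ : Continuous φ)
    (hs : HasCompactSupport φ) : Integrable (fun x => f x * φ x) :=
  (Lp.memLp f).integrable_mul (q := 2) (hφ.memLp_of_hasCompactSupport hs)

theorem integrable_mul_iteratedDeriv (f : L2) (j : ℕ) {φ : ℝ → ℝ} (hφ : ContDiff ℝ ∞ φ)
    (hs : HasCompactSupport φ) : Integrable (fun x => f x * iteratedDeriv j φ x) := by
  refine integrable_mul_test f (hφ.continuous_iteratedDeriv j (by exact_mod_cast le_top)) ?_
  induction j with
  | zero => simpa using hs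
  | succ n ih => rw [iteratedDeriv_succ]; exact ih.deriv

theorem IsWeakDeriv.zero (j : ℕ) : IsWeakDeriv j 0 0 := by
  intro φ _ _
  have h1 : ∀ ψ : ℝ → ℝ, ∫ x, (0 : L2) x * ψ x = 0 := fun ψ => by
    rw [integral_congr_ae (g := fun _ => (0 : ℝ)) ?_, integral_zero]
    filter_upwards [Lp.coeFn_zero ℝ 2 (volume : Measure ℝ)] with x hx
    rw [hx]; simp
  rw [h1, h1]; simp

theorem IsWeakDeriv.add {j : ℕ} {f g f' g' : L2} (h : IsWeakDeriv j f g)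
    (h' : IsWeakDeriv j f' g') : IsWeakDeriv j (f + f') (g + g') := by
  intro φ hφ hs
  have key : ∀ (a b : L2) (ψ : ℝ → ℝ), Integrable (fun x => a x * ψ x) →
      Integrable (fun x => b x * ψ x) →
      ∫ x, (a + b : L2) x * ψ x = (∫ x, a x * ψ x) + ∫ x, b x * ψ x := by
    intro a b ψ ha hb
    rw [← integral_add ha hb]
    refine integral_congr_ae ?_
    filter_upwards [Lp.coeFn_add a b] with x hx
    rw [hx]; simp [add_mul]
  rw [key f f' _ (integrable_mul_iteratedDeriv f j hφ hs)
      (integrable_mul_iteratedDeriv f' j hφ hs),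
    key g g' _ (integrable_mul_test g hφ.continuous hs) (integrable_mul_test g' hφ.continuous hs),
    h φ hφ hs, h' φ hφ hs]
  ring

theorem IsWeakDeriv.smul {j : ℕ} {f g : L2} (c : ℝ) (h : IsWeakDeriv j f g) :
    IsWeakDeriv j (c • f) (c • g) := by
  intro φ hφ hs
  have key : ∀ (a : L2) (ψ : ℝ → ℝ), ∫ x, (c • a : L2) x * ψ x = c * ∫ x, a x * ψ x := by
    intro a ψ
    rw [← integral_const_mul]
    refine integral_congr_ae ?_
    filter_upwards [Lp.coeFn_smul c a] with x hx
    rw [hx]; simp [mul_assoc]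
  rw [key, key, h φ hφ hs]
  ring

/-- The Sobolev space `H^k(ℝ)`. An element is recorded as the tuple `(u, u', …, u^(k))` of its
weak derivatives (which are determined by `u`), so that the norm is
`(∑_{j ≤ k} ‖u^(j)‖²_{L²})^{1/2}`. -/
def H (k : ℕ) : Submodule ℝ (PiLp 2 (fun _ : Fin (k + 1) => L2)) where
  carrier := {w | ∀ j : Fin (k + 1), IsWeakDeriv j (w 0) (w j)}
  add_mem' := fun ha hb j => (ha j).add (hb j)
  zero_mem' := fun j => IsWeakDeriv.zero j
  smul_mem' := fun c _ ha j => (ha j).smul c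

/-- The weak derivative of order `j ≤ k`, as a map `H^k(ℝ) → L²(ℝ)`. -/
def wd {k : ℕ} (j : Fin (k + 1)) : H k →L[ℝ] L2 :=
  (PiLp.proj 2 (fun _ : Fin (k + 1) => L2) j).comp (H k).subtypeL

/-- The inclusion `H^k(ℝ) ⊆ L²(ℝ)`. -/
def toL2 {k : ℕ} : H k →L[ℝ] L2 := wd 0

/-- The inclusion `H^m(ℝ) ⊆ H^k(ℝ)` for `k ≤ m`. -/
def incl {k m : ℕ} (hkm : k ≤ m) : H m →L[ℝ] H k :=
  (((PiLp.continuousLinearEquiv 2 ℝ (fun _ : Fin (k + 1) => L2)).symm :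
      (Fin (k + 1) → L2) →L[ℝ] PiLp 2 (fun _ : Fin (k + 1) => L2)).comp
    (ContinuousLinearMap.pi fun j : Fin (k + 1) =>
      wd (k := m) (Fin.castLE (Nat.succ_le_succ hkm) j))).codRestrict (H k)
    (fun u j => u.2 (Fin.castLE (Nat.succ_le_succ hkm) j))

theorem toL2_incl {k m : ℕ} (hkm : k ≤ m) (u : H m) : toL2 (incl hkm u) = toL2 u := rfl

/-! ### Function spaces on `[0,T] × ℝ` -/

/-- The time interval `[0,T]`. -/
abbrev I (T : ℝ) : Type := Icc (0 : ℝ) T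

/-- `v : [0,T] → X` is the derivative of `u : [0,T] → X` at every point of `[0,T]`
(one-sided at the end points). -/
def HasTimeDeriv {X : Type*} [NormedAddCommGroup X] [NormedSpace ℝ X] {T : ℝ}
    (u v : I T → X) : Prop :=
  ∀ t : I T, HasDerivWithinAt (Function.extend Subtype.val u 0) (v t) (Icc 0 T) t

theorem HasTimeDeriv.clm {X Y : Type*} [NormedAddCommGroup X] [NormedSpace ℝ X]
    [NormedAddCommGroup Y] [NormedSpace ℝ Y] {T : ℝ} {u v : I T → X}
    (h : HasTimeDeriv u v) (L : X →L[ℝ] Y) :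
    HasTimeDeriv (fun t => L (u t)) (fun t => L (v t)) := by
  intro t
  have h1 := L.hasFDerivAt.comp_hasDerivWithinAt (t : ℝ) (h t)
  refine h1.congr_of_mem (fun s hs => ?_) t.2
  have e1 := Subtype.val_injective.extend_apply u 0 (⟨s, hs⟩ : I T)
  have e2 := Subtype.val_injective.extend_apply (fun t => L (u t)) 0 (⟨s, hs⟩ : I T)
  simp only at e1 e2
  simp only [Function.comp_apply]
  rw [e1, e2]

theorem HasTimeDeriv.zero {X : Type*} [NormedAddCommGroup X] [NormedSpace ℝ X] {T : ℝ} :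
    HasTimeDeriv (fun _ : I T => (0 : X)) (fun _ => 0) := by
  intro t
  refine (hasDerivWithinAt_const (t : ℝ) (Icc 0 T) (0 : X)).congr_of_mem (fun s hs => ?_) t.2
  exact Subtype.val_injective.extend_apply (fun _ : I T => (0 : X)) 0 ⟨s, hs⟩

theorem HasTimeDeriv.add {X : Type*} [NormedAddCommGroup X] [NormedSpace ℝ X] {T : ℝ}
    {u v u' v' : I T → X} (h : HasTimeDeriv u v) (h' : HasTimeDeriv u' v') :
    HasTimeDeriv (fun t => u t + u' t) (fun t => v t + v' t) := by
  intro t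
  refine ((h t).add (h' t)).congr_of_mem (fun s hs => ?_) t.2
  have e1 := Subtype.val_injective.extend_apply u 0 (⟨s, hs⟩ : I T)
  have e2 := Subtype.val_injective.extend_apply u' 0 (⟨s, hs⟩ : I T)
  have e3 := Subtype.val_injective.extend_apply (fun t => u t + u' t) 0 (⟨s, hs⟩ : I T)
  simp only at e1 e2 e3
  simp only [Pi.add_apply]
  rw [e1, e2, e3]

/-- `E₂(T) = C⁰([0,T]; H²(ℝ))` with the sup norm. -/
abbrev E2 (T : ℝ) : Type := C(I T, H 2)

/-- `E₁(T) = C⁰([0,T]; H²(ℝ)) ∩ C¹([0,T]; L²(ℝ))`. An element is recorded as the pair `(u, u_t)`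
(for `T > 0`, `u_t` is determined by `u`), so that the norm is
`max (sup_t ‖u(t)‖_{H²}) (sup_t ‖u_t(t)‖_{L²})`. -/
def E1 (T : ℝ) : Submodule ℝ (C(I T, H 2) × C(I T, L2)) where
  carrier := {u | HasTimeDeriv (fun t => toL2 (u.1 t)) (fun t => u.2 t)}
  add_mem' := fun ha hb => by simpa using HasTimeDeriv.add ha hb
  zero_mem' := by simpa using HasTimeDeriv.zero (X := L2) (T := T)
  smul_mem' := fun c _ ha => by
    simpa using HasTimeDeriv.clm ha (c • ContinuousLinearMap.id ℝ L2)

/-- `E₀(T) = C⁰([0,T]; H⁴(ℝ)) ∩ C¹([0,T]; H²(ℝ)) ∩ C²([0,T]; L²(ℝ))`. An element is recorded as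
the function `u` together with its time derivatives `u_t` and `u_tt`. -/
structure E0 (T : ℝ) where
  u : C(I T, H 4)
  ut : C(I T, H 2)
  utt : C(I T, L2)
  hasDeriv_u : HasTimeDeriv (fun t => incl (k := 2) (by norm_num) (u t)) (fun t => ut t)
  hasDeriv_ut : HasTimeDeriv (fun t => toL2 (ut t)) (fun t => utt t)

/-- The inclusion `E₀(T) ⊆ E₁(T)`. -/
def E0.toE1 {T : ℝ} (w : E0 T) : E1 T :=
  ⟨(((incl (k := 2) (by norm_num) : H 4 →L[ℝ] H 2) : C(H 4, H 2)).comp w.u,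
    ((toL2 : H 2 →L[ℝ] L2) : C(H 2, L2)).comp w.ut), w.hasDeriv_u.clm toL2⟩

/-- Lebesgue measure on `[0,T]`. -/
abbrev timeMeasure (T : ℝ) : Measure (I T) := Measure.comap Subtype.val (volume : Measure ℝ)

instance instIsFiniteMeasureTimeMeasure (T : ℝ) : IsFiniteMeasure (timeMeasure T) where
  measure_univ_lt_top := by
    rw [comap_subtype_coe_apply measurableSet_Icc (volume : Measure ℝ), image_univ,
      Subtype.range_coe]
    exact measure_Icc_lt_top

/-- `L²([0,T]; L²(ℝ))`. -/
abbrev L2L2 (T : ℝ) : Type := Lp L2 2 (timeMeasure T)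

/-- The inclusion `E₂(T) ⊆ L²([0,T]; L²(ℝ))`. -/
def E2.toL2L2 {T : ℝ} (g : E2 T) : L2L2 T :=
  ContinuousMap.toLp 2 (timeMeasure T) ℝ (((toL2 : H 2 →L[ℝ] L2) : C(H 2, L2)).comp g)

/-! ### The linear problem -/

/-- `F(t,x) = 1 / (1 + θ(x - ζ(t)))`. -/
def F (θ ζ : ℝ → ℝ) (t x : ℝ) : ℝ := 1 / (1 + θ (x - ζ t))

/-- `G(t,x) = - ζ̇(t) θ'(x - ζ(t)) / (1 + θ(x - ζ(t)))`. -/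
def G (T : ℝ) (θ ζ : ℝ → ℝ) (t x : ℝ) : ℝ :=
  -(derivWithin ζ (Icc 0 T) t * deriv θ (x - ζ t)) / (1 + θ (x - ζ t))

/-- `w ∈ E₀(T)` solves `u_tt + F u_xxxx + G u_t = g`, `u(0) = u₀`, `u_t(0) = u₁`. -/
def IsStrongSolution {T : ℝ} (θ ζ : ℝ → ℝ) (u₀ : H 4) (u₁ : H 2) (g : E2 T) (w : E0 T) : Prop :=
  (∀ t : I T, ∀ᵐ x : ℝ,
    w.utt t x + F θ ζ t x * wd 4 (w.u t) x + G T θ ζ t x * toL2 (w.ut t) x = toL2 (g t) x) ∧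
  ∀ t : I T, (t : ℝ) = 0 → w.u t = u₀ ∧ w.ut t = u₁

/-- `A : H²(ℝ) × L²(ℝ) × L²([0,T]; L²(ℝ)) → E₁(T)` is a continuous extension of the map
`H⁴(ℝ) × H²(ℝ) × E₂(T) → E₀(T)` that sends `(u₀, u₁, g)` to the unique solution of the linear
problem. -/
def IsSolutionOperator {T : ℝ} (θ ζ : ℝ → ℝ) (A : H 2 × L2 × L2L2 T → E1 T) : Prop :=
  Continuous A ∧
  ∀ (u₀ : H 4) (u₁ : H 2) (g : E2 T), ∃ w : E0 T,
    (∀ w' : E0 T, IsStrongSolution θ ζ u₀ u₁ g w' ↔ w' = w) ∧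
    A (incl (by norm_num) u₀, toL2 u₁, g.toL2L2) = w.toE1

/-! ### The mollified and truncated nonlinearity -/

/-- The truncation `φ^R` of the square function: smooth, even, nondecreasing on `[0,∞)`,
equal to `x²` for `|x| ≤ R` and to `(R+1)²` for `|x| ≥ R + 2`. -/
structure IsTruncation (R : ℝ) (φ : ℝ → ℝ) : Prop where
  smooth : ContDiff ℝ ∞ φ
  even : ∀ x, φ (-x) = φ x
  mono : MonotoneOn φ (Ici 0)
  eq_sq : ∀ x, |x| ≤ R → φ x = x ^ 2
  eq_const : ∀ x, R + 2 ≤ |x| → φ x = (R + 1) ^ 2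

/-- An even smooth compactly supported probability density. -/
structure IsMollifier (θ : ℝ → ℝ) : Prop where
  smooth : ContDiff ℝ ∞ θ
  compact : HasCompactSupport θ
  nonneg : ∀ x, 0 ≤ θ x
  integral_eq : ∫ x, θ x = 1
  even : ∀ x, θ (-x) = θ x

/-- Convolution on the line, `(f ⋆ g)(x) = ∫ f(y) g(x - y) dy`. -/
def conv (f g : ℝ → ℝ) : ℝ → ℝ :=
  MeasureTheory.convolution f g (ContinuousLinearMap.mul ℝ ℝ) volume

/-- The function `([(φ(v ⋆ θ') - ν p)(v ⋆ θ'')] ⋆ θ + h) F` at `(t,x)`. -/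
def nonlinearity {T : ℝ} (θ ζ φ : ℝ → ℝ) (ν : ℝ) (p h : E2 T) (v : E1 T) (t : I T) (x : ℝ) : ℝ :=
  (conv (fun y => (φ (conv (toL2 (v.1.1 t)) (deriv θ) y) - ν * toL2 (p t) y) *
      conv (toL2 (v.1.1 t)) (iteratedDeriv 2 θ) y) θ x + toL2 (h t) x) * F θ ζ t x

/-- `C : E₁(T) → E₂(T)` is the map `v ↦ ([(φ(v ⋆ θ') - ν p)(v ⋆ θ'')] ⋆ θ + h) F`. -/
def IsNonlinearOperator {T : ℝ} (θ ζ φ : ℝ → ℝ) (ν : ℝ) (p h : E2 T) (C : E1 T → E2 T) : Prop :=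
  ∀ (v : E1 T) (t : I T), ∀ᵐ x : ℝ, toL2 (C v t) x = nonlinearity θ ζ φ ν p h v t x

end Beam

end

noncomputable section

namespace Beam

open scoped RealInnerProductSpace ENNReal BoundedContinuousFunction

/-! ### Convolution of `L²` functions with test functions -/

/-! With `M = 1/F = 1 + θ(x - ζ(t))` one has `M_t = M G`, so the linear equation reads `(M u_t)_t +
u_xxxx = M g`. The energy `⟨M u_t, u_t⟩ + ‖u_xx‖² + ‖u‖²` then obeys a Grönwall inequality, since
`⟨u_xxxx, u_t⟩ = ⟨u_xx, u_xxt⟩` cancels the top order terms. This bounds a solution by the norms of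
the data in `H² × L² × L²(L²)` (`Coeffs.energy`, `Coeffs.strongSol_energy`). Uniqueness follows;
density of the regular data yields the unique continuous extension, with values in the closed
subspace `E1 T`.

Strong solutions are built from the equation for `v = u_t`, `w = u_tt - g`, which is `M(w + G v) =
-u_xxxx` differentiated in time. In it `∂²` is replaced by the bounded Yosida approximation `K_n =
∂² J_n`, `J_n = (1 - ε_n ∂²)⁻¹`, leaving a linear ODE in `L²`. The commutator estimate
`Coef.norm_ko_mul_le` keeps the bounds uniform in `n`. Approximations with different `n` differ by a
defect of size `ε_n + ε_k` (`ResolventFamily.inner_defect`) times second order quantities. These are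
controlled only for smoother data, so the data are first smoothed by a fixed `J_m`, and the first
order estimate absorbs the smoothing error uniformly in `n` (`Coeffs.regSol_cauchy`). The limit
gives `v` at energy level; integrating in time and reading `u_xxxx` off the equation recovers the
`H⁴` regularity of `u` (`Coeffs.exists_strongSol`).

For the fixed point no compactness is needed. The nonlinearity depends on `v` only through its
values in `L²`. It is locally Lipschitz there, and of linear growth because `φ` is bounded. The
linear estimate is causal: the squared `L²` distance of two solutions at time `t` is at most `C ∫₀ᵗ
‖g - g'‖²`. Hence `w ↦ (solution with source built from w)` is a Volterra map of `C([0,T]; L²)`.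
Linear growth gives an invariant set `‖w(t)‖² ≤ D e^{λt}`, on which the map is Lipschitz, and Picard
iteration converges in an exponential weight (`exists_fixedPoint_of_growth`). -/

theorem lintegral_enorm_conv_sq_le {f ψ : ℝ → ℝ} (hf : AEStronglyMeasurable f volume)
    (hψ : Continuous ψ) :
    ∫⁻ x, ‖conv f ψ x‖ₑ ^ 2 ≤
      (∫⁻ x, ‖ψ x‖ₑ) ^ 2 * ∫⁻ x, ‖f x‖ₑ ^ 2 := by
  set A := ∫⁻ x, ‖ψ x‖ₑ
  have hshift : ∀ x, ∫⁻ y, ‖ψ (x - y)‖ₑ = A := fun x =>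
    lintegral_sub_left_eq_self (fun y => ‖ψ y‖ₑ) x
  have hshift' : ∀ y, ∫⁻ x, ‖ψ (x - y)‖ₑ = A := fun y =>
    lintegral_sub_right_eq_self (fun y => ‖ψ y‖ₑ) y
  have h1 : ∀ x, ‖conv f ψ x‖ₑ ^ 2 ≤
      A * ∫⁻ y, ‖f y‖ₑ ^ 2 * ‖ψ (x - y)‖ₑ := by
    intro x
    have e1 : ‖conv f ψ x‖ₑ ≤ ∫⁻ y, ‖f y‖ₑ * ‖ψ (x - y)‖ₑ := by
      refine (enorm_integral_le_lintegral_enorm _).trans (le_of_eq ?_)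
      simp [enorm_mul]
    -- Splitting `|ψ|` into two square roots lets Cauchy–Schwarz leave `|f|²|ψ|`, to which Tonelli
    -- applies; this is Young's inequality for `L² ⋆ L¹`.
    have e2 : ∫⁻ y, ‖f y‖ₑ * ‖ψ (x - y)‖ₑ =
        ∫⁻ y, ((fun y => ‖f y‖ₑ * ‖ψ (x - y)‖ₑ ^ (1 / 2 : ℝ)) *
          (fun y => ‖ψ (x - y)‖ₑ ^ (1 / 2 : ℝ))) y := by
      refine lintegral_congr fun y => ?_
      simp only [Pi.mul_apply]
      rw [mul_assoc, ← ENNReal.rpow_add_of_nonneg _ _ (by norm_num) (by norm_num)]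
      norm_num
    have hψm : Measurable fun y => ‖ψ (x - y)‖ₑ :=
      (show Continuous fun y => ψ (x - y) by fun_prop).measurable.enorm
    have e3 := ENNReal.lintegral_mul_le_Lp_mul_Lq volume Real.HolderConjugate.two_two
      (f := fun y => ‖f y‖ₑ * ‖ψ (x - y)‖ₑ ^ (1 / 2 : ℝ))
      (g := fun y => ‖ψ (x - y)‖ₑ ^ (1 / 2 : ℝ))
      (hf.enorm.mul (hψm.pow_const _).aemeasurable) (hψm.pow_const _).aemeasurable
    have e4 := ENNReal.rpow_le_rpow (e1.trans (e2.le.trans e3)) (show (0 : ℝ) ≤ 2 by norm_num)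
    rw [ENNReal.mul_rpow_of_nonneg _ _ (by norm_num), ← ENNReal.rpow_mul, ← ENNReal.rpow_mul] at e4
    norm_num at e4
    refine e4.trans ?_
    simp only [← ENNReal.rpow_natCast, ← ENNReal.rpow_mul]
    norm_num
    rw [hshift x, mul_comm]
    gcongr with y
    rw [mul_pow, ← ENNReal.rpow_natCast (‖ψ (x - y)‖ₑ ^ _), ← ENNReal.rpow_mul]
    norm_num
  calc ∫⁻ x, ‖conv f ψ x‖ₑ ^ 2
      ≤ ∫⁻ x, A * ∫⁻ y, ‖f y‖ₑ ^ 2 * ‖ψ (x - y)‖ₑ := lintegral_mono h1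
    _ = A * ∫⁻ x, ∫⁻ y, ‖f y‖ₑ ^ 2 * ‖ψ (x - y)‖ₑ := by
        refine lintegral_const_mul'' _ ?_
        refine AEMeasurable.lintegral_prod_right' (f := fun z : ℝ × ℝ =>
          ‖f z.2‖ₑ ^ 2 * ‖ψ (z.1 - z.2)‖ₑ) ?_
        refine (hf.comp_snd.enorm.pow_const _).mul ?_
        have : Continuous fun z : ℝ × ℝ => ψ (z.1 - z.2) := by fun_prop
        exact this.measurable.enorm.aemeasurable
    _ = A * ∫⁻ y, ∫⁻ x, ‖f y‖ₑ ^ 2 * ‖ψ (x - y)‖ₑ := by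
        rw [lintegral_lintegral_swap]
        refine (hf.comp_snd.enorm.pow_const _).mul ?_
        have : Continuous fun z : ℝ × ℝ => ψ (z.1 - z.2) := by fun_prop
        exact this.measurable.enorm.aemeasurable
    _ = A * ∫⁻ y, ‖f y‖ₑ ^ 2 * A := by
        congr 1
        refine lintegral_congr fun y => ?_
        rw [lintegral_const_mul _
          (show Continuous fun x => ψ (x - y) by fun_prop).measurable.enorm, hshift']
    _ = A ^ 2 * ∫⁻ x, ‖f x‖ₑ ^ 2 := by
        rw [lintegral_mul_const'' _ (hf.enorm.pow_const _)]
        ring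

theorem lintegral_enorm_lt_top {ψ : ℝ → ℝ} (hψ : Continuous ψ) (hs : HasCompactSupport ψ) :
    ∫⁻ x, ‖ψ x‖ₑ < ⊤ :=
  (hψ.integrable_of_hasCompactSupport hs).2

theorem continuous_conv {f ψ : ℝ → ℝ} (hf : LocallyIntegrable f volume)
    (hψ : Continuous ψ) (hs : HasCompactSupport ψ) : Continuous (conv f ψ) :=
  hs.continuous_convolution_right _ hf hψ

theorem locallyIntegrable_coe (f : L2) : LocallyIntegrable f volume :=
  (Lp.memLp f).locallyIntegrable (by norm_num)

theorem eLpNorm_conv_le {f ψ : ℝ → ℝ} (hf : AEStronglyMeasurable f volume)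
    (hψ : Continuous ψ) :
    eLpNorm (conv f ψ) 2 volume ≤ (∫⁻ x, ‖ψ x‖ₑ) * eLpNorm f 2 volume := by
  rw [eLpNorm_eq_lintegral_rpow_enorm_toReal (by norm_num) (by norm_num),
    eLpNorm_eq_lintegral_rpow_enorm_toReal (by norm_num) (by norm_num)]
  simp only [ENNReal.toReal_ofNat, ENNReal.rpow_two]
  refine (ENNReal.rpow_le_rpow (lintegral_enorm_conv_sq_le hf hψ) (by norm_num)).trans ?_
  rw [ENNReal.mul_rpow_of_nonneg _ _ (by norm_num), ← ENNReal.rpow_two, ← ENNReal.rpow_mul]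
  norm_num

theorem memLp_conv (f : L2) {ψ : ℝ → ℝ} (hψ : Continuous ψ) (hs : HasCompactSupport ψ) :
    MemLp (conv f ψ) 2 volume := by
  refine ⟨(continuous_conv (locallyIntegrable_coe f) hψ hs).aestronglyMeasurable, ?_⟩
  exact (eLpNorm_conv_le (Lp.aestronglyMeasurable f) hψ).trans_lt
    (ENNReal.mul_lt_top (lintegral_enorm_lt_top hψ hs) (Lp.memLp f).2)

theorem convolutionExists_conv {f : ℝ → ℝ} (hf : LocallyIntegrable f volume) {ψ : ℝ → ℝ}
    (hψ : Continuous ψ) (hs : HasCompactSupport ψ) :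
    ConvolutionExists f ψ (ContinuousLinearMap.mul ℝ ℝ) volume :=
  hs.convolutionExists_right _ hf hψ

theorem conv_congr_left {f g : ℝ → ℝ} (h : f =ᵐ[volume] g) (ψ : ℝ → ℝ) : conv f ψ = conv g ψ := by
  funext x
  refine integral_congr_ae ?_
  filter_upwards [h] with y hy
  rw [hy]

theorem conv_add_left (f g : L2) {ψ : ℝ → ℝ} (hψ : Continuous ψ) (hs : HasCompactSupport ψ) :
    conv (f + g : L2) ψ = conv f ψ + conv g ψ := by
  rw [conv_congr_left (Lp.coeFn_add f g)]
  exact (convolutionExists_conv (locallyIntegrable_coe f) hψ hs).add_distrib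
    (convolutionExists_conv (locallyIntegrable_coe g) hψ hs)

theorem conv_smul_left (c : ℝ) (f : L2) (ψ : ℝ → ℝ) :
    conv (c • f : L2) ψ = c • conv f ψ := by
  rw [conv_congr_left (Lp.coeFn_smul c f)]
  exact smul_convolution

/-- Convolution with a continuous compactly supported function, as an operator on `L²(ℝ)`. -/
def convL (ψ : ℝ → ℝ) (hψ : Continuous ψ) (hs : HasCompactSupport ψ) : L2 →L[ℝ] L2 :=
  LinearMap.mkContinuous
    { toFun := fun f => (memLp_conv f hψ hs).toLp _
      map_add' := fun f g => by
        rw [← MemLp.toLp_add]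
        exact MemLp.toLp_congr _ _ (.of_forall fun x => by rw [conv_add_left f g hψ hs])
      map_smul' := fun c f => by
        rw [RingHom.id_apply, ← MemLp.toLp_const_smul]
        exact MemLp.toLp_congr _ _ (.of_forall fun x => by rw [conv_smul_left c f]) }
    (∫⁻ x, ‖ψ x‖ₑ).toReal
    (fun f => by
      change ‖(memLp_conv f hψ hs).toLp _‖ ≤ _
      rw [Lp.norm_toLp, Lp.norm_def, ← ENNReal.toReal_mul]
      exact ENNReal.toReal_mono (ENNReal.mul_lt_top (lintegral_enorm_lt_top hψ hs)
        (Lp.memLp f).2).ne (eLpNorm_conv_le (Lp.aestronglyMeasurable f) hψ))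

theorem coeFn_convL {ψ : ℝ → ℝ} (hψ : Continuous ψ) (hs : HasCompactSupport ψ) (f : L2) :
    convL ψ hψ hs f =ᵐ[volume] conv f ψ :=
  MemLp.coeFn_toLp (memLp_conv f hψ hs)

theorem hasDerivAt_conv (f : L2) {ψ : ℝ → ℝ} (hψ : ContDiff ℝ ∞ ψ) (hs : HasCompactSupport ψ)
    (x : ℝ) : HasDerivAt (conv f ψ) (conv f (deriv ψ) x) x :=
  hs.hasDerivAt_convolution_right _ (locallyIntegrable_coe f) (hψ.of_le (by simp)) x

theorem contDiff_deriv {ψ : ℝ → ℝ} (hψ : ContDiff ℝ ∞ ψ) : ContDiff ℝ ∞ (deriv ψ) :=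
  (contDiff_infty_iff_deriv.1 hψ).2

/-! ### Weak derivatives -/

theorem inner_eq_integral (f g : L2) : ⟪f, g⟫ = ∫ x, f x * g x := by
  rw [L2.inner_def]
  refine integral_congr_ae (.of_forall fun x => ?_)
  simp [mul_comm]

/-- A test function as an element of `L²(ℝ)`. -/
def testL2 (φ : ℝ → ℝ) (hφ : ContDiff ℝ ∞ φ) (hs : HasCompactSupport φ) : L2 :=
  (hφ.continuous.memLp_of_hasCompactSupport hs).toLp φ

theorem inner_testL2 (f : L2) {φ : ℝ → ℝ} (hφ : ContDiff ℝ ∞ φ) (hs : HasCompactSupport φ) :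
    ⟪f, testL2 φ hφ hs⟫ = ∫ x, f x * φ x := by
  rw [inner_eq_integral]
  refine integral_congr_ae ?_
  filter_upwards [MemLp.coeFn_toLp (hφ.continuous.memLp_of_hasCompactSupport (p := 2)
    (μ := volume) hs)] with x hx
  simp only [testL2]
  rw [hx]

theorem contDiff_iteratedDeriv_infty {φ : ℝ → ℝ} (hφ : ContDiff ℝ ∞ φ) (j : ℕ) :
    ContDiff ℝ ∞ (iteratedDeriv j φ) := by
  induction j with
  | zero => simpa using hφ
  | succ n ih => rw [iteratedDeriv_succ]; exact contDiff_deriv ih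

theorem hasCompactSupport_iteratedDeriv {φ : ℝ → ℝ} (hs : HasCompactSupport φ) (j : ℕ) :
    HasCompactSupport (iteratedDeriv j φ) := by
  induction j with
  | zero => simpa using hs
  | succ n ih => rw [iteratedDeriv_succ]; exact ih.deriv

theorem iteratedDeriv_iteratedDeriv_add (i j : ℕ) (φ : ℝ → ℝ) :
    iteratedDeriv i (iteratedDeriv j φ) = iteratedDeriv (i + j) φ := by
  simp only [iteratedDeriv_eq_iterate, Function.iterate_add_apply]

theorem isWeakDeriv_iff_inner {j : ℕ} {f g : L2} : IsWeakDeriv j f g ↔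
    ∀ (φ : ℝ → ℝ) (hφ : ContDiff ℝ ∞ φ) (hs : HasCompactSupport φ),
      ⟪f, testL2 _ (contDiff_iteratedDeriv_infty hφ j) (hasCompactSupport_iteratedDeriv hs j)⟫
        = (-1) ^ j * ⟪g, testL2 φ hφ hs⟫ := by
  refine forall_congr' fun φ => forall_congr' fun hφ => forall_congr' fun hs => ?_
  rw [inner_testL2, inner_testL2]

theorem eq_zero_of_integral_test {f : L2}
    (h : ∀ φ : ℝ → ℝ, ContDiff ℝ ∞ φ → HasCompactSupport φ → ∫ x, f x * φ x = 0) : f = 0 := by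
  rw [Lp.eq_zero_iff_ae_eq_zero]
  refine ae_eq_zero_of_integral_contDiff_smul_eq_zero (locallyIntegrable_coe f) fun g hg hs => ?_
  rw [← h g hg hs]
  simp [mul_comm]

theorem eq_of_inner_testL2 {f g : L2} (h : ∀ (φ : ℝ → ℝ) (hφ : ContDiff ℝ ∞ φ)
    (hs : HasCompactSupport φ), ⟪f, testL2 φ hφ hs⟫ = ⟪g, testL2 φ hφ hs⟫) : f = g := by
  rw [← sub_eq_zero]
  refine eq_zero_of_integral_test fun φ hφ hs => ?_
  rw [← inner_testL2 _ hφ hs, inner_sub_left, h, sub_self]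

theorem IsWeakDeriv.unique {j : ℕ} {f g g' : L2} (h : IsWeakDeriv j f g)
    (h' : IsWeakDeriv j f g') : g = g' := by
  refine eq_of_inner_testL2 fun φ hφ hs => ?_
  have h1 := isWeakDeriv_iff_inner.1 h φ hφ hs
  rw [isWeakDeriv_iff_inner.1 h' φ hφ hs] at h1
  exact (mul_left_cancel₀ (pow_ne_zero j (by norm_num)) h1).symm

theorem isWeakDeriv_zero_iff {f g : L2} : IsWeakDeriv 0 f g ↔ g = f := by
  have h0 : IsWeakDeriv 0 f f := fun φ _ _ => by simp
  exact ⟨fun h => h.unique h0, fun h => h ▸ h0⟩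

theorem IsWeakDeriv.trans {i j : ℕ} {f g h : L2} (h1 : IsWeakDeriv i f g)
    (h2 : IsWeakDeriv j g h) : IsWeakDeriv (i + j) f h := by
  intro φ hφ hs
  have e := h1 (iteratedDeriv j φ) (contDiff_iteratedDeriv_infty hφ j)
    (hasCompactSupport_iteratedDeriv hs j)
  rw [h2 φ hφ hs, iteratedDeriv_iteratedDeriv_add] at e
  rw [e, pow_add, mul_assoc]

theorem IsWeakDeriv.of_trans {i j : ℕ} {f g h : L2} (h1 : IsWeakDeriv i f g)
    (h2 : IsWeakDeriv (i + j) f h) : IsWeakDeriv j g h := by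
  intro φ hφ hs
  have e := h1 (iteratedDeriv j φ) (contDiff_iteratedDeriv_infty hφ j)
    (hasCompactSupport_iteratedDeriv hs j)
  rw [iteratedDeriv_iteratedDeriv_add, h2 φ hφ hs, pow_add, mul_assoc] at e
  exact (mul_left_cancel₀ (pow_ne_zero i (by norm_num)) e).symm

/-- Each instance of the defining identity is an equality of two continuous functionals of the pair.
This is what makes `H k` complete. -/
theorem isClosed_isWeakDeriv (j : ℕ) : IsClosed {p : L2 × L2 | IsWeakDeriv j p.1 p.2} := by
  simp only [isWeakDeriv_iff_inner, ofPred_forall]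
  refine isClosed_iInter fun φ => isClosed_iInter fun hφ => isClosed_iInter fun hs => ?_
  exact isClosed_eq (by fun_prop) (by fun_prop)

theorem isClosed_H (k : ℕ) : IsClosed (H k : Set (PiLp 2 (fun _ : Fin (k + 1) => L2))) := by
  have : (H k : Set (PiLp 2 (fun _ : Fin (k + 1) => L2))) =
      ⋂ j : Fin (k + 1), {w | IsWeakDeriv j (w 0) (w j)} := by
    ext w; simp only [mem_iInter]; rfl
  rw [this]
  refine isClosed_iInter fun j => ?_
  exact (isClosed_isWeakDeriv j).preimage
    (f := fun w : PiLp 2 (fun _ : Fin (k + 1) => L2) => (w 0, w j)) (by fun_prop)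

instance instCompleteSpaceH (k : ℕ) : CompleteSpace (H k) :=
  (isClosed_H k).completeSpace_coe

theorem isWeakDeriv_wd {k : ℕ} (u : H k) (j : Fin (k + 1)) :
    IsWeakDeriv j (toL2 u) (wd j u) := u.2 j

theorem toL2_injective {k : ℕ} : Function.Injective (toL2 : H k → L2) := by
  intro u v h
  refine Subtype.ext (PiLp.ext fun j => ?_)
  have hv := isWeakDeriv_wd v j
  rw [← h] at hv
  exact (isWeakDeriv_wd u j).unique hv

theorem norm_sq_H {k : ℕ} (u : H k) : ‖u‖ ^ 2 = ∑ j, ‖wd j u‖ ^ 2 := by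
  rw [Submodule.coe_norm, PiLp.norm_sq_eq_of_L2]
  rfl

/-- The element of `H^1(ℝ)` with given value and weak derivative. -/
def mkH1 (f f₁ : L2) (h : IsWeakDeriv 1 f f₁) : H 1 :=
  ⟨WithLp.toLp 2 ![f, f₁], fun j => by
    fin_cases j
    · exact isWeakDeriv_zero_iff.2 rfl
    · exact h⟩

/-- The element of `H^2(ℝ)` with given value and weak derivatives. -/
def mkH2 (f f₁ f₂ : L2) (h : IsWeakDeriv 1 f f₁) (h' : IsWeakDeriv 2 f f₂) : H 2 :=
  ⟨WithLp.toLp 2 ![f, f₁, f₂], fun j => by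
    fin_cases j
    · exact isWeakDeriv_zero_iff.2 rfl
    · exact h
    · exact h'⟩

@[simp] theorem toL2_mkH1 (f f₁ : L2) (h : IsWeakDeriv 1 f f₁) : toL2 (mkH1 f f₁ h) = f := rfl
@[simp] theorem wd_one_mkH1 (f f₁ : L2) (h : IsWeakDeriv 1 f f₁) : wd 1 (mkH1 f f₁ h) = f₁ := rfl
theorem norm_wd_le {k : ℕ} (j : Fin (k + 1)) (u : H k) : ‖wd j u‖ ≤ ‖u‖ := by
  refine le_of_sq_le_sq ?_ (norm_nonneg _)
  rw [norm_sq_H]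
  exact Finset.single_le_sum (f := fun j => ‖wd j u‖ ^ 2) (fun _ _ => sq_nonneg _)
    (Finset.mem_univ j)

/-- A continuous linear map into `H^2(ℝ)`, given by the weak derivatives of its values. -/
def mkH2L {X : Type*} [NormedAddCommGroup X] [NormedSpace ℝ X] (A A₁ A₂ : X →L[ℝ] L2)
    (h : ∀ f, IsWeakDeriv 1 (A f) (A₁ f)) (h' : ∀ f, IsWeakDeriv 2 (A f) (A₂ f)) : X →L[ℝ] H 2 :=
  (((PiLp.continuousLinearEquiv 2 ℝ (fun _ : Fin 3 => L2)).symm :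
      (Fin 3 → L2) →L[ℝ] PiLp 2 (fun _ : Fin 3 => L2)).comp
    (ContinuousLinearMap.pi ![A, A₁, A₂])).codRestrict (H 2) (fun f j => by
      fin_cases j
      · exact isWeakDeriv_zero_iff.2 rfl
      · exact h f
      · exact h' f)

theorem iteratedDeriv_comp_sub_left (j : ℕ) (ψ : ℝ → ℝ) (x : ℝ) :
    iteratedDeriv j (fun y => ψ (x - y)) = fun y => (-1) ^ j * iteratedDeriv j ψ (x - y) := by
  funext y
  rw [iteratedDeriv_comp_const_sub]
  simp

theorem hasCompactSupport_const_sub {ψ : ℝ → ℝ} (hs : HasCompactSupport ψ) (x : ℝ) :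
    HasCompactSupport fun y => ψ (x - y) :=
  hs.comp_homeomorph (Homeomorph.subLeft x)

/-- The convolution at `x` is the pairing with the test function `y ↦ ψ (x - y)`; the sign from the
reflection cancels that of the weak derivative. -/
theorem IsWeakDeriv.conv_iteratedDeriv {j : ℕ} {f g : L2} (h : IsWeakDeriv j f g) {ψ : ℝ → ℝ}
    (hψ : ContDiff ℝ ∞ ψ) (hs : HasCompactSupport ψ) :
    conv f (iteratedDeriv j ψ) = conv g ψ := by
  funext x
  have e := h (fun y => ψ (x - y)) (hψ.comp (contDiff_const.sub contDiff_id))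
    (hasCompactSupport_const_sub hs x)
  rw [iteratedDeriv_comp_sub_left] at e
  have e' : ∫ y, f y * ((-1) ^ j * iteratedDeriv j ψ (x - y)) =
      (-1) ^ j * ∫ y, f y * iteratedDeriv j ψ (x - y) := by
    rw [← integral_const_mul]
    exact integral_congr_ae (.of_forall fun y => by ring)
  rw [e'] at e
  exact mul_left_cancel₀ (pow_ne_zero j (by norm_num)) e

/-- The only `L²` solution of `f = ε f''` with `ε > 0` is zero. -/
theorem eq_zero_of_isWeakDeriv_two {ε : ℝ} (hε : 0 < ε) {f g : L2} (h : IsWeakDeriv 2 f g)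
    (hfg : f = ε • g) : f = 0 := by
  -- Mollification makes the equation classical: `k = f ⋆ ψ` satisfies `k = ε k''` with `k, k', k''`
  -- in `L²`, so `∫ k² = -ε ∫ k'² ≤ 0`.
  have key : ∀ ψ : ℝ → ℝ, ContDiff ℝ ∞ ψ → HasCompactSupport ψ → conv f ψ 0 = 0 := by
    intro ψ hψ hs
    have hψ1 := contDiff_deriv hψ
    have hψ2 := contDiff_deriv hψ1
    have e2 : conv f (deriv (deriv ψ)) = conv g ψ := by
      rw [← h.conv_iteratedDeriv hψ hs, iteratedDeriv_succ, iteratedDeriv_one]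
    have e0 : conv f ψ = ε • conv f (deriv (deriv ψ)) := by
      rw [e2]
      conv_lhs => rw [hfg]
      exact conv_smul_left ε g ψ
    have m0 := memLp_conv f hψ.continuous hs
    have m1 := memLp_conv f hψ1.continuous hs.deriv
    have m2 := memLp_conv f hψ2.continuous hs.deriv.deriv
    have ibp := integral_mul_deriv_eq_deriv_mul_of_integrable
      (fun x _ => hasDerivAt_conv f hψ hs x) (fun x _ => hasDerivAt_conv f hψ1 hs.deriv x)
      (m0.integrable_mul m2) (m1.integrable_mul m1) (m0.integrable_mul m1)
    have h1 : ∫ x, conv f ψ x * conv f ψ x = -(ε * ∫ x, conv f (deriv ψ) x * conv f (deriv ψ) x) := by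
      rw [← mul_neg, ← ibp, ← integral_const_mul]
      refine integral_congr_ae (.of_forall fun x => ?_)
      have := congrFun e0 x
      simp only [Pi.smul_apply, smul_eq_mul] at this
      simp only
      rw [mul_left_comm, ← this]
    have h2 : ∫ x, conv f ψ x * conv f ψ x = 0 := by
      refine le_antisymm ?_ (integral_nonneg fun x => mul_self_nonneg _)
      rw [h1, neg_nonpos]
      exact mul_nonneg hε.le (integral_nonneg fun x => mul_self_nonneg _)
    rw [integral_eq_zero_iff_of_nonneg (fun x => mul_self_nonneg _) (m0.integrable_mul m0)] at h2
    have h3 : conv f ψ = fun _ => 0 := by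
      refine Continuous.ae_eq_iff_eq volume
        (continuous_conv (locallyIntegrable_coe f) hψ.continuous hs) continuous_const |>.1 ?_
      filter_upwards [h2] with x hx
      simpa using hx
    rw [h3]
  refine eq_zero_of_integral_test fun φ hφ hs => ?_
  -- The value at `0` of the convolution with the reflected `φ` is `∫ f φ`.
  have := key (fun y => φ (0 - y)) (hφ.comp (contDiff_const.sub contDiff_id))
    (hasCompactSupport_const_sub hs 0)
  simpa [conv, convolution_def] using this

/-! ### The resolvent of the second derivative -/

/-- The bilinear form `⟨u, v⟩ + ε ⟨u', v'⟩` on `H^1(ℝ)`. -/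
def formH1 (ε : ℝ) : H 1 →L[ℝ] H 1 →L[ℝ] ℝ :=
  LinearMap.mkContinuous₂
    (LinearMap.mk₂ ℝ (fun u v : H 1 => ⟪toL2 u, toL2 v⟫ + ε * ⟪wd 1 u, wd 1 v⟫)
      (fun u u' v => by simp only [map_add, inner_add_left]; ring)
      (fun c u v => by simp only [map_smul, real_inner_smul_left, smul_eq_mul]; ring)
      (fun u v v' => by simp only [map_add, inner_add_right]; ring)
      (fun c u v => by simp only [map_smul, real_inner_smul_right, smul_eq_mul]; ring))
    (1 + |ε|) (fun u v => by
      have hn : ∀ (j : Fin 2) (w : H 1), ‖wd j w‖ ≤ ‖w‖ := fun j w => norm_wd_le j w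
      rw [LinearMap.mk₂_apply, Real.norm_eq_abs]
      refine (abs_add_le _ _).trans ?_
      have h1 : |⟪toL2 u, toL2 v⟫| ≤ ‖u‖ * ‖v‖ := (abs_real_inner_le_norm _ _).trans
        (mul_le_mul (hn 0 u) (hn 0 v) (norm_nonneg _) (norm_nonneg _))
      have h2 : |⟪wd 1 u, wd 1 v⟫| ≤ ‖u‖ * ‖v‖ := (abs_real_inner_le_norm _ _).trans
        (mul_le_mul (hn 1 u) (hn 1 v) (norm_nonneg _) (norm_nonneg _))
      rw [abs_mul]
      calc _ ≤ ‖u‖ * ‖v‖ + |ε| * (‖u‖ * ‖v‖) := by gcongr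
        _ = _ := by ring)

theorem formH1_apply (ε : ℝ) (u v : H 1) :
    formH1 ε u v = ⟪toL2 u, toL2 v⟫ + ε * ⟪wd 1 u, wd 1 v⟫ := rfl

theorem isCoercive_formH1 {ε : ℝ} (hε : 0 < ε) : IsCoercive (formH1 ε) := by
  refine ⟨min 1 ε, lt_min one_pos hε, fun u => ?_⟩
  rw [formH1_apply, real_inner_self_eq_norm_sq, real_inner_self_eq_norm_sq, mul_assoc, ← sq,
    norm_sq_H, Fin.sum_univ_two]
  have h1 := mul_le_mul_of_nonneg_right (min_le_left 1 ε) (sq_nonneg ‖wd (k := 1) 0 u‖)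
  have h2 := mul_le_mul_of_nonneg_right (min_le_right 1 ε) (sq_nonneg ‖wd 1 u‖)
  have e : toL2 u = wd 0 u := rfl
  rw [e]
  linarith

/-- The solution operator `f ↦ z` of `⟨z, v⟩ + ε ⟨z', v'⟩ = ⟨f, v⟩`, `v ∈ H^1(ℝ)`. -/
def resH1 (ε : ℝ) (hε : 0 < ε) : L2 →L[ℝ] H 1 :=
  ((isCoercive_formH1 hε).continuousLinearEquivOfBilin.symm : H 1 →L[ℝ] H 1).comp
    (ContinuousLinearMap.adjoint (toL2 : H 1 →L[ℝ] L2))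

theorem resH1_spec {ε : ℝ} (hε : 0 < ε) (f : L2) (v : H 1) :
    ⟪toL2 (resH1 ε hε f), toL2 v⟫ + ε * ⟪wd 1 (resH1 ε hε f), wd 1 v⟫ = ⟪f, toL2 v⟫ := by
  rw [← formH1_apply, ← IsCoercive.continuousLinearEquivOfBilin_apply (isCoercive_formH1 hε)]
  simp only [resH1, ContinuousLinearMap.comp_apply, ContinuousLinearEquiv.coe_coe,
    ContinuousLinearEquiv.apply_symm_apply]
  exact ContinuousLinearMap.adjoint_inner_left _ _ _

theorem isWeakDeriv_testL2 {φ : ℝ → ℝ} (hφ : ContDiff ℝ ∞ φ) (hs : HasCompactSupport φ) :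
    IsWeakDeriv 1 (testL2 φ hφ hs) (testL2 (deriv φ) (contDiff_deriv hφ) hs.deriv) := by
  intro χ hχ hχs
  rw [iteratedDeriv_one, ← inner_testL2 _ (contDiff_deriv hχ) hχs.deriv,
    ← inner_testL2 _ hχ hχs, real_inner_comm, real_inner_comm (testL2 χ hχ hχs),
    inner_testL2, inner_testL2]
  have e1 : ∫ x, testL2 (deriv χ) (contDiff_deriv hχ) hχs.deriv x * φ x =
      ∫ x, φ x * deriv χ x := by
    refine integral_congr_ae ?_
    filter_upwards [MemLp.coeFn_toLp ((contDiff_deriv hχ).continuous.memLp_of_hasCompactSupport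
      (p := 2) (μ := volume) hχs.deriv)] with x hx
    simp only [testL2]
    rw [hx, mul_comm]
  have e2 : ∫ x, testL2 χ hχ hχs x * deriv φ x = ∫ x, deriv φ x * χ x := by
    refine integral_congr_ae ?_
    filter_upwards [MemLp.coeFn_toLp (hχ.continuous.memLp_of_hasCompactSupport
      (p := 2) (μ := volume) hχs)] with x hx
    simp only [testL2]
    rw [hx, mul_comm]
  rw [e1, e2, pow_one, neg_one_mul]
  have hd : ∀ {ψ : ℝ → ℝ}, ContDiff ℝ ∞ ψ → ∀ x, HasDerivAt ψ (deriv ψ x) x := fun h x =>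
    (h.differentiable (by simp) x).hasDerivAt
  have hm : ∀ {ψ : ℝ → ℝ}, ContDiff ℝ ∞ ψ → HasCompactSupport ψ → MemLp ψ 2 volume :=
    fun h h' => h.continuous.memLp_of_hasCompactSupport h'
  exact integral_mul_deriv_eq_deriv_mul_of_integrable (fun x _ => hd hφ x) (fun x _ => hd hχ x)
    ((hm hφ hs).integrable_mul (hm (contDiff_deriv hχ) hχs.deriv))
    ((hm (contDiff_deriv hφ) hs.deriv).integrable_mul (hm hχ hχs))
    ((hm hφ hs).integrable_mul (hm hχ hχs))

/-- Test functions lie in `H 1`, and the variational equation tested against them says `z'' = ε⁻¹ (z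
- f)` weakly. -/
theorem isWeakDeriv_resH1 {ε : ℝ} (hε : 0 < ε) (f : L2) :
    IsWeakDeriv 1 (wd 1 (resH1 ε hε f)) (ε⁻¹ • (toL2 (resH1 ε hε f) - f)) := by
  intro φ hφ hs
  have h := resH1_spec hε f (mkH1 _ _ (isWeakDeriv_testL2 hφ hs))
  rw [toL2_mkH1, wd_one_mkH1] at h
  rw [iteratedDeriv_one, ← inner_testL2 _ (contDiff_deriv hφ) hs.deriv, ← inner_testL2 _ hφ hs,
    inner_smul_left, inner_sub_left, ← h]
  simp only [conj_trivial]
  field_simp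
  ring

/-- The resolvent `(1 - ε ∂²)⁻¹ : L²(ℝ) → H²(ℝ)`. -/
def res (ε : ℝ) (hε : 0 < ε) : L2 →L[ℝ] H 2 :=
  mkH2L (toL2.comp (resH1 ε hε)) ((wd 1).comp (resH1 ε hε))
    (ε⁻¹ • (toL2.comp (resH1 ε hε) - ContinuousLinearMap.id ℝ L2))
    (fun f => isWeakDeriv_wd (resH1 ε hε f) 1)
    (fun f => (isWeakDeriv_wd (resH1 ε hε f) 1).trans (isWeakDeriv_resH1 hε f))

theorem wd_two_res {ε : ℝ} (hε : 0 < ε) (f : L2) :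
    wd 2 (res ε hε f) = ε⁻¹ • (toL2 (res ε hε f) - f) := rfl

theorem toL2_res {ε : ℝ} (hε : 0 < ε) (f : L2) :
    toL2 (res ε hε f) = f + ε • wd 2 (res ε hε f) := by
  rw [wd_two_res, smul_inv_smul₀ hε.ne']
  abel

/-- For functions in the range of the resolvent, integration by parts is the variational equation
rewritten. -/
theorem inner_wd_one_res {ε : ℝ} (hε : 0 < ε) (f : L2) (v : H 1) :
    ⟪wd 1 (res ε hε f), wd 1 v⟫ = -⟪wd 2 (res ε hε f), toL2 v⟫ := by
  have h := resH1_spec hε f v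
  rw [wd_two_res, real_inner_smul_left, inner_sub_left]
  change ⟪wd 1 (resH1 ε hε f), wd 1 v⟫ = -(ε⁻¹ * (⟪toL2 (resH1 ε hε f), toL2 v⟫ - ⟪f, toL2 v⟫))
  rw [← h]
  field_simp
  ring

/-- `1 - ε ∂²` is inverted by the resolvent. -/
theorem res_of_H2 {ε : ℝ} (hε : 0 < ε) (u : H 2) :
    res ε hε (toL2 u - ε • wd 2 u) = u := by
  refine toL2_injective ?_
  set z := res ε hε (toL2 u - ε • wd 2 u) with hz
  have h1 := toL2_res hε (toL2 u - ε • wd 2 u)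
  rw [← hz] at h1
  rw [← sub_eq_zero]
  refine eq_zero_of_isWeakDeriv_two hε (isWeakDeriv_wd (z - u) 2) ?_
  rw [map_sub, h1, smul_sub]
  abel

/-- Every `H²` function is a resolvent, so the integration by parts known on the range of `res`
holds on all of `H 2`. -/
theorem exists_res {ε : ℝ} (hε : 0 < ε) (u : H 2) : ∃ f, res ε hε f = u := ⟨_, res_of_H2 hε u⟩

/-- Integration by parts. -/
theorem inner_wd_one (u : H 2) (v : H 1) : ⟪wd 1 u, wd 1 v⟫ = -⟪wd 2 u, toL2 v⟫ := by
  obtain ⟨f, rfl⟩ := exists_res one_pos u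
  exact inner_wd_one_res _ f v

theorem inner_wd_one' (u v : H 2) : ⟪wd 1 u, wd 1 v⟫ = -⟪wd 2 u, toL2 v⟫ :=
  inner_wd_one u (incl (by norm_num) v)

theorem inner_wd_two_comm (u v : H 2) : ⟪wd 2 u, toL2 v⟫ = ⟪toL2 u, wd 2 v⟫ := by
  rw [real_inner_comm _ (toL2 u)]
  have h1 := inner_wd_one' u v
  have h2 := inner_wd_one' v u
  rw [real_inner_comm] at h2
  linarith

theorem norm_wd_one_sq_le (u : H 2) : ‖wd 1 u‖ ^ 2 ≤ ‖wd 2 u‖ * ‖toL2 u‖ := by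
  rw [← real_inner_self_eq_norm_sq, inner_wd_one', ← inner_neg_left]
  exact (real_inner_le_norm _ _).trans (by rw [norm_neg])

theorem norm_wd_one_le (u : H 2) : ‖wd 1 u‖ ≤ ‖toL2 u‖ + ‖wd 2 u‖ := by
  refine le_of_sq_le_sq ((norm_wd_one_sq_le u).trans ?_) (by positivity)
  nlinarith [norm_nonneg (wd 2 u), norm_nonneg (toL2 u)]

/-- The interpolation `‖u'‖² ≤ ‖u''‖ ‖u‖` makes the middle derivative redundant, so energies control
only `u` and `u''`. -/
theorem norm_H2_le (u : H 2) : ‖u‖ ≤ 2 * (‖toL2 u‖ + ‖wd 2 u‖) := by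
  refine le_of_sq_le_sq ?_ (by positivity)
  rw [norm_sq_H, Fin.sum_univ_three]
  change ‖toL2 u‖ ^ 2 + ‖wd 1 u‖ ^ 2 + ‖wd 2 u‖ ^ 2 ≤ _
  nlinarith [norm_wd_one_sq_le u, norm_nonneg (wd 2 u), norm_nonneg (toL2 u)]

/-- Pairing `f = z - ε z''` with `z` gives `‖z‖² + ε ‖z'‖² = ⟨f, z⟩`. -/
theorem norm_toL2_res_le {ε : ℝ} (hε : 0 < ε) (f : L2) : ‖toL2 (res ε hε f)‖ ≤ ‖f‖ := by
  set z := res ε hε f with hz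
  have h1 : f = toL2 z - ε • wd 2 z := by rw [hz, toL2_res hε f]; abel
  have h2 : ‖toL2 z‖ ^ 2 + ε * ‖wd 1 z‖ ^ 2 = ⟪f, toL2 z⟫ := by
    have h3 : ⟪f, toL2 z⟫ = ⟪toL2 z - ε • wd 2 z, toL2 z⟫ := by rw [← h1]
    rw [h3, inner_sub_left, real_inner_smul_left, real_inner_self_eq_norm_sq,
      ← real_inner_self_eq_norm_sq (wd 1 z), inner_wd_one']
    ring
  have h4 := real_inner_le_norm f (toL2 z)
  by_contra hlt
  push Not at hlt
  nlinarith [mul_nonneg hε.le (sq_nonneg ‖wd 1 z‖), norm_nonneg f, norm_nonneg (toL2 z)]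

/-- The resolvent commutes with the second derivative. -/
theorem wd_two_res_H2 {ε : ℝ} (hε : 0 < ε) (u : H 2) :
    wd 2 (res ε hε (toL2 u)) = toL2 (res ε hε (wd 2 u)) := by
  set z := res ε hε (toL2 u) with hz
  -- This `y` represents `z''` and belongs to `H²`; since `y - ε y'' = u''`, it is the resolvent of
  -- `u''`.
  set y : H 2 := ε⁻¹ • (z - u) with hy
  have h1 : wd 2 z = toL2 y := by rw [hz, wd_two_res, hy, map_smul, map_sub]
  have h2 : toL2 y - ε • wd 2 y = wd 2 u := by
    rw [hy, map_smul, map_sub, map_smul, smul_inv_smul₀ hε.ne', ← map_sub, ← map_smul, ← hy, ← h1,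
      map_sub]
    abel
  rw [h1, ← h2, res_of_H2]

/-! ### The family of resolvents -/

/-- The parameter sequence `1 / (n + 1)`. -/
def eps (n : ℕ) : ℝ := 1 / ((n : ℝ) + 1)

theorem eps_pos (n : ℕ) : 0 < eps n := Nat.one_div_pos_of_nat

theorem tendsto_eps : Tendsto eps atTop (𝓝 0) := tendsto_one_div_add_atTop_nhds_zero_nat

theorem eps_le_one (n : ℕ) : eps n ≤ 1 := by
  rw [eps, div_le_one (by positivity)]
  linarith [n.cast_nonneg (α := ℝ)]

/-- `(1 - εₙ ∂²)⁻¹` as an operator on `L²(ℝ)`. -/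
def jo (n : ℕ) : L2 →L[ℝ] L2 := toL2.comp (res (eps n) (eps_pos n))

/-- `∂² (1 - εₙ ∂²)⁻¹` as an operator on `L²(ℝ)`. -/
def ko (n : ℕ) : L2 →L[ℝ] L2 := (wd 2).comp (res (eps n) (eps_pos n))

theorem jo_apply (n : ℕ) (f : L2) : jo n f = f + eps n • ko n f := toL2_res _ f

theorem norm_jo_le (n : ℕ) (f : L2) : ‖jo n f‖ ≤ ‖f‖ := norm_toL2_res_le _ f

theorem ko_H2 (n : ℕ) (u : H 2) : ko n (toL2 u) = jo n (wd 2 u) := wd_two_res_H2 _ u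

theorem ko_jo (n m : ℕ) (f : L2) : ko n (jo m f) = jo n (ko m f) :=
  ko_H2 n (res (eps m) (eps_pos m) f)

/-- Symmetry of `∂²` on `H²` passes to `K_n` by writing `f = J_n f - ε_n K_n f`: the extra terms are
symmetric. -/
theorem inner_ko_comm (n : ℕ) (f g : L2) : ⟪ko n f, g⟫ = ⟪f, ko n g⟫ := by
  have hf : ∀ f : L2, f = jo n f - eps n • ko n f := fun f => by rw [jo_apply]; abel
  have h1 : ⟪ko n f, jo n g⟫ = ⟪jo n f, ko n g⟫ := inner_wd_two_comm _ _
  calc ⟪ko n f, g⟫ = ⟪ko n f, jo n g - eps n • ko n g⟫ := by rw [← hf]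
    _ = ⟪jo n f - eps n • ko n f, ko n g⟫ := by
      rw [inner_sub_left, inner_sub_right, h1, real_inner_smul_left, real_inner_smul_right]
    _ = ⟪f, ko n g⟫ := by rw [← hf]

theorem eq_zero_of_toL2_res_eq_zero {ε : ℝ} (hε : 0 < ε) {f : L2} (h : toL2 (res ε hε f) = 0) :
    f = 0 := by
  have h1 := toL2_res hε f
  have h2 : res ε hε f = 0 := toL2_injective (by rw [h, map_zero])
  rw [h2] at h1
  simpa using h1.symm

theorem jo_injective (n : ℕ) : Function.Injective (jo n) := by
  intro f g h
  rw [← sub_eq_zero]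
  refine eq_zero_of_toL2_res_eq_zero (eps_pos n) ?_
  rw [map_sub, map_sub]
  exact sub_eq_zero.2 h

/-- If `g` is orthogonal to `H²`, pairing it with its own resolvent `z` gives `0 = ⟨z, z - z''⟩ =
‖z‖² + ‖z'‖²`. -/
theorem denseRange_toL2_H2 : DenseRange (toL2 : H 2 → L2) := by
  have h : (LinearMap.range (toL2 : H 2 →L[ℝ] L2).toLinearMap).topologicalClosure = ⊤ := by
    rw [Submodule.topologicalClosure_eq_top_iff, Submodule.eq_bot_iff]
    intro g hg
    have h0 : ⟪toL2 (res 1 one_pos g), g⟫ = 0 := hg _ ⟨res 1 one_pos g, rfl⟩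
    have h1 := toL2_res one_pos g
    set z := res 1 one_pos g with hz
    have h2 : g = toL2 z - wd 2 z := by rw [h1, one_smul]; abel
    have h3 : ‖toL2 z‖ ^ 2 + ‖wd 1 z‖ ^ 2 = 0 := by
      rw [← h0]
      conv_rhs => rw [h2]
      rw [inner_sub_right, ← real_inner_self_eq_norm_sq, ← real_inner_self_eq_norm_sq,
        inner_wd_one', real_inner_comm (wd 2 z) (toL2 z)]
      ring
    have h4 : toL2 z = 0 := by
      have : ‖toL2 z‖ ^ 2 = 0 := by nlinarith [sq_nonneg ‖toL2 z‖, sq_nonneg ‖wd 1 z‖]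
      simpa using this
    exact eq_zero_of_toL2_res_eq_zero one_pos h4
  intro x
  have hx : x ∈ (LinearMap.range (toL2 : H 2 →L[ℝ] L2).toLinearMap).topologicalClosure := by
    rw [h]; trivial
  exact hx

theorem norm_jo_sub_le (n : ℕ) (u : H 2) : ‖jo n (toL2 u) - toL2 u‖ ≤ eps n * ‖wd 2 u‖ := by
  rw [jo_apply, add_sub_cancel_left, norm_smul, Real.norm_of_nonneg (eps_pos n).le, ko_H2]
  exact mul_le_mul_of_nonneg_left (norm_jo_le _ _) (eps_pos n).le

/-- On `H²` the error is at most `ε_n ‖u''‖`; the `J_n` are contractions and `H²` is dense. -/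
theorem tendsto_jo (f : L2) : Tendsto (fun n => jo n f) atTop (𝓝 f) := by
  rw [Metric.tendsto_atTop]
  intro δ hδ
  obtain ⟨_, hu, u, rfl⟩ := Metric.dense_iff.1 denseRange_toL2_H2 f (δ / 3) (by positivity)
  have h1 : Tendsto (fun n => eps n * ‖wd 2 u‖) atTop (𝓝 0) := by
    simpa using tendsto_eps.mul_const ‖wd 2 u‖
  obtain ⟨N, hN⟩ := (h1.eventually_lt_const (show (0 : ℝ) < δ / 3 by positivity)).exists_forall_of_atTop
  refine ⟨N, fun n hn => ?_⟩
  rw [Metric.mem_ball, dist_eq_norm] at hu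
  have h2 : jo n f - f = jo n (f - toL2 u) + (jo n (toL2 u) - toL2 u) + (toL2 u - f) := by
    rw [map_sub]; abel
  have h3 := norm_jo_le n (f - toL2 u)
  rw [norm_sub_rev] at hu
  rw [dist_eq_norm, h2]
  have h4 := norm_jo_sub_le n u
  have h5 := hN n hn
  rw [norm_sub_rev] at hu
  rw [norm_sub_rev] at hu
  have h6 := norm_add₃_le (a := jo n (f - toL2 u)) (b := jo n (toL2 u) - toL2 u) (c := toL2 u - f)
  rw [norm_sub_rev (toL2 u) f] at h6
  linarith

/-- If `v ∈ L²(ℝ)` satisfies `∂² Jₙ v = Jₙ y`, then `v ∈ H²(ℝ)` and `v'' = y`. -/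
theorem eq_res_of_ko_eq {v y : L2} (n : ℕ) (h : ko n v = jo n y) :
    v = toL2 (res (eps n) (eps_pos n) (v - eps n • y)) ∧
      y = wd 2 (res (eps n) (eps_pos n) (v - eps n • y)) := by
  -- This is where membership in `H²` comes from: `J_n v - ε_n J_n y = J_n v - ε_n K_n v = v`, so
  -- `v` is a resolvent.
  have h1 : jo n (v - eps n • y) = v := by
    rw [map_sub, map_smul, ← h, jo_apply]; abel
  refine ⟨h1.symm, ?_⟩
  change y = ko n (v - eps n • y)
  refine jo_injective n ?_
  rw [← ko_jo, h1, h]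

/-! ### Multiplication operators -/

theorem memLp_bcf_mul (a : ℝ →ᵇ ℝ) (f : L2) : MemLp (fun x => a x * f x) 2 volume := by
  refine (Lp.memLp f).of_le_mul (c := ‖a‖)
    (a.continuous.aestronglyMeasurable.mul (Lp.aestronglyMeasurable f)) (.of_forall fun x => ?_)
  rw [norm_mul]
  exact mul_le_mul_of_nonneg_right (a.norm_coe_le_norm x) (norm_nonneg _)

theorem coeFn_toLp_bcf_mul (a : ℝ →ᵇ ℝ) (f : L2) :
    (memLp_bcf_mul a f).toLp _ =ᵐ[volume] fun x => a x * f x := MemLp.coeFn_toLp _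

/-- Multiplication of `L²` functions by bounded continuous functions. -/
def mulL : (ℝ →ᵇ ℝ) →L[ℝ] L2 →L[ℝ] L2 :=
  LinearMap.mkContinuous₂
    (LinearMap.mk₂ ℝ (fun (a : ℝ →ᵇ ℝ) (f : L2) => (memLp_bcf_mul a f).toLp _)
      (fun a b f => by
        rw [← MemLp.toLp_add]
        exact MemLp.toLp_congr _ _ (.of_forall fun x => by simp [add_mul]))
      (fun c a f => by
        rw [← MemLp.toLp_const_smul]
        exact MemLp.toLp_congr _ _ (.of_forall fun x => by simp [mul_assoc]))
      (fun a f g => by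
        rw [← MemLp.toLp_add]
        refine MemLp.toLp_congr _ _ ?_
        filter_upwards [Lp.coeFn_add f g] with x hx
        rw [hx]; simp [mul_add])
      (fun c a f => by
        rw [← MemLp.toLp_const_smul]
        refine MemLp.toLp_congr _ _ ?_
        filter_upwards [Lp.coeFn_smul c f] with x hx
        rw [hx]; simp [mul_left_comm]))
    1 (fun a f => by
      rw [one_mul]
      refine Lp.norm_le_mul_norm_of_ae_le_mul ?_
      filter_upwards [coeFn_toLp_bcf_mul a f] with x hx
      rw [LinearMap.mk₂_apply, hx, norm_mul]
      exact mul_le_mul_of_nonneg_right (a.norm_coe_le_norm x) (norm_nonneg _))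

theorem coeFn_mulL (a : ℝ →ᵇ ℝ) (f : L2) : mulL a f =ᵐ[volume] fun x => a x * f x :=
  coeFn_toLp_bcf_mul a f

theorem norm_mulL_apply_le (a : ℝ →ᵇ ℝ) (f : L2) : ‖mulL a f‖ ≤ ‖a‖ * ‖f‖ := by
  refine Lp.norm_le_mul_norm_of_ae_le_mul ?_
  filter_upwards [coeFn_mulL a f] with x hx
  rw [hx, norm_mul]
  exact mul_le_mul_of_nonneg_right (a.norm_coe_le_norm x) (norm_nonneg _)

theorem mulL_mulL (a b : ℝ →ᵇ ℝ) (f : L2) : mulL a (mulL b f) = mulL (a * b) f := by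
  refine Lp.ext ?_
  filter_upwards [coeFn_mulL a (mulL b f), coeFn_mulL b f, coeFn_mulL (a * b) f] with x h1 h2 h3
  rw [h1, h2, h3]; simp [mul_assoc]

theorem mulL_one (f : L2) : mulL 1 f = f := by
  refine Lp.ext ?_
  filter_upwards [coeFn_mulL 1 f] with x h1
  rw [h1]; simp

theorem inner_mulL_comm (a : ℝ →ᵇ ℝ) (f g : L2) : ⟪mulL a f, g⟫ = ⟪f, mulL a g⟫ := by
  rw [inner_eq_integral, inner_eq_integral]
  refine integral_congr_ae ?_
  filter_upwards [coeFn_mulL a f, coeFn_mulL a g] with x h1 h2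
  rw [h1, h2]; ring

theorem inner_mulL_ge {a : ℝ →ᵇ ℝ} {c : ℝ} (h : ∀ x, c ≤ a x) (f : L2) :
    c * ‖f‖ ^ 2 ≤ ⟪mulL a f, f⟫ := by
  have hi : ∀ b : ℝ →ᵇ ℝ, Integrable (fun x => b x * f x * f x) := fun b =>
    (memLp_bcf_mul b f).integrable_mul (Lp.memLp f)
  have h1 : ⟪mulL a f, f⟫ = ∫ x, a x * f x * f x := by
    rw [inner_eq_integral]
    refine integral_congr_ae ?_
    filter_upwards [coeFn_mulL a f] with x h1
    rw [h1]
  rw [h1, ← real_inner_self_eq_norm_sq, inner_eq_integral, ← integral_const_mul]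
  refine integral_mono_ae (by simpa [mul_assoc] using hi (BoundedContinuousFunction.const ℝ c))
    (hi a) (.of_forall fun x => ?_)
  simp only
  nlinarith [mul_le_mul_of_nonneg_right (h x) (mul_self_nonneg (f x))]

/-- The product `a φ` is again a test function; using it in the identity for `f` gives the Leibniz
rule. -/
theorem IsWeakDeriv.mulL {a a' : ℝ →ᵇ ℝ} (ha : ContDiff ℝ ∞ a) (ha' : ∀ x, a' x = deriv a x)
    {f f₁ : L2} (h : IsWeakDeriv 1 f f₁) :
    IsWeakDeriv 1 (mulL a f) (mulL a' f + mulL a f₁) := by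
  intro φ hφ hs
  have hs' : HasCompactSupport (fun x => a x * φ x) := hs.mul_left
  have e := h (fun x => a x * φ x) (ha.mul hφ) hs'
  have hd : deriv (fun x => a x * φ x) = fun x => a' x * φ x + a x * deriv φ x := by
    funext x
    rw [deriv_fun_mul (ha.differentiable (by simp) x) (hφ.differentiable (by simp) x), ha']
  rw [iteratedDeriv_one, hd] at e
  have hφ' := contDiff_deriv hφ
  have i1 : Integrable fun x => f x * (a' x * φ x) :=
    integrable_mul_test f (a'.continuous.mul hφ.continuous) hs.mul_left
  have i2 : Integrable fun x => f x * (a x * deriv φ x) :=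
    integrable_mul_test f (a.continuous.mul hφ'.continuous) hs.deriv.mul_left
  have i3 : Integrable fun x => f₁ x * (a x * φ x) :=
    integrable_mul_test f₁ (a.continuous.mul hφ.continuous) hs'
  have e1 : ∫ x, f x * (a' x * φ x + a x * deriv φ x) =
      (∫ x, f x * (a' x * φ x)) + ∫ x, f x * (a x * deriv φ x) := by
    rw [← integral_add i1 i2]
    exact integral_congr_ae (.of_forall fun x => mul_add _ _ _)
  have e2 : ∫ x, Beam.mulL a f x * iteratedDeriv 1 φ x = ∫ x, f x * (a x * deriv φ x) := by
    refine integral_congr_ae ?_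
    filter_upwards [coeFn_mulL a f] with x hx
    rw [hx, iteratedDeriv_one]; ring
  have e3 : ∫ x, (Beam.mulL a' f + Beam.mulL a f₁ : L2) x * φ x =
      (∫ x, f x * (a' x * φ x)) + ∫ x, f₁ x * (a x * φ x) := by
    rw [← integral_add i1 i3]
    refine integral_congr_ae ?_
    filter_upwards [Lp.coeFn_add (Beam.mulL a' f) (Beam.mulL a f₁), coeFn_mulL a' f,
      coeFn_mulL a f₁] with x h1 h2 h3
    rw [h1, Pi.add_apply, h2, h3]; ring
  rw [e2, e3]
  rw [e1] at e
  linarith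

/-- Multiplication by a smooth function on `H²(ℝ)`. -/
def mulH2 (a a' a'' : ℝ →ᵇ ℝ) (ha : ContDiff ℝ ∞ a) (ha' : ∀ x, a' x = deriv a x)
    (ha'' : ∀ x, a'' x = deriv a' x) : H 2 →L[ℝ] H 2 :=
  mkH2L ((mulL a).comp (toL2 (k := 2)))
    ((mulL a').comp (toL2 (k := 2)) + (mulL a).comp (wd (k := 2) 1))
    ((mulL a'').comp (toL2 (k := 2)) + (2 : ℝ) • (mulL a').comp (wd (k := 2) 1) +
      (mulL a).comp (wd (k := 2) 2))
    (fun u => (isWeakDeriv_wd u 1).mulL ha ha')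
    (fun u => by
      have hs : ContDiff ℝ ∞ a' := (funext ha' : (a' : ℝ → ℝ) = deriv a) ▸ contDiff_deriv ha
      have h1 := isWeakDeriv_wd u 1
      have h2 : IsWeakDeriv 1 (wd 1 u) (wd 2 u) := h1.of_trans (isWeakDeriv_wd u 2)
      have h3 := (h1.mulL ha ha').trans ((h1.mulL hs ha'').add (h2.mulL ha ha'))
      have e : mulL a'' (toL2 u) + mulL a' (wd 1 u) + (mulL a' (wd 1 u) + mulL a (wd 2 u)) =
          mulL a'' (toL2 u) + (2 : ℝ) • mulL a' (wd 1 u) + mulL a (wd 2 u) := by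
        rw [two_smul]; abel
      rw [e] at h3
      exact h3)

/-! ### Smooth coefficients that are constant outside a compact set -/

/-- Smooth functions that are constant outside a compact set. -/
structure Coef (Θ : ℝ → ℝ) : Prop where
  smooth : ContDiff ℝ ∞ Θ
  compact : ∃ c : ℝ, HasCompactSupport fun x => Θ x - c

namespace Coef

variable {Θ Ξ : ℝ → ℝ}

theorem of_compact (h : ContDiff ℝ ∞ Θ) (hs : HasCompactSupport Θ) : Coef Θ :=
  ⟨h, 0, by simpa using hs⟩

theorem deriv_compact (h : Coef Θ) : HasCompactSupport (deriv Θ) := by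
  obtain ⟨c, hc⟩ := h.compact
  have : deriv Θ = deriv fun x => Θ x - c := by
    funext x
    rw [deriv_sub_const]
  rw [this]
  exact hc.deriv

theorem deriv (h : Coef Θ) : Coef (deriv Θ) := of_compact (contDiff_deriv h.smooth) h.deriv_compact

theorem bounded (h : Coef Θ) : ∃ C, ∀ x, ‖Θ x‖ ≤ C := by
  obtain ⟨c, hc⟩ := h.compact
  obtain ⟨C, hC⟩ := (h.smooth.continuous.sub continuous_const).bounded_above_of_compact_support hc
  refine ⟨C + ‖c‖, fun x => ?_⟩
  have := norm_add_le (Θ x - c) c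
  rw [sub_add_cancel] at this
  exact this.trans (add_le_add_left (hC x) _)

/-- A bound for a coefficient. -/
def bound (h : Coef Θ) : ℝ := h.bounded.choose

theorem norm_le_bound (h : Coef Θ) (x : ℝ) : ‖Θ x‖ ≤ h.bound := h.bounded.choose_spec x

theorem bound_nonneg (h : Coef Θ) : 0 ≤ h.bound := (norm_nonneg _).trans (h.norm_le_bound 0)

/-- The translated coefficient `x ↦ Θ(x - s)`. -/
def shift (h : Coef Θ) (s : ℝ) : ℝ →ᵇ ℝ :=
  BoundedContinuousFunction.ofNormedAddCommGroup (fun x => Θ (x - s))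
    (h.smooth.continuous.comp (continuous_id.sub continuous_const)) h.bound
    (fun _ => h.norm_le_bound _)

@[simp] theorem shift_apply (h : Coef Θ) (s x : ℝ) : h.shift s x = Θ (x - s) := rfl

theorem norm_shift_le (h : Coef Θ) (s : ℝ) : ‖h.shift s‖ ≤ h.bound :=
  BoundedContinuousFunction.norm_ofNormedAddCommGroup_le _ h.bound_nonneg _

theorem contDiff_shift (h : Coef Θ) (s : ℝ) : ContDiff ℝ ∞ (h.shift s) :=
  h.smooth.comp (contDiff_id.sub contDiff_const)

theorem shift_deriv (h : Coef Θ) (s x : ℝ) : h.deriv.shift s x = _root_.deriv (h.shift s) x := by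
  have : (h.shift s : ℝ → ℝ) = fun x => Θ (x - s) := rfl
  rw [this, deriv_comp_sub_const, shift_apply]

/-- Differentiability is in the sup norm: since `Θ''` is bounded, the Taylor remainder is quadratic
uniformly in `x`. It makes the multiplication operators differentiable in operator norm. -/
theorem hasDerivAt_shift (h : Coef Θ) (s : ℝ) :
    HasDerivAt (fun s => h.shift s) (-h.deriv.shift s) s := by
  have hd : ∀ x, HasDerivAt Θ (_root_.deriv Θ x) x := fun x =>
    (h.smooth.differentiable (by simp) x).hasDerivAt
  have hd' : ∀ x, HasDerivAt (_root_.deriv Θ) (_root_.deriv (_root_.deriv Θ) x) x := fun x =>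
    (h.deriv.smooth.differentiable (by simp) x).hasDerivAt
  have hlip : ∀ x y, ‖_root_.deriv Θ x - _root_.deriv Θ y‖ ≤ h.deriv.deriv.bound * ‖x - y‖ :=
    fun x y => convex_univ.norm_image_sub_le_of_norm_hasDerivWithin_le
      (fun x _ => (hd' x).hasDerivWithinAt) (fun x _ => h.deriv.deriv.norm_le_bound x)
      (mem_univ _) (mem_univ _)
  have key : ∀ r, ‖h.shift r - h.shift s - (r - s) • -h.deriv.shift s‖ ≤
      h.deriv.deriv.bound * ‖r - s‖ * ‖r - s‖ := by
    intro r
    refine (BoundedContinuousFunction.norm_le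
      (by have := h.deriv.deriv.bound_nonneg; positivity)).2 fun x => ?_
    -- Mean value inequality for `τ ↦ Θ (x - τ) + τ Θ' (x - s)`, whose derivative is at most `sup
    -- |Θ''| |r - s|` between `s` and `r`.
    have h1 := (convex_uIcc s r).norm_image_sub_le_of_norm_hasDerivWithin_le
      (f := fun τ => Θ (x - τ) + τ * _root_.deriv Θ (x - s))
      (f' := fun τ => -_root_.deriv Θ (x - τ) + _root_.deriv Θ (x - s))
      (C := h.deriv.deriv.bound * ‖r - s‖) (x := s) (y := r)
      (fun τ _ => by
        have e1 : HasDerivAt (fun τ => Θ (x - τ)) (-_root_.deriv Θ (x - τ)) τ := by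
          have := HasDerivAt.comp τ (hd (x - τ)) ((hasDerivAt_id τ).const_sub x)
          rwa [mul_neg_one] at this
        have e2 : HasDerivAt (fun τ => τ * _root_.deriv Θ (x - s)) (_root_.deriv Θ (x - s)) τ := by
          simpa using (hasDerivAt_id τ).mul_const (_root_.deriv Θ (x - s))
        exact (e1.add e2).hasDerivWithinAt)
      (fun τ hτ => by
        have e1 := hlip (x - s) (x - τ)
        rw [neg_add_eq_sub]
        refine e1.trans (mul_le_mul_of_nonneg_left ?_ h.deriv.deriv.bound_nonneg)
        rw [sub_sub_sub_cancel_left]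
        exact abs_sub_left_of_mem_uIcc hτ)
      left_mem_uIcc right_mem_uIcc
    refine le_of_eq_of_le ?_ h1
    congr 1
    simp only [BoundedContinuousFunction.coe_sub, BoundedContinuousFunction.coe_smul,
      BoundedContinuousFunction.coe_neg, Pi.sub_apply, Pi.neg_apply, shift_apply, smul_eq_mul]
    ring
  rw [hasDerivAt_iff_isLittleO]
  refine Asymptotics.IsBigO.trans_isLittleO (g := fun r => (r - s) * (r - s)) ?_ ?_
  · refine Asymptotics.IsBigO.of_bound h.deriv.deriv.bound (.of_forall fun r => ?_)
    rw [norm_mul, ← mul_assoc]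
    exact key r
  · have h1 : (fun r => r - s) =o[𝓝 s] fun _ => (1 : ℝ) :=
      (Asymptotics.isLittleO_one_iff ℝ).2 (by
        have : Tendsto (fun r => r - s) (𝓝 s) (𝓝 (s - s)) :=
          (continuous_id.sub continuous_const).tendsto s
        rwa [sub_self] at this)
    simpa using (Asymptotics.isBigO_refl (fun r => r - s) (𝓝 s)).mul_isLittleO h1

theorem continuous_shift (h : Coef Θ) : Continuous h.shift :=
  continuous_iff_continuousAt.2 fun s => (h.hasDerivAt_shift s).continuousAt

/-- Multiplication by `Θ(· - s)` on `L²(ℝ)`. -/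
def mul (h : Coef Θ) (s : ℝ) : L2 →L[ℝ] L2 := mulL (h.shift s)

theorem coeFn_mul (h : Coef Θ) (s : ℝ) (f : L2) :
    h.mul s f =ᵐ[volume] fun x => Θ (x - s) * f x := coeFn_mulL _ f

theorem norm_mul_apply_le (h : Coef Θ) (s : ℝ) (f : L2) : ‖h.mul s f‖ ≤ h.bound * ‖f‖ :=
  (norm_mulL_apply_le _ f).trans (mul_le_mul_of_nonneg_right (h.norm_shift_le s) (norm_nonneg _))

theorem hasDerivAt_mul (h : Coef Θ) (s : ℝ) :
    HasDerivAt (fun s => h.mul s) (-h.deriv.mul s) s := by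
  have := mulL.hasFDerivAt.comp_hasDerivAt s (h.hasDerivAt_shift s)
  rwa [map_neg] at this

theorem continuous_mul (h : Coef Θ) : Continuous h.mul := mulL.continuous.comp h.continuous_shift

theorem inner_mul_comm (h : Coef Θ) (s : ℝ) (f g : L2) : ⟪h.mul s f, g⟫ = ⟪f, h.mul s g⟫ :=
  inner_mulL_comm _ f g

theorem inner_mul_ge (h : Coef Θ) {c : ℝ} (hc : ∀ x, c ≤ Θ x) (s : ℝ) (f : L2) :
    c * ‖f‖ ^ 2 ≤ ⟪h.mul s f, f⟫ := inner_mulL_ge (fun _ => hc _) f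

/-- Multiplication by `Θ(· - s)` on `H²(ℝ)`. -/
def mulH (h : Coef Θ) (s : ℝ) : H 2 →L[ℝ] H 2 :=
  mulH2 (h.shift s) (h.deriv.shift s) (h.deriv.deriv.shift s) (h.contDiff_shift s)
    (h.shift_deriv s) (h.deriv.shift_deriv s)

theorem toL2_mulH (h : Coef Θ) (s : ℝ) (u : H 2) : toL2 (h.mulH s u) = h.mul s (toL2 u) := rfl

theorem wd_two_mulH (h : Coef Θ) (s : ℝ) (u : H 2) :
    wd 2 (h.mulH s u) =
      h.deriv.deriv.mul s (toL2 u) + (2 : ℝ) • h.deriv.mul s (wd 1 u) + h.mul s (wd 2 u) := rfl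

/-- With `z = J_n f` and `Z = Θ z`, one has `Θ f = (Z - ε_n Z'') + ε_n (Z'' - Θ K_n f)`. On the
first bracket `K_n` returns `Z''`; on the second, `ε_n K_n = J_n - 1`. -/
theorem ko_mul (h : Coef Θ) (s : ℝ) (n : ℕ) (f : L2) :
    ko n (h.mul s f) = wd 2 (h.mulH s (res (eps n) (eps_pos n) f)) +
      (jo n (wd 2 (h.mulH s (res (eps n) (eps_pos n) f)) - h.mul s (ko n f)) -
        (wd 2 (h.mulH s (res (eps n) (eps_pos n) f)) - h.mul s (ko n f))) := by
  set z := res (eps n) (eps_pos n) f with hz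
  set Z := h.mulH s z with hZ
  have h1 : f = toL2 z - eps n • ko n f := by
    have := jo_apply n f
    change toL2 z = _ at this
    rw [this]; abel
  have h2 : h.mul s f = (toL2 Z - eps n • wd 2 Z) + eps n • (wd 2 Z - h.mul s (ko n f)) := by
    conv_lhs => rw [h1]
    rw [map_sub, map_smul, hZ, toL2_mulH, smul_sub]
    abel
  have h3 : ko n (toL2 Z - eps n • wd 2 Z) = wd 2 Z := congrArg (fun w : H 2 => wd 2 w)
    (res_of_H2 (eps_pos n) Z)
  rw [h2, map_add, h3, map_smul, jo_apply]
  abel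

/-- In `Z'' - Θ K_n f` only `Θ'' z + 2 Θ' z'` survives, which interpolation bounds by `‖f‖ + ‖K_n
f‖`. The constant depends on neither `n` nor the shift, so the energy estimates are uniform in the
regularization. -/
theorem norm_ko_mul_le (h : Coef Θ) : ∃ C, ∀ s n f, ‖ko n (h.mul s f)‖ ≤ C * (‖f‖ + ‖ko n f‖) := by
  set B0 := h.bound
  set B1 := h.deriv.bound
  set B2 := h.deriv.deriv.bound
  refine ⟨3 * B2 + 6 * B1 + B0, fun s n f => ?_⟩
  have b0 : 0 ≤ B0 := h.bound_nonneg
  have b1 : 0 ≤ B1 := h.deriv.bound_nonneg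
  have b2 : 0 ≤ B2 := h.deriv.deriv.bound_nonneg
  rw [ko_mul]
  set z := res (eps n) (eps_pos n) f with hz
  have e2 : wd 2 z = ko n f := rfl
  have n0 : ‖toL2 z‖ ≤ ‖f‖ := norm_jo_le n f
  have n1 : ‖wd 1 z‖ ≤ ‖f‖ + ‖ko n f‖ := (norm_wd_one_le z).trans (by rw [e2]; linarith)
  -- The lower order part of `(Θ z)''`. It enters three times below, once through `J_n`, whence `3 *
  -- B2 + 6 * B1`.
  set r := h.deriv.deriv.mul s (toL2 z) + (2 : ℝ) • h.deriv.mul s (wd 1 z) with hr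
  have e3 : wd 2 (h.mulH s z) = r + h.mul s (ko n f) := by rw [wd_two_mulH, e2]
  rw [e3, add_sub_cancel_right]
  have nr : ‖r‖ ≤ B2 * ‖f‖ + 2 * (B1 * (‖f‖ + ‖ko n f‖)) := by
    refine (norm_add_le _ _).trans (add_le_add ?_ ?_)
    · exact (h.deriv.deriv.norm_mul_apply_le s _).trans (mul_le_mul_of_nonneg_left n0 b2)
    · rw [norm_smul, Real.norm_ofNat]
      refine mul_le_mul_of_nonneg_left ?_ (by norm_num)
      exact (h.deriv.norm_mul_apply_le s _).trans (mul_le_mul_of_nonneg_left n1 b1)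
  have nj := norm_jo_le n r
  have nm : ‖h.mul s (ko n f)‖ ≤ B0 * ‖ko n f‖ := h.norm_mul_apply_le s _
  calc ‖r + h.mul s (ko n f) + (jo n r - r)‖
      ≤ ‖r‖ + ‖h.mul s (ko n f)‖ + (‖jo n r‖ + ‖r‖) :=
        (norm_add_le _ _).trans (add_le_add (norm_add_le _ _) (norm_sub_le _ _))
    _ ≤ 3 * (B2 * ‖f‖ + 2 * (B1 * (‖f‖ + ‖ko n f‖))) + B0 * ‖ko n f‖ := by linarith
    _ ≤ _ := by nlinarith [mul_nonneg b2 (norm_nonneg (ko n f)), mul_nonneg b0 (norm_nonneg f)]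

end Coef

/-! ### Calculus on `[0,T]` -/

section Time

variable {T : ℝ} {X Y : Type*} [NormedAddCommGroup X] [NormedSpace ℝ X] [NormedAddCommGroup Y]
  [NormedSpace ℝ Y]

/-- Extension by zero of a function on `[0,T]`. -/
def ex (u : I T → X) : ℝ → X := Function.extend Subtype.val u 0

@[simp] theorem ex_coe (u : I T → X) (t : I T) : ex u t = u t :=
  Subtype.val_injective.extend_apply u 0 t

theorem ex_of_mem (u : I T → X) {t : ℝ} (ht : t ∈ Icc 0 T) : ex u t = u ⟨t, ht⟩ :=
  ex_coe u ⟨t, ht⟩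

theorem hasTimeDeriv_of_eqOn {u v : I T → X} {f : ℝ → X} (hf : ∀ t : I T, f t = u t)
    (h : ∀ t : I T, HasDerivWithinAt f (v t) (Icc 0 T) t) : HasTimeDeriv u v := by
  intro t
  refine (h t).congr_of_mem (fun s hs => ?_) t.2
  exact (ex_of_mem u hs).trans (hf ⟨s, hs⟩).symm

theorem continuousOn_ex {u : I T → X} (hu : Continuous u) : ContinuousOn (ex u) (Icc 0 T) := by
  rw [continuousOn_iff_continuous_domRestrict]
  exact hu.congr fun t => (ex_coe u t).symm

theorem HasTimeDeriv.congr {u v u' v' : I T → X} (h : HasTimeDeriv u v) (hu : ∀ t, u t = u' t)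
    (hv : ∀ t, v t = v' t) : HasTimeDeriv u' v' := by
  rwa [show u' = u from funext fun t => (hu t).symm, show v' = v from funext fun t => (hv t).symm]

theorem HasTimeDeriv.neg {u v : I T → X} (h : HasTimeDeriv u v) :
    HasTimeDeriv (fun t => -u t) (fun t => -v t) :=
  hasTimeDeriv_of_eqOn (f := fun t => -ex u t) (fun t => by simp) fun t => (h t).fun_neg

theorem HasTimeDeriv.sub {u v u' v' : I T → X} (h : HasTimeDeriv u v) (h' : HasTimeDeriv u' v') :
    HasTimeDeriv (fun t => u t - u' t) (fun t => v t - v' t) := by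
  simpa only [sub_eq_add_neg] using h.add h'.neg

theorem HasTimeDeriv.clm_apply {A A' : I T → X →L[ℝ] Y} {u v : I T → X} (hA : HasTimeDeriv A A')
    (h : HasTimeDeriv u v) : HasTimeDeriv (fun t => A t (u t)) (fun t => A' t (u t) + A t (v t)) :=
  hasTimeDeriv_of_eqOn (f := fun t => ex A t (ex u t)) (fun t => by simp) fun t => by
    have := (hA t).clm_apply (h t)
    change HasDerivWithinAt (fun t => ex A t (ex u t)) (A' t (ex u t) + ex A t (v t)) _ _ at this
    simpa using this

theorem HasTimeDeriv.smul {a a' : I T → ℝ} {u v : I T → X} (ha : HasTimeDeriv a a')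
    (h : HasTimeDeriv u v) : HasTimeDeriv (fun t => a t • u t) (fun t => a t • v t + a' t • u t) :=
  hasTimeDeriv_of_eqOn (f := fun t => ex a t • ex u t) (fun t => by simp) fun t => by
    have := (ha t).fun_smul (h t)
    change HasDerivWithinAt (fun t => ex a t • ex u t) (ex a t • v t + a' t • ex u t) _ _ at this
    simpa using this

theorem HasTimeDeriv.inner {X : Type*} [NormedAddCommGroup X] [InnerProductSpace ℝ X]
    {u v u' v' : I T → X} (h : HasTimeDeriv u v) (h' : HasTimeDeriv u' v') :
    HasTimeDeriv (fun t => ⟪u t, u' t⟫) (fun t => ⟪u t, v' t⟫ + ⟪v t, u' t⟫) :=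
  hasTimeDeriv_of_eqOn (f := fun t => ⟪ex u t, ex u' t⟫) (fun t => by simp) fun t => by
    have := (h t).inner ℝ (h' t)
    change HasDerivWithinAt (fun t => ⟪ex u t, ex u' t⟫) (⟪ex u t, v' t⟫ + ⟪v t, ex u' t⟫) _ _
      at this
    simpa using this

theorem HasTimeDeriv.normSq {X : Type*} [NormedAddCommGroup X] [InnerProductSpace ℝ X]
    {u v : I T → X} (h : HasTimeDeriv u v) :
    HasTimeDeriv (fun t => ‖u t‖ ^ 2) (fun t => 2 * ⟪u t, v t⟫) :=
  (h.inner h).congr (fun _ => real_inner_self_eq_norm_sq _)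
    fun t => by rw [real_inner_comm (u t) (v t)]; ring

theorem HasTimeDeriv.continuous {u v : I T → X} (h : HasTimeDeriv u v) : Continuous u := by
  have : ContinuousOn (ex u) (Icc 0 T) := fun t ht => (h ⟨t, ht⟩).continuousWithinAt
  rw [continuousOn_iff_continuous_domRestrict] at this
  exact this.congr fun t => ex_coe u t

theorem HasTimeDeriv.unique (hT : 0 < T) {u v v' : I T → X} (h : HasTimeDeriv u v)
    (h' : HasTimeDeriv u v') : v = v' :=
  funext fun t => (uniqueDiffOn_Icc hT t t.2).eq_deriv _ (h t) (h' t)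

/-- The initial time. -/
def zeroTime (hT : 0 < T) : I T := ⟨0, left_mem_Icc.2 hT.le⟩

theorem intervalIntegrable_ex {φ : I T → X} (hφ : Continuous φ) {t : ℝ} (ht : t ∈ Icc 0 T) :
    IntervalIntegrable (ex φ) volume 0 t :=
  ((continuousOn_ex hφ).mono (by
    rw [uIcc_of_le ht.1]; exact Icc_subset_Icc_right ht.2)).intervalIntegrable

/-- A family of operators applied pointwise in time. -/
def opApply (A : C(I T, X →L[ℝ] Y)) (w : C(I T, X)) : C(I T, Y) :=
  ⟨fun t => A t (w t), A.continuous.clm_apply w.continuous⟩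

@[simp] theorem opApply_apply (A : C(I T, X →L[ℝ] Y)) (w : C(I T, X)) (t : I T) :
    opApply A w t = A t (w t) := rfl

variable [CompleteSpace X]

theorem hasTimeDeriv_integral {φ : I T → X} (hφ : Continuous φ) :
    HasTimeDeriv (fun t => ∫ s in (0 : ℝ)..t, ex φ s) φ := by
  refine hasTimeDeriv_of_eqOn (f := fun t => ∫ s in (0 : ℝ)..t, ex φ s) (fun t => rfl) fun t => ?_
  have hc := continuousOn_ex hφ
  have h0 : (0 : ℝ) ≤ T := t.2.1.trans t.2.2
  have h1 : HasDerivWithinAt (fun t => ∫ s in (0 : ℝ)..t, ex φ s) (ex φ t) (Icc 0 T) t := by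
    have : Fact ((t : ℝ) ∈ Icc 0 T) := ⟨t.2⟩
    refine intervalIntegral.integral_hasDerivWithinAt_right (intervalIntegrable_ex hφ t.2)
      (t := Icc 0 T) ?_ (hc t t.2)
    exact hc.stronglyMeasurableAtFilter_nhdsWithin measurableSet_Icc t
  rwa [ex_coe] at h1

/-- The primitive `t ↦ ∫₀ᵗ φ(s) ds`. -/
def prim (φ : C(I T, X)) : C(I T, X) :=
  ⟨fun t => ∫ s in (0 : ℝ)..t, ex φ s, (hasTimeDeriv_integral φ.continuous).continuous⟩

theorem prim_apply (φ : C(I T, X)) (t : I T) : prim φ t = ∫ s in (0 : ℝ)..t, ex φ s := rfl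

theorem hasTimeDeriv_prim (φ : C(I T, X)) : HasTimeDeriv (prim φ) φ :=
  hasTimeDeriv_integral φ.continuous

theorem prim_zeroTime (hT : 0 < T) (φ : C(I T, X)) : prim φ (zeroTime hT) = 0 :=
  intervalIntegral.integral_same

theorem prim_congr_of_hasTimeDeriv (hT : 0 < T) {u v : C(I T, X)} (h : HasTimeDeriv u v) (t : I T) :
    u t = u (zeroTime hT) + prim v t := by
  have h1 : ∫ s in (0 : ℝ)..t, ex v s = ex u t - ex u 0 := by
    refine intervalIntegral.integral_eq_sub_of_hasDeriv_right_of_le t.2.1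
      ((continuousOn_ex u.continuous).mono (Icc_subset_Icc_right t.2.2)) (fun s hs => ?_)
      (intervalIntegrable_ex v.continuous t.2)
    have hs' : s ∈ Ioo 0 T := ⟨hs.1, hs.2.trans_le t.2.2⟩
    have h2 := h ⟨s, Ioo_subset_Icc_self hs'⟩
    rw [ex_of_mem _ (Ioo_subset_Icc_self hs')]
    exact (h2.hasDerivAt (Icc_mem_nhds hs'.1 hs'.2)).hasDerivWithinAt
  rw [prim_apply, h1, ex_coe, ex_of_mem _ (left_mem_Icc.2 hT.le)]
  simp [zeroTime]

theorem norm_prim_le (φ : C(I T, X)) (t : I T) : ‖prim φ t‖ ≤ ∫ s in (0 : ℝ)..t, ‖ex φ s‖ :=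
  intervalIntegral.norm_integral_le_integral_norm t.2.1

/-- The primitive as a continuous linear map. -/
def primL : C(I T, X) →L[ℝ] C(I T, X) :=
  LinearMap.mkContinuous
    { toFun := prim
      map_add' := fun φ ψ => by
        ext t
        rw [ContinuousMap.add_apply, prim_apply, prim_apply, prim_apply,
          ← intervalIntegral.integral_add (intervalIntegrable_ex φ.continuous t.2)
            (intervalIntegrable_ex ψ.continuous t.2)]
        refine intervalIntegral.integral_congr fun s hs => ?_
        rw [uIcc_of_le t.2.1] at hs
        have hs' : s ∈ Icc 0 T := Icc_subset_Icc_right t.2.2 hs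
        simp only [ex_of_mem _ hs', ContinuousMap.add_apply]
      map_smul' := fun c φ => by
        ext t
        rw [RingHom.id_apply, ContinuousMap.smul_apply, prim_apply, prim_apply,
          ← intervalIntegral.integral_smul]
        refine intervalIntegral.integral_congr fun s hs => ?_
        rw [uIcc_of_le t.2.1] at hs
        have hs' : s ∈ Icc 0 T := Icc_subset_Icc_right t.2.2 hs
        simp only [ex_of_mem _ hs', ContinuousMap.smul_apply] }
    |T| (fun φ => by
      refine (ContinuousMap.norm_le _ (by positivity)).2 fun t => ?_
      have h0 : (0 : ℝ) ≤ T := t.2.1.trans t.2.2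
      change ‖∫ s in (0 : ℝ)..t, ex φ s‖ ≤ _
      have h1 := intervalIntegral.norm_integral_le_of_norm_le_const (a := (0 : ℝ)) (b := t)
        (f := ex φ) (C := ‖φ‖) (fun s hs => by
          rw [uIoc_of_le t.2.1] at hs
          rw [ex_of_mem _ (show s ∈ Icc 0 T from ⟨hs.1.le, hs.2.trans t.2.2⟩)]
          exact φ.norm_coe_le_norm _)
      refine h1.trans ?_
      rw [mul_comm, sub_zero, abs_of_nonneg t.2.1, abs_of_nonneg h0]
      exact mul_le_mul_of_nonneg_right t.2.2 (norm_nonneg _))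

@[simp] theorem primL_apply (φ : C(I T, X)) : primL φ = prim φ := rfl

theorem prim_mono {φ ψ : C(I T, ℝ)} (t : I T) (h : ∀ s : I T, s ≤ t → φ s ≤ ψ s) :
    prim φ t ≤ prim ψ t := by
  refine intervalIntegral.integral_mono_on t.2.1 (intervalIntegrable_ex φ.continuous t.2)
    (intervalIntegrable_ex ψ.continuous t.2) fun s hs => ?_
  have hs' : s ∈ Icc 0 T := Icc_subset_Icc_right t.2.2 hs
  rw [ex_of_mem _ hs', ex_of_mem _ hs']
  exact h _ hs.2

theorem prim_nonneg {φ : C(I T, ℝ)} (h : ∀ s, 0 ≤ φ s) (t : I T) : 0 ≤ prim φ t := by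
  have := prim_mono (φ := 0) (ψ := φ) t fun s _ => h s
  rwa [← primL_apply, map_zero] at this

theorem prim_le_const {φ : C(I T, ℝ)} {γ : ℝ} (h : ∀ s, φ s ≤ γ) (t : I T) : prim φ t ≤ t * γ := by
  refine (prim_mono (ψ := ContinuousMap.const _ γ) t fun s _ => h s).trans (le_of_eq ?_)
  rw [prim_apply, intervalIntegral.integral_congr (g := fun _ => γ)]
  · simp
  · intro s hs
    rw [uIcc_of_le t.2.1] at hs
    rw [ex_of_mem _ (Icc_subset_Icc_right t.2.2 hs)]
    rfl

/-- The function `t ↦ ‖w(t)‖²`. -/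
def normSq {X : Type*} [NormedAddCommGroup X] (w : C(I T, X)) : C(I T, ℝ) :=
  ⟨fun t => ‖w t‖ ^ 2, by fun_prop⟩

@[simp] theorem normSq_apply {X : Type*} [NormedAddCommGroup X] (w : C(I T, X)) (t : I T) :
    normSq w t = ‖w t‖ ^ 2 := rfl

theorem norm_prim_sq_le (φ : C(I T, X)) (t : I T) : ‖prim φ t‖ ^ 2 ≤ t * prim (normSq φ) t := by
  set n : C(I T, ℝ) := ⟨fun t => ‖φ t‖, by fun_prop⟩ with hn
  have h1 : ‖prim φ t‖ ≤ prim n t := by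
    refine (norm_prim_le φ t).trans (le_of_eq (intervalIntegral.integral_congr fun s hs => ?_))
    rw [uIcc_of_le t.2.1] at hs
    have hs' : s ∈ Icc 0 T := Icc_subset_Icc_right t.2.2 hs
    simp only [ex_of_mem _ hs', hn, ContinuousMap.coe_mk]
  -- Cauchy–Schwarz in time, from integrating `2 c x ≤ x² + c²`; the best `c` is the time average of
  -- the norm, used below.
  have h2 : ∀ c : ℝ, 2 * c * prim n t ≤ prim (normSq φ) t + t * c ^ 2 := by
    intro c
    have h3 : prim ((2 * c) • n - normSq φ) t ≤ t * c ^ 2 := by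
      refine prim_le_const (fun s => ?_) t
      simp only [ContinuousMap.sub_apply, ContinuousMap.smul_apply, smul_eq_mul, normSq_apply, hn,
        ContinuousMap.coe_mk]
      nlinarith [sq_nonneg (c - ‖φ s‖)]
    rw [← primL_apply, map_sub, map_smul] at h3
    simp only [ContinuousMap.sub_apply, ContinuousMap.smul_apply, smul_eq_mul, primL_apply] at h3
    linarith
  have h4 : (prim n t) ^ 2 ≤ t * prim (normSq φ) t := by
    rcases t.2.1.eq_or_lt with h0 | h0
    · have : prim n t = 0 := by rw [prim_apply, ← h0]; exact intervalIntegral.integral_same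
      rw [this, ← h0]; simp
    · have h5 := h2 (prim n t / t)
      have h6 : 2 * (prim n t / t) * prim n t = 2 * ((prim n t) ^ 2 / t) := by ring
      have h7 : (t : ℝ) * (prim n t / t) ^ 2 = (prim n t) ^ 2 / t := by field_simp
      rw [h6, h7] at h5
      have h8 : (prim n t) ^ 2 / t ≤ prim (normSq φ) t := by linarith
      rw [div_le_iff₀ h0] at h8
      linarith
  exact (pow_le_pow_left₀ (norm_nonneg _) h1 2).trans h4

/-- Grönwall's inequality. -/
theorem gronwall (hT : 0 < T) {e e' : I T → ℝ} (he : HasTimeDeriv e e') {C : ℝ} (hC : 0 ≤ C)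
    {h : C(I T, ℝ)} (hh : ∀ t, 0 ≤ h t) (hle : ∀ t, e' t ≤ C * e t + h t)
    (h0 : 0 ≤ e (zeroTime hT)) (t : I T) :
    e t ≤ Real.exp (C * T) * (e (zeroTime hT) + prim h t) := by
  -- This function is nonincreasing: the derivative of `e^{-Cs} e(s)` is at most `e^{-Cs} h(s) ≤
  -- h(s)`.
  set f : ℝ → ℝ := fun s => Real.exp (-C * s) * ex e s - ex (prim h) s with hf
  have hd : ∀ s (hs : s ∈ Icc 0 T), HasDerivWithinAt f
      (Real.exp (-C * s) * -C * e ⟨s, hs⟩ + Real.exp (-C * s) * e' ⟨s, hs⟩ - h ⟨s, hs⟩)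
      (Icc 0 T) s := by
    intro s hs
    have h1 : HasDerivWithinAt (fun s => Real.exp (-C * s)) (Real.exp (-C * s) * -C) (Icc 0 T) s := by
      simpa using ((hasDerivAt_id s).const_mul (-C)).exp.hasDerivWithinAt
    have h2 := h1.fun_mul (he ⟨s, hs⟩)
    have h3 := h2.fun_sub (hasTimeDeriv_prim h ⟨s, hs⟩)
    change HasDerivWithinAt f (Real.exp (-C * s) * -C * ex e s + Real.exp (-C * s) * e' ⟨s, hs⟩ -
      h ⟨s, hs⟩) _ _ at h3
    rwa [ex_of_mem _ hs] at h3
  have hanti : AntitoneOn f (Icc 0 T) := by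
    refine antitoneOn_of_deriv_nonpos (convex_Icc 0 T)
      (fun s hs => (hd s hs).continuousWithinAt) (fun s hs => ?_) (fun s hs => ?_)
    · exact ((hd s (interior_subset hs)).mono interior_subset).differentiableWithinAt
    · rw [interior_Icc] at hs
      have hs' := Ioo_subset_Icc_self hs
      rw [((hd s hs').hasDerivAt (Icc_mem_nhds hs.1 hs.2)).deriv]
      have h1 := hle ⟨s, hs'⟩
      have h2 : Real.exp (-C * s) ≤ 1 := Real.exp_le_one_iff.2 (by nlinarith [hs.1])
      have h3 := mul_le_mul_of_nonneg_left h1 (Real.exp_pos (-C * s)).le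
      nlinarith [mul_le_mul_of_nonneg_right h2 (hh ⟨s, hs'⟩)]
  have h1 := hanti (left_mem_Icc.2 hT.le) t.2 t.2.1
  simp only [hf, ex_coe, ex_of_mem _ (left_mem_Icc.2 hT.le)] at h1
  have h2 : prim h ⟨0, left_mem_Icc.2 hT.le⟩ = 0 := prim_zeroTime hT h
  rw [h2] at h1
  simp only [mul_zero, Real.exp_zero, one_mul, sub_zero] at h1
  have h3 : Real.exp (-C * t) * e t ≤ e (zeroTime hT) + prim h t := by
    rw [zeroTime]; linarith
  have h4 : e t = Real.exp (C * t) * (Real.exp (-C * t) * e t) := by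
    rw [← mul_assoc, ← Real.exp_add]; simp
  rw [h4]
  have h5 : Real.exp (C * t) ≤ Real.exp (C * T) :=
    Real.exp_le_exp.2 (mul_le_mul_of_nonneg_left t.2.2 hC)
  calc _ ≤ Real.exp (C * t) * (e (zeroTime hT) + prim h t) :=
        mul_le_mul_of_nonneg_left h3 (Real.exp_pos _).le
    _ ≤ _ := mul_le_mul_of_nonneg_right h5 (add_nonneg h0 (prim_nonneg hh t))

/-- Integrating an exponential weight gains the factor `1 / lam`; a large `lam` makes Volterra maps
contract. -/
theorem prim_exp_le {lam : ℝ} (hl : 0 < lam) (hT : 0 < T) {D : ℝ} (t : I T)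
    {φ : C(I T, ℝ)} (h : ∀ s, s ≤ t → φ s ≤ D * Real.exp (lam * s)) :
    prim φ t ≤ D / lam * (Real.exp (lam * t) - 1) := by
  set ψ : C(I T, ℝ) := ⟨fun s => D * Real.exp (lam * s), by fun_prop⟩
  set χ : C(I T, ℝ) := ⟨fun s => D / lam * Real.exp (lam * s), by fun_prop⟩
  have h1 : HasTimeDeriv χ ψ := by
    refine hasTimeDeriv_of_eqOn (f := fun s => D / lam * Real.exp (lam * s)) (fun t => rfl)
      fun t => ?_
    have h2 : HasDerivAt (fun s : ℝ => Real.exp (lam * s)) (Real.exp (lam * t) * lam) (t : ℝ) := by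
      simpa using ((hasDerivAt_id (t : ℝ)).const_mul lam).exp
    have h3 := h2.const_mul (D / lam)
    have h4 : D / lam * (Real.exp (lam * t) * lam) = ψ t := by
      change _ = D * Real.exp (lam * t)
      field_simp
    rw [h4] at h3
    exact h3.hasDerivWithinAt
  have h2 := prim_congr_of_hasTimeDeriv hT h1 t
  have h3 : prim φ t ≤ prim ψ t := prim_mono t h
  have h4 : χ t = D / lam * Real.exp (lam * t) := rfl
  have h5 : χ (zeroTime hT) = D / lam := by
    change D / lam * Real.exp (lam * 0) = _
    simp
  rw [h4, h5] at h2
  linarith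

/-- A fixed point theorem for Volterra maps. -/
theorem exists_fixedPoint_volterra (hT : 0 < T) {S : Set C(I T, X)} (hS : IsClosed S)
    (hne : S.Nonempty) {Ψ : C(I T, X) → C(I T, X)} (hmaps : MapsTo Ψ S S) {L : ℝ} (hL : 0 < L)
    (hle : ∀ w ∈ S, ∀ w' ∈ S, ∀ t, ‖Ψ w t - Ψ w' t‖ ^ 2 ≤ L * prim (normSq (w - w')) t) :
    ∃ w ∈ S, Ψ w = w := by
  obtain ⟨w₀, hw₀⟩ := hne
  set w : ℕ → C(I T, X) := fun n => Ψ^[n] w₀ with hw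
  have hmem : ∀ n, w n ∈ S := fun n => hmaps.iterate n hw₀
  have hsucc : ∀ n, w (n + 1) = Ψ (w n) := fun n => Function.iterate_succ_apply' Ψ n w₀
  set D := ‖w 1 - w 0‖ ^ 2 with hD
  -- The rate `4 L` is chosen so that `L` times the integral of the weight gains a factor `1 / 4` at
  -- each iteration, hence `1 / 2` for the norms.
  have h1 : ∀ n t, ‖w (n + 1) t - w n t‖ ^ 2 ≤ D / 4 ^ n * Real.exp (4 * L * t) := by
    intro n
    induction n with
    | zero =>
      intro t
      have h2 : ‖w 1 t - w 0 t‖ ≤ ‖w 1 - w 0‖ := (w 1 - w 0).norm_coe_le_norm t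
      have h3 : (1 : ℝ) ≤ Real.exp (4 * L * t) := Real.one_le_exp (by have := t.2.1; positivity)
      rw [pow_zero, div_one]
      have h4 := pow_le_pow_left₀ (norm_nonneg _) h2 2
      nlinarith [sq_nonneg ‖w 1 - w 0‖]
    | succ n ih =>
      intro t
      rw [hsucc (n + 1), hsucc n]
      refine (hle _ (hsucc n ▸ hmem (n + 1)) _ (hmem n) t).trans ?_
      have h2 := prim_exp_le (lam := 4 * L) (by positivity) hT (D := D / 4 ^ n) t
        (φ := normSq (w (n + 1) - w n)) fun s _ => ih s
      rw [← hsucc n]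
      have h3 := mul_le_mul_of_nonneg_left h2 hL.le
      refine h3.trans ?_
      have h4 : L * (D / 4 ^ n / (4 * L) * (Real.exp (4 * L * t) - 1)) =
          D / 4 ^ (n + 1) * (Real.exp (4 * L * t) - 1) := by
        field_simp; ring
      rw [h4]
      have h5 : 0 ≤ D / 4 ^ (n + 1) := by positivity
      linarith
  set M := ‖w 1 - w 0‖ * Real.exp (2 * L * T) with hM
  have h2 : ∀ n, dist (w n) (w (n + 1)) ≤ M * (1 / 2) ^ n := by
    intro n
    rw [dist_comm, dist_eq_norm]
    refine (ContinuousMap.norm_le _ (by positivity)).2 fun t => ?_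
    refine le_of_sq_le_sq ((h1 n t).trans ?_) (by positivity)
    have h3 : (M * (1 / 2) ^ n) ^ 2 = D / 4 ^ n * Real.exp (4 * L * T) := by
      rw [hM, hD, mul_pow, mul_pow, ← Real.exp_nat_mul, ← pow_mul, mul_comm n 2, pow_mul]
      rw [show ((2 : ℕ) : ℝ) * (2 * L * T) = 4 * L * T by push_cast; ring]
      rw [show ((1 : ℝ) / 2) ^ 2 = 4⁻¹ by norm_num, inv_pow]
      ring
    rw [h3]
    refine mul_le_mul_of_nonneg_left (Real.exp_le_exp.2 ?_) (by positivity)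
    exact mul_le_mul_of_nonneg_left t.2.2 (by positivity)
  obtain ⟨v, hv⟩ := cauchySeq_tendsto_of_complete
    (cauchySeq_of_le_geometric (1 / 2) M (by norm_num) h2)
  have hvS : v ∈ S := hS.mem_of_tendsto hv (.of_forall hmem)
  refine ⟨v, hvS, ?_⟩
  -- The Volterra bound also gives continuity of `Ψ` on `S`, with Lipschitz constant `√(L T)`, so
  -- the limit is a fixed point.
  have h3 : Tendsto (fun n => Ψ (w n)) atTop (𝓝 (Ψ v)) := by
    rw [tendsto_iff_dist_tendsto_zero]
    have h4 : ∀ n, dist (Ψ (w n)) (Ψ v) ≤ Real.sqrt (L * T) * dist (w n) v := by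
      intro n
      rw [dist_eq_norm, dist_eq_norm]
      refine (ContinuousMap.norm_le _ (by positivity)).2 fun t => ?_
      refine le_of_sq_le_sq ((hle _ (hmem n) _ hvS t).trans ?_) (by positivity)
      rw [mul_pow, Real.sq_sqrt (by positivity), mul_assoc]
      refine mul_le_mul_of_nonneg_left ?_ hL.le
      refine (prim_le_const (γ := ‖w n - v‖ ^ 2) (fun s => ?_) t).trans ?_
      · exact pow_le_pow_left₀ (norm_nonneg _) ((w n - v).norm_coe_le_norm s) 2
      · exact mul_le_mul_of_nonneg_right t.2.2 (sq_nonneg _)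
    refine squeeze_zero (fun n => dist_nonneg) h4 ?_
    have := (tendsto_iff_dist_tendsto_zero.1 hv).const_mul (Real.sqrt (L * T))
    rwa [mul_zero] at this
  have h4 : Tendsto (fun n => Ψ (w n)) atTop (𝓝 v) := by
    have := hv.comp (tendsto_add_atTop_nat 1)
    exact this.congr fun n => hsucc n
  exact tendsto_nhds_unique h3 h4

/-- Linear differential equations with continuous bounded coefficients are solvable. -/
theorem exists_linear_ode (hT : 0 < T) (A : C(I T, X →L[ℝ] X)) (b : C(I T, X)) (y₀ : X) :
    ∃ y : C(I T, X), y (zeroTime hT) = y₀ ∧ HasTimeDeriv y (opApply A y + b) := by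
  set Ψ : C(I T, X) → C(I T, X) := fun w => ContinuousMap.const _ y₀ + prim (opApply A w + b)
  obtain ⟨y, -, hy⟩ := exists_fixedPoint_volterra hT (S := univ) isClosed_univ univ_nonempty
    -- `T ‖A‖²` is the constant of the estimate; the added `T` makes it positive even when `A = 0`.
    (Ψ := Ψ) (mapsTo_univ _ _) (L := T * ‖A‖ ^ 2 + T) (by positivity) (fun w _ w' _ t => by
      have e1 : Ψ w t - Ψ w' t = prim (opApply A (w - w')) t := by
        simp only [Ψ, ContinuousMap.add_apply, add_sub_add_left_eq_sub]
        rw [← ContinuousMap.sub_apply, ← primL_apply, ← primL_apply, ← map_sub, primL_apply]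
        congr 2
        ext s
        simp
      have e2 := norm_prim_sq_le (opApply A (w - w')) t
      rw [e1]
      refine e2.trans ?_
      have e3 : prim (normSq (opApply A (w - w'))) t ≤ ‖A‖ ^ 2 * prim (normSq (w - w')) t := by
        rw [← smul_eq_mul, ← ContinuousMap.smul_apply, ← primL_apply (normSq (w - w')), ← map_smul,
          primL_apply]
        refine prim_mono t fun s _ => ?_
        rw [normSq_apply, opApply_apply, ContinuousMap.smul_apply, normSq_apply, smul_eq_mul,
          ← mul_pow]
        refine pow_le_pow_left₀ (norm_nonneg _) (((A s).le_opNorm _).trans ?_) 2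
        exact mul_le_mul_of_nonneg_right (A.norm_coe_le_norm s) (norm_nonneg _)
      have e4 := prim_nonneg (φ := normSq (w - w')) (fun s => sq_nonneg _) t
      have e5 : prim (normSq (opApply A (w - w'))) t ≥ 0 := prim_nonneg (fun s => sq_nonneg _) t
      calc (t : ℝ) * prim (normSq (opApply A (w - w'))) t
          ≤ T * prim (normSq (opApply A (w - w'))) t := mul_le_mul_of_nonneg_right t.2.2 e5
        _ ≤ T * (‖A‖ ^ 2 * prim (normSq (w - w')) t) := mul_le_mul_of_nonneg_left e3 hT.le
        _ ≤ _ := by nlinarith)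
  refine ⟨y, ?_, ?_⟩
  · rw [← hy]
    simp [Ψ, prim_zeroTime]
  · have h1 := (hasTimeDeriv_prim (opApply A y + b))
    have h2 : HasTimeDeriv (fun _ : I T => y₀) (fun _ => (0 : X)) :=
      hasTimeDeriv_of_eqOn (f := fun _ => y₀) (fun _ => rfl) fun t => hasDerivWithinAt_const _ _ _
    exact (h2.add h1).congr (fun t => congrArg (fun f : C(I T, X) => f t) hy) (fun t => zero_add _)

end Time

/-! ### An abstract second order evolution equation -/

section Evolution

variable {T : ℝ} {X : Type*} [NormedAddCommGroup X] [InnerProductSpace ℝ X]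

/-- A sequence `Jₙ = (1 - εₙ A)⁻¹` of resolvents of a nonpositive self-adjoint operator `A`, with
the Yosida approximations `Kₙ = A Jₙ`. -/
structure ResolventFamily (J K : ℕ → X →L[ℝ] X) : Prop where
  symm : ∀ n f g, ⟪K n f, g⟫ = ⟪f, K n g⟫
  eq_add : ∀ n f, J n f = f + eps n • K n f
  norm_le : ∀ n f, ‖J n f‖ ≤ ‖f‖
  comm : ∀ n m f, K n (J m f) = J n (K m f)
  tendsto : ∀ f, Tendsto (fun n => J n f) atTop (𝓝 f)

/-- The coefficients of the equation `u_tt + F A² u + G u_t = g`, where `M = F⁻¹` and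
`M_t = M G`. -/
structure Coeffs (T : ℝ) (K : ℕ → X →L[ℝ] X) where
  M : C(I T, X →L[ℝ] X)
  F : C(I T, X →L[ℝ] X)
  G : C(I T, X →L[ℝ] X)
  G₁ : C(I T, X →L[ℝ] X)
  deriv_M : HasTimeDeriv M (fun t => (M t).comp (G t))
  deriv_F : HasTimeDeriv F (fun t => -(G t).comp (F t))
  deriv_G : HasTimeDeriv G G₁
  M_F : ∀ t f, M t (F t f) = f
  symm_M : ∀ t f g, ⟪M t f, g⟫ = ⟪f, M t g⟫
  symm_F : ∀ t f g, ⟪F t f, g⟫ = ⟪f, F t g⟫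
  c : ℝ
  c_pos : 0 < c
  c_le : c ≤ 1
  M_ge : ∀ t f, c * ‖f‖ ^ 2 ≤ ⟪M t f, f⟫
  F_ge : ∀ t f, c * ‖f‖ ^ 2 ≤ ⟪F t f, f⟫
  B : ℝ
  B_nonneg : 0 ≤ B
  norm_M_le : ∀ t f, ‖M t f‖ ≤ B * ‖f‖
  norm_F_le : ∀ t f, ‖F t f‖ ≤ B * ‖f‖
  norm_G_le : ∀ t f, ‖G t f‖ ≤ B * ‖f‖
  norm_G₁_le : ∀ t f, ‖G₁ t f‖ ≤ B * ‖f‖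
  norm_K_G_le : ∀ n t f, ‖K n (G t f)‖ ≤ B * (‖f‖ + ‖K n f‖)
  norm_K_G₁_le : ∀ n t f, ‖K n (G₁ t f)‖ ≤ B * (‖f‖ + ‖K n f‖)

theorem two_mul_real_inner_le (a b : X) : 2 * ⟪a, b⟫ ≤ ‖a‖ ^ 2 + ‖b‖ ^ 2 := by
  have := real_inner_le_norm a b
  nlinarith [sq_nonneg (‖a‖ - ‖b‖)]

variable {J K : ℕ → X →L[ℝ] X}

/-- The basic energy estimate. -/
theorem Coeffs.energy (cf : Coeffs T K) (hT : 0 < T) {C₀ : ℝ} (hC₀ : 0 ≤ C₀) :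
    ∃ C, 0 ≤ C ∧ ∀ (V W Y A Z r g k : I T → X) (h : C(I T, ℝ)),
      HasTimeDeriv V (fun t => W t + g t) →
      HasTimeDeriv W (fun t => -cf.F t (A t) + r t) →
      HasTimeDeriv Y (fun t => Z t + k t) →
      (∀ t, ⟪Y t, Z t⟫ ≤ ⟪A t, W t⟫ + h t) →
      (∀ t, ‖r t‖ ^ 2 ≤ C₀ * (‖V t‖ ^ 2 + ‖W t‖ ^ 2) + h t) →
      (∀ t, ‖g t‖ ^ 2 ≤ h t) → (∀ t, ‖k t‖ ^ 2 ≤ h t) →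
      ∀ t, ‖V t‖ ^ 2 + ‖Y t‖ ^ 2 + ‖W t‖ ^ 2 ≤
        C * (‖V (zeroTime hT)‖ ^ 2 + ‖Y (zeroTime hT)‖ ^ 2 + ‖W (zeroTime hT)‖ ^ 2 +
          prim h t) := by
  have hB := cf.B_nonneg
  have hc := cf.c_pos
  -- The two `B²` come from `⟨M G W, W⟩` and `2⟨M W, r⟩`, `C₀` from `r`, the rest from Young's
  -- inequality for the remaining products. Division by `c` passes from norms to the energy.
  set D := cf.B ^ 2 + cf.B ^ 2 + 1 + C₀ + 2 with hD
  have hD0 : 0 ≤ D := by positivity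
  set E := Real.exp (D / cf.c * T) with hE
  refine ⟨E * (cf.B + 6) / cf.c, by positivity, ?_⟩
  intro V W Y A Z r g k h hV hW hY hYZ hr hg hk
  -- Here `Y`, `A`, `Z` play the roles of `∂²V`, `∂⁴V`, `∂²W`. The weight `M` undoes `F`: `2⟨M W, -F
  -- A⟩ = -2⟨A, W⟩`, which offsets `2⟨Y, Z⟩` up to `2 h`.
  set e : I T → ℝ := fun t => ⟪cf.M t (W t), W t⟫ + (‖Y t‖ ^ 2 + ‖V t‖ ^ 2) with he
  have hh : ∀ t, 0 ≤ h t := fun t => (sq_nonneg _).trans (hg t)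
  have hel : ∀ t, cf.c * (‖V t‖ ^ 2 + ‖Y t‖ ^ 2 + ‖W t‖ ^ 2) ≤ e t := by
    intro t
    have h1 := cf.M_ge t (W t)
    have h2 : cf.c * (‖V t‖ ^ 2 + ‖Y t‖ ^ 2) ≤ 1 * (‖V t‖ ^ 2 + ‖Y t‖ ^ 2) :=
      mul_le_mul_of_nonneg_right cf.c_le (by positivity)
    simp only [he]
    linarith
  have hed := ((cf.deriv_M.clm_apply hW).inner hW).add (hY.normSq.add hV.normSq)
  have hle : ∀ t, (⟪cf.M t (W t), -cf.F t (A t) + r t⟫ +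
      ⟪((cf.M t).comp (cf.G t)) (W t) + cf.M t (-cf.F t (A t) + r t), W t⟫ +
      (2 * ⟪Y t, Z t + k t⟫ + 2 * ⟪V t, W t + g t⟫)) ≤ D / cf.c * e t + ((5 : ℝ) • h) t := by
    intro t
    have h1 : ⟪cf.M t (W t), -cf.F t (A t)⟫ = -⟪A t, W t⟫ := by
      rw [inner_neg_right, cf.symm_M, cf.M_F, real_inner_comm]
    have h2 : ⟪cf.M t (-cf.F t (A t) + r t), W t⟫ = ⟪cf.M t (W t), -cf.F t (A t) + r t⟫ := by
      rw [cf.symm_M, real_inner_comm]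
    have h3 : 2 * ⟪cf.M t (W t), r t⟫ ≤ cf.B ^ 2 * ‖W t‖ ^ 2 + ‖r t‖ ^ 2 := by
      refine (two_mul_real_inner_le _ _).trans (add_le_add_left ?_ _)
      rw [← mul_pow]
      exact pow_le_pow_left₀ (norm_nonneg _) (cf.norm_M_le t _) 2
    have h4 : ⟪cf.M t (cf.G t (W t)), W t⟫ ≤ cf.B ^ 2 * ‖W t‖ ^ 2 := by
      refine (real_inner_le_norm _ _).trans ?_
      have := (cf.norm_M_le t (cf.G t (W t))).trans
        (mul_le_mul_of_nonneg_left (cf.norm_G_le t (W t)) hB)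
      nlinarith [norm_nonneg (W t)]
    have h5 := two_mul_real_inner_le (Y t) (k t)
    have h6 := two_mul_real_inner_le (V t) (g t)
    have h7 := two_mul_real_inner_le (V t) (W t)
    have h8 : D * (‖V t‖ ^ 2 + ‖Y t‖ ^ 2 + ‖W t‖ ^ 2) ≤ D / cf.c * e t := by
      rw [div_mul_eq_mul_div, le_div_iff₀ hc]
      have := mul_le_mul_of_nonneg_left (hel t) hD0
      nlinarith
    rw [inner_add_left, h2, inner_add_right, h1, inner_add_right (Y t), inner_add_right (V t),
      ContinuousLinearMap.comp_apply]
    -- Two copies of `h` come from `2⟨Y, Z⟩` and one each from `r`, `g` and `k`.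
    have h9 : ((5 : ℝ) • h) t = 5 * h t := by simp
    rw [h9]
    refine le_trans ?_ (add_le_add_left h8 _)
    have := hYZ t
    have := hr t
    have := hg t
    have := hk t
    rw [hD]
    nlinarith [sq_nonneg ‖V t‖, sq_nonneg ‖W t‖, sq_nonneg ‖Y t‖, sq_nonneg cf.B,
      mul_nonneg (sq_nonneg cf.B) (sq_nonneg ‖V t‖), mul_nonneg (sq_nonneg cf.B) (sq_nonneg ‖Y t‖),
      mul_nonneg hC₀ (sq_nonneg ‖Y t‖)]
  have he0 : ∀ t, 0 ≤ e t := fun t => le_trans (by positivity) (hel t)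
  intro t
  have hgr := gronwall hT hed (C := D / cf.c) (by positivity) (h := (5 : ℝ) • h)
    (fun t => by simpa using hh t) hle (he0 _) t
  have hp : prim ((5 : ℝ) • h) t = 5 * prim h t := by
    rw [← primL_apply, map_smul]; simp
  have hp0 := prim_nonneg hh t
  rw [hp] at hgr
  have he00 : e (zeroTime hT) ≤ (cf.B + 1) * (‖V (zeroTime hT)‖ ^ 2 + ‖Y (zeroTime hT)‖ ^ 2 +
      ‖W (zeroTime hT)‖ ^ 2) := by
    have h1 : ⟪cf.M (zeroTime hT) (W (zeroTime hT)), W (zeroTime hT)⟫ ≤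
        cf.B * ‖W (zeroTime hT)‖ ^ 2 := by
      refine (real_inner_le_norm _ _).trans ?_
      have := cf.norm_M_le (zeroTime hT) (W (zeroTime hT))
      nlinarith [norm_nonneg (W (zeroTime hT))]
    simp only [he]
    nlinarith [sq_nonneg ‖V (zeroTime hT)‖, sq_nonneg ‖Y (zeroTime hT)‖,
      sq_nonneg ‖W (zeroTime hT)‖]
  rw [div_mul_eq_mul_div, le_div_iff₀ hc]
  have h1 := (hel t).trans hgr
  have hE0 : 0 < E := Real.exp_pos _
  calc _ ≤ E * (e (zeroTime hT) + 5 * prim h t) := by rw [mul_comm]; exact h1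
    _ ≤ E * ((cf.B + 6) * (‖V (zeroTime hT)‖ ^ 2 + ‖Y (zeroTime hT)‖ ^ 2 +
      ‖W (zeroTime hT)‖ ^ 2 + prim h t)) := by
        refine mul_le_mul_of_nonneg_left ?_ hE0.le
        nlinarith [sq_nonneg ‖V (zeroTime hT)‖, sq_nonneg ‖Y (zeroTime hT)‖,
          sq_nonneg ‖W (zeroTime hT)‖, mul_nonneg hB hp0]
    _ = _ := by ring

/-- The lower order terms of the equation for `w`. -/
def Coeffs.lower (cf : Coeffs T K) (v w g : I T → X) (t : I T) : X :=
  -((2 : ℝ) • cf.G t (w t) + (cf.G t (cf.G t (v t)) + cf.G₁ t (v t)) + cf.G t (g t))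

/-- The regularized system `v_t = w + g`, `w_t = -F Kₙ² v - 2 G w - (G² + G_t) v - G g`. -/
structure Coeffs.IsRegSol (cf : Coeffs T K) (n : ℕ) (v w g : C(I T, X)) : Prop where
  deriv_v : HasTimeDeriv v (fun t => w t + g t)
  deriv_w : HasTimeDeriv w (fun t => -cf.F t (K n (K n (v t))) + cf.lower v w g t)

/-- For fixed `n` the operator `F K_n²` is bounded, so the system is a linear ODE on `X × X`. -/
theorem Coeffs.exists_isRegSol [CompleteSpace X] (cf : Coeffs T K) (hT : 0 < T) (n : ℕ)
    (v₀ w₀ : X) (g : C(I T, X)) :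
    ∃ v w, cf.IsRegSol n v w g ∧ v (zeroTime hT) = v₀ ∧ w (zeroTime hT) = w₀ := by
  set fs := ContinuousLinearMap.fst ℝ X X
  set sn := ContinuousLinearMap.snd ℝ X X
  set il := ContinuousLinearMap.inl ℝ X X
  set ir := ContinuousLinearMap.inr ℝ X X
  have hc : ∀ {A B : I T → X →L[ℝ] X}, Continuous A → Continuous B →
      Continuous fun t => (A t).comp (B t) := fun hA hB => hA.clm_comp hB
  set A : C(I T, X × X →L[ℝ] X × X) := ⟨fun t => il.comp sn + ir.comp
    ((-((cf.F t).comp ((K n).comp (K n))) - ((cf.G t).comp (cf.G t) + cf.G₁ t)).comp fs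
      - (2 : ℝ) • (cf.G t).comp sn), by
    refine continuous_const.add (continuous_const.clm_comp (Continuous.sub ?_ ?_))
    · exact ((hc cf.F.continuous continuous_const).neg.sub
        ((hc cf.G.continuous cf.G.continuous).add cf.G₁.continuous)).clm_comp continuous_const
    · have hG : Continuous fun t => (cf.G t).comp sn := cf.G.continuous.clm_comp continuous_const
      exact hG.const_smul (2 : ℝ)⟩
  set b : C(I T, X × X) := ⟨fun t => (g t, -cf.G t (g t)),
    g.continuous.prodMk (cf.G.continuous.clm_apply g.continuous).neg⟩
  obtain ⟨y, hy0, hy⟩ := exists_linear_ode hT A b (v₀, w₀)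
  refine ⟨⟨fun t => (y t).1, by fun_prop⟩, ⟨fun t => (y t).2, by fun_prop⟩, ⟨?_, ?_⟩, ?_, ?_⟩
  · refine (hy.clm fs).congr (fun _ => rfl) fun t => ?_
    simp [A, b, fs, il, ir, sn]
  · refine (hy.clm sn).congr (fun _ => rfl) fun t => ?_
    simp [A, b, fs, il, ir, sn, Coeffs.lower]
    abel
  · simp [hy0]
  · simp [hy0]

theorem Coeffs.norm_lower_le (cf : Coeffs T K) (v w g : I T → X) (t : I T) :
    ‖cf.lower v w g t‖ ^ 2 ≤
      (12 * cf.B ^ 2 + 3 * (cf.B ^ 2 + cf.B) ^ 2) * (‖v t‖ ^ 2 + ‖w t‖ ^ 2)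
        + 3 * cf.B ^ 2 * ‖g t‖ ^ 2 := by
  have hB := cf.B_nonneg
  have h1 : ‖cf.lower v w g t‖ ≤
      2 * (cf.B * ‖w t‖) + (cf.B ^ 2 + cf.B) * ‖v t‖ + cf.B * ‖g t‖ := by
    rw [Coeffs.lower, norm_neg]
    refine (norm_add₃_le).trans (add_le_add_three ?_ ?_ (cf.norm_G_le t _))
    · rw [norm_smul, Real.norm_ofNat]
      exact mul_le_mul_of_nonneg_left (cf.norm_G_le t _) (by norm_num)
    · refine (norm_add_le _ _).trans ?_
      have := (cf.norm_G_le t (cf.G t (v t))).trans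
        (mul_le_mul_of_nonneg_left (cf.norm_G_le t (v t)) hB)
      have := cf.norm_G₁_le t (v t)
      nlinarith
  have h2 := pow_le_pow_left₀ (norm_nonneg _) h1 2
  refine h2.trans ?_
  have h3 : ∀ a b c : ℝ, (a + b + c) ^ 2 ≤ 3 * a ^ 2 + 3 * b ^ 2 + 3 * c ^ 2 := fun a b c => by
    nlinarith [sq_nonneg (a - b), sq_nonneg (b - c), sq_nonneg (a - c)]
  refine (h3 _ _ _).trans ?_
  have h4 : 0 ≤ cf.B ^ 2 * ‖v t‖ ^ 2 := by positivity
  have h5 : 0 ≤ (cf.B ^ 2 + cf.B) ^ 2 * ‖w t‖ ^ 2 := by positivity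
  nlinarith

/-- First order estimate for differences of solutions of regularized systems. -/
theorem Coeffs.regSol_diff [CompleteSpace X] (cf : Coeffs T K) (hT : 0 < T) :
    ∃ C, 0 ≤ C ∧ ∀ (n m : ℕ) (v w g v' w' g' : C(I T, X)) (γ : ℝ),
      cf.IsRegSol n v w g → cf.IsRegSol m v' w' g' →
      (∀ t, ⟪K n (v t) - K m (v' t), K n (w t) - K m (w' t)⟫ ≤
        ⟪K n (K n (v t)) - K m (K m (v' t)), w t - w' t⟫ + γ) →
      (∀ t, ‖g t - g' t‖ ^ 2 ≤ γ) → (∀ t, ‖K n (g t) - K m (g' t)‖ ^ 2 ≤ γ) →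
      ‖v (zeroTime hT) - v' (zeroTime hT)‖ ^ 2 ≤ γ →
      ‖K n (v (zeroTime hT)) - K m (v' (zeroTime hT))‖ ^ 2 ≤ γ →
      ‖w (zeroTime hT) - w' (zeroTime hT)‖ ^ 2 ≤ γ →
      ∀ t, ‖v t - v' t‖ ^ 2 + ‖K n (v t) - K m (v' t)‖ ^ 2 + ‖w t - w' t‖ ^ 2 ≤ C * γ := by
  have hB := cf.B_nonneg
  obtain ⟨C, hC, H⟩ := cf.energy hT (C₀ := 12 * cf.B ^ 2 + 3 * (cf.B ^ 2 + cf.B) ^ 2)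
    (by positivity)
  -- The `3` counts the initial terms. The source is the constant `(3 B² + 1) γ`: `3 B² γ` from `G
  -- (g - g')` in the lower order terms, `γ` for the other hypotheses.
  refine ⟨C * (3 + T * (3 * cf.B ^ 2 + 1)), by positivity, ?_⟩
  intro n m v w g v' w' g' γ h h' hYZ hg hk hv0 hy0 hw0 t
  have hγ : 0 ≤ γ := (sq_nonneg _).trans hv0
  have key := H (fun t => v t - v' t) (fun t => w t - w' t) (fun t => K n (v t) - K m (v' t))
    (fun t => K n (K n (v t)) - K m (K m (v' t))) (fun t => K n (w t) - K m (w' t))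
    (fun t => cf.lower (fun t => v t - v' t) (fun t => w t - w' t) (fun t => g t - g' t) t)
    (fun t => g t - g' t) (fun t => K n (g t) - K m (g' t))
    (ContinuousMap.const _ ((3 * cf.B ^ 2 + 1) * γ))
    ((h.deriv_v.sub h'.deriv_v).congr (fun _ => rfl) fun t => by abel)
    ((h.deriv_w.sub h'.deriv_w).congr (fun _ => rfl) fun t => by
      simp only [Coeffs.lower, map_sub, smul_sub]; abel)
    (((h.deriv_v.clm (K n)).sub (h'.deriv_v.clm (K m))).congr (fun _ => rfl) fun t => by
      simp only [map_add]; abel)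
    (fun t => (hYZ t).trans (by
      simp only [ContinuousMap.const_apply]; nlinarith [mul_nonneg (sq_nonneg cf.B) hγ]))
    (fun t => (cf.norm_lower_le _ _ _ t).trans (by
      simp only [ContinuousMap.const_apply]
      have := mul_le_mul_of_nonneg_left (hg t) (show 0 ≤ 3 * cf.B ^ 2 by positivity)
      linarith))
    (fun t => (hg t).trans (by
      simp only [ContinuousMap.const_apply]; nlinarith [mul_nonneg (sq_nonneg cf.B) hγ]))
    (fun t => (hk t).trans (by
      simp only [ContinuousMap.const_apply]; nlinarith [mul_nonneg (sq_nonneg cf.B) hγ])) t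
  refine key.trans ?_
  rw [mul_assoc]
  refine mul_le_mul_of_nonneg_left ?_ hC
  have h1 := prim_le_const (φ := ContinuousMap.const (I T) ((3 * cf.B ^ 2 + 1) * γ))
    (γ := (3 * cf.B ^ 2 + 1) * γ)
    (fun _ => le_rfl) t
  have h2 : (t : ℝ) * ((3 * cf.B ^ 2 + 1) * γ) ≤ T * ((3 * cf.B ^ 2 + 1) * γ) :=
    mul_le_mul_of_nonneg_right t.2.2 (by positivity)
  nlinarith

/-- Second order estimate for solutions of the regularized system. -/
theorem Coeffs.regSol_second [CompleteSpace X] (cf : Coeffs T K) (hT : 0 < T)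
    (hJ : ResolventFamily J K) :
    ∃ C, 0 ≤ C ∧ ∀ (n : ℕ) (v w g : C(I T, X)) (β : ℝ), 0 ≤ β → cf.IsRegSol n v w g →
      (∀ t, ‖v t‖ ≤ β) → (∀ t, ‖K n (v t)‖ ≤ β) → (∀ t, ‖w t‖ ≤ β) → (∀ t, ‖g t‖ ≤ β) →
      (∀ t, ‖K n (g t)‖ ≤ β) → (∀ t, ‖K n (K n (g t))‖ ≤ β) →
      ‖K n (K n (v (zeroTime hT)))‖ ≤ β → ‖K n (w (zeroTime hT))‖ ≤ β →
      ∀ t, ‖K n (K n (v t))‖ ≤ C * β ∧ ‖K n (w t)‖ ≤ C * β := by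
  have hB := cf.B_nonneg
  have hc := cf.c_pos
  -- `P β` bounds `K_n` of the lower order terms, apart from the part `2 B ‖K_n w‖` coming from `2 G
  -- w`.
  set P := 2 * cf.B + (cf.B * (2 * cf.B + cf.B) + 2 * cf.B) + 2 * cf.B with hP
  have hP0 : 0 ≤ P := by positivity
  set D := cf.B ^ 2 + cf.B ^ 2 + 4 * cf.B + 1 with hD
  have hD0 : 0 ≤ D := by positivity
  set E := Real.exp (D / cf.c * T) with hE
  have hE0 : 0 < E := Real.exp_pos _
  set Q := E * ((cf.B + 1) + T * (1 + P ^ 2)) / cf.c with hQ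
  have hQ0 : 0 ≤ Q := by positivity
  refine ⟨Real.sqrt Q, Real.sqrt_nonneg _, ?_⟩
  intro n v w g β hβ h hv hkv hw hg hkg hkkg ha0 hb0
  set a : I T → X := fun t => K n (K n (v t)) with ha
  set b : I T → X := fun t => K n (w t) with hb
  -- After applying `K_n` the weight is `F` and sits on `a = K_n² v`. By symmetry `⟨b, -K_n F a⟩ =
  -- -⟨F a, K_n² w⟩`, which cancels the main part of the derivative of `⟨F a, a⟩`.
  set e : I T → ℝ := fun t => ⟪cf.F t (a t), a t⟫ + ‖b t‖ ^ 2 with he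
  have hel : ∀ t, cf.c * (‖a t‖ ^ 2 + ‖b t‖ ^ 2) ≤ e t := by
    intro t
    have h1 := cf.F_ge t (a t)
    have h2 : cf.c * ‖b t‖ ^ 2 ≤ 1 * ‖b t‖ ^ 2 :=
      mul_le_mul_of_nonneg_right cf.c_le (sq_nonneg _)
    simp only [he]
    linarith
  have hda : HasTimeDeriv a (fun t => K n (K n (w t)) + K n (K n (g t))) :=
    ((h.deriv_v.clm (K n)).clm (K n)).congr (fun _ => rfl) fun t => by simp only [map_add]
  have hdb : HasTimeDeriv b (fun t => -K n (cf.F t (a t)) + K n (cf.lower v w g t)) :=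
    (h.deriv_w.clm (K n)).congr (fun _ => rfl) fun t => by simp only [map_add, map_neg, ha]
  have hed := ((cf.deriv_F.clm_apply hda).inner hda).add hdb.normSq
  have hlow : ∀ t, ‖K n (cf.lower v w g t)‖ ≤ P * β + 2 * cf.B * ‖b t‖ := by
    intro t
    rw [Coeffs.lower, map_neg, norm_neg, map_add, map_add, map_smul, map_add]
    have h1 : ‖(2 : ℝ) • K n (cf.G t (w t))‖ ≤ 2 * (cf.B * (β + ‖b t‖)) := by
      rw [norm_smul, Real.norm_ofNat]
      refine mul_le_mul_of_nonneg_left ((cf.norm_K_G_le n t (w t)).trans ?_) (by norm_num)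
      exact mul_le_mul_of_nonneg_left (add_le_add_left (hw t) _) hB
    have h2 : ‖K n (cf.G t (v t))‖ ≤ cf.B * (2 * β) :=
      (cf.norm_K_G_le n t (v t)).trans
        (mul_le_mul_of_nonneg_left (by linarith [hv t, hkv t]) hB)
    have h3 : ‖cf.G t (v t)‖ ≤ cf.B * β :=
      (cf.norm_G_le t (v t)).trans (mul_le_mul_of_nonneg_left (hv t) hB)
    have h4 : ‖K n (cf.G t (cf.G t (v t)))‖ ≤ cf.B * (cf.B * β + cf.B * (2 * β)) :=
      (cf.norm_K_G_le n t _).trans (mul_le_mul_of_nonneg_left (add_le_add h3 h2) hB)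
    have h5 : ‖K n (cf.G₁ t (v t))‖ ≤ cf.B * (2 * β) :=
      (cf.norm_K_G₁_le n t (v t)).trans
        (mul_le_mul_of_nonneg_left (by linarith [hv t, hkv t]) hB)
    have h6 : ‖K n (cf.G t (g t))‖ ≤ cf.B * (2 * β) :=
      (cf.norm_K_G_le n t (g t)).trans
        (mul_le_mul_of_nonneg_left (by linarith [hg t, hkg t]) hB)
    refine (norm_add₃_le).trans ?_
    have h7 := norm_add_le (K n (cf.G t (cf.G t (v t)))) (K n (cf.G₁ t (v t)))
    rw [hP]
    nlinarith
  have hle : ∀ t, (⟪cf.F t (a t), K n (K n (w t)) + K n (K n (g t))⟫ +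
      ⟪(-(cf.G t).comp (cf.F t)) (a t) + cf.F t (K n (K n (w t)) + K n (K n (g t))), a t⟫ +
      2 * ⟪b t, -K n (cf.F t (a t)) + K n (cf.lower v w g t)⟫) ≤
      D / cf.c * e t + ContinuousMap.const (I T) ((1 + P ^ 2) * β ^ 2) t := by
    intro t
    have h1 : ⟪b t, -K n (cf.F t (a t))⟫ = -⟪cf.F t (a t), K n (K n (w t))⟫ := by
      rw [inner_neg_right, ← hJ.symm, real_inner_comm]
    have h2 : ⟪cf.F t (K n (K n (w t)) + K n (K n (g t))), a t⟫ =
        ⟪cf.F t (a t), K n (K n (w t)) + K n (K n (g t))⟫ := by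
      rw [cf.symm_F, real_inner_comm]
    have h3 : 2 * ⟪cf.F t (a t), K n (K n (g t))⟫ ≤ cf.B ^ 2 * ‖a t‖ ^ 2 + β ^ 2 := by
      refine (two_mul_real_inner_le _ _).trans (add_le_add ?_ ?_)
      · rw [← mul_pow]
        exact pow_le_pow_left₀ (norm_nonneg _) (cf.norm_F_le t _) 2
      · exact pow_le_pow_left₀ (norm_nonneg _) (hkkg t) 2
    have h4 : ⟪(-(cf.G t).comp (cf.F t)) (a t), a t⟫ ≤ cf.B ^ 2 * ‖a t‖ ^ 2 := by
      refine (real_inner_le_norm _ _).trans ?_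
      have h5 : ‖(-(cf.G t).comp (cf.F t)) (a t)‖ ≤ cf.B * (cf.B * ‖a t‖) := by
        rw [neg_apply, norm_neg, ContinuousLinearMap.comp_apply]
        exact (cf.norm_G_le t _).trans (mul_le_mul_of_nonneg_left (cf.norm_F_le t _) hB)
      nlinarith [norm_nonneg (a t)]
    have h5 : 2 * ⟪b t, K n (cf.lower v w g t)⟫ ≤
        (4 * cf.B + 1) * ‖b t‖ ^ 2 + P ^ 2 * β ^ 2 := by
      have h6 := real_inner_le_norm (b t) (K n (cf.lower v w g t))
      have h7 := mul_le_mul_of_nonneg_left (hlow t) (norm_nonneg (b t))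
      nlinarith [sq_nonneg (‖b t‖ - P * β)]
    have h8 : D * (‖a t‖ ^ 2 + ‖b t‖ ^ 2) ≤ D / cf.c * e t := by
      rw [div_mul_eq_mul_div, le_div_iff₀ hc]
      have := mul_le_mul_of_nonneg_left (hel t) hD0
      nlinarith
    rw [inner_add_left, h2, inner_add_right, inner_add_right (b t), h1, ContinuousMap.const_apply]
    refine le_trans ?_ (add_le_add_left h8 _)
    rw [hD]
    nlinarith [sq_nonneg ‖a t‖, sq_nonneg ‖b t‖, sq_nonneg cf.B, mul_nonneg hB (sq_nonneg ‖a t‖),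
      mul_nonneg (sq_nonneg cf.B) (sq_nonneg ‖b t‖)]
  intro t
  have he0 : ∀ t, 0 ≤ e t := fun t => le_trans (by positivity) (hel t)
  have hgr := gronwall hT hed (C := D / cf.c) (by positivity)
    (h := ContinuousMap.const (I T) ((1 + P ^ 2) * β ^ 2))
    (fun t => by simp only [ContinuousMap.const_apply]; positivity) hle (he0 _) t
  have hp := prim_le_const (φ := ContinuousMap.const (I T) ((1 + P ^ 2) * β ^ 2))
    (γ := (1 + P ^ 2) * β ^ 2) (fun _ => le_rfl) t
  have hp' : (t : ℝ) * ((1 + P ^ 2) * β ^ 2) ≤ T * ((1 + P ^ 2) * β ^ 2) :=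
    mul_le_mul_of_nonneg_right t.2.2 (by positivity)
  have he00 : e (zeroTime hT) ≤ (cf.B + 1) * β ^ 2 := by
    have h1 : ⟪cf.F (zeroTime hT) (a (zeroTime hT)), a (zeroTime hT)⟫ ≤ cf.B * β * β := by
      refine (real_inner_le_norm _ _).trans ?_
      refine mul_le_mul ((cf.norm_F_le _ _).trans (mul_le_mul_of_nonneg_left ha0 hB)) ha0
        (norm_nonneg _) (by positivity)
    have h2 := pow_le_pow_left₀ (norm_nonneg _) hb0 2
    change ⟪cf.F (zeroTime hT) (a (zeroTime hT)), a (zeroTime hT)⟫ + ‖K n (w (zeroTime hT))‖ ^ 2 ≤ _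
    linarith
  have hfin : ‖a t‖ ^ 2 + ‖b t‖ ^ 2 ≤ Q * β ^ 2 := by
    rw [hQ, div_mul_eq_mul_div, le_div_iff₀ hc]
    calc _ ≤ E * (e (zeroTime hT) + prim (ContinuousMap.const (I T) ((1 + P ^ 2) * β ^ 2)) t) := by
          rw [mul_comm]; exact (hel t).trans hgr
      _ ≤ E * ((cf.B + 1) * β ^ 2 + T * ((1 + P ^ 2) * β ^ 2)) :=
          mul_le_mul_of_nonneg_left (by linarith) hE0.le
      _ = _ := by ring
  have hsq : (Real.sqrt Q * β) ^ 2 = Q * β ^ 2 := by rw [mul_pow, Real.sq_sqrt hQ0]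
  have hb1 := sq_nonneg ‖b t‖
  have ha1 := sq_nonneg ‖a t‖
  have hSβ : 0 ≤ Real.sqrt Q * β := mul_nonneg (Real.sqrt_nonneg _) hβ
  have ha2 : ‖a t‖ ^ 2 ≤ (Real.sqrt Q * β) ^ 2 := by rw [hsq]; linarith
  have hb2 : ‖b t‖ ^ 2 ≤ (Real.sqrt Q * β) ^ 2 := by rw [hsq]; linarith
  exact ⟨le_of_sq_le_sq ha2 hSβ, le_of_sq_le_sq hb2 hSβ⟩

end Evolution

/-! ### Convergence of the regularized systems and weak solutions -/

section Limit

/-- Pointwise application of a continuous linear map to a continuous curve. -/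
def compT {T : ℝ} {X Y : Type*} [NormedAddCommGroup X] [NormedSpace ℝ X] [NormedAddCommGroup Y]
    [NormedSpace ℝ Y] (L : X →L[ℝ] Y) : C(I T, X) →L[ℝ] C(I T, Y) :=
  L.compLeftContinuous ℝ (I T)

@[simp]
theorem compT_apply {T : ℝ} {X Y : Type*} [NormedAddCommGroup X] [NormedSpace ℝ X]
    [NormedAddCommGroup Y] [NormedSpace ℝ Y] (L : X →L[ℝ] Y) (φ : C(I T, X)) (t : I T) :
    compT L φ t = L (φ t) := rfl

/-- Strong convergence of contractions is uniform on continuous curves. -/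
theorem tendsto_compLeft {T : ℝ} {X : Type*} [NormedAddCommGroup X] [NormedSpace ℝ X]
    {L : ℕ → X →L[ℝ] X} (hL : ∀ n f, ‖L n f‖ ≤ ‖f‖)
    (h : ∀ f, Tendsto (fun n => L n f) atTop (𝓝 f)) (g : C(I T, X)) :
    Tendsto (fun n => compT (L n) g) atTop (𝓝 g) := by
  rw [Metric.tendsto_atTop]
  intro δ hδ
  -- The range of a continuous curve is compact, so convergence on a finite `δ/4`-net suffices, the
  -- operators being contractions.
  obtain ⟨s, -, hs, hcov⟩ := (isCompact_range g.continuous).finite_cover_balls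
    (show 0 < δ / 4 by positivity)
  have hev : ∀ᶠ n in atTop, ∀ x ∈ s, dist (L n x) x < δ / 4 :=
    (eventually_all_finite hs).2 fun x _ => (Metric.tendsto_nhds.1 (h x)) _ (by positivity)
  obtain ⟨N, hN⟩ := hev.exists_forall_of_atTop
  refine ⟨N, fun n hn => ?_⟩
  refine lt_of_le_of_lt ((ContinuousMap.dist_le (C := 3 * δ / 4) (by positivity)).2 fun t => ?_)
    (by linarith)
  obtain ⟨x, hx, hxt⟩ := mem_iUnion₂.1 (hcov (mem_range_self t))
  rw [Metric.mem_ball, dist_eq_norm] at hxt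
  have h1 := hN n hn x hx
  rw [dist_eq_norm] at h1 ⊢
  have h2 := hL n (g t - x)
  have h3 : L n (g t) - g t = L n (g t - x) + (L n x - x) + (x - g t) := by rw [map_sub]; abel
  change ‖L n (g t) - g t‖ ≤ _
  rw [h3]
  have h4 := norm_add₃_le (a := L n (g t - x)) (b := L n x - x) (c := x - g t)
  rw [norm_sub_rev x (g t)] at h4
  linarith

variable {T : ℝ} {X : Type*} [NormedAddCommGroup X] [InnerProductSpace ℝ X] [CompleteSpace X]
  {J K : ℕ → X →L[ℝ] X}

theorem prim_clm {Y : Type*} [NormedAddCommGroup Y] [NormedSpace ℝ Y] [CompleteSpace Y]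
    {X : Type*} [NormedAddCommGroup X] [NormedSpace ℝ X] [CompleteSpace X] (L : X →L[ℝ] Y)
    (φ : C(I T, X)) (t : I T) :
    L (prim φ t) = prim (compT L φ) t := by
  rw [prim_apply, prim_apply, ← ContinuousLinearMap.intervalIntegral_comp_comm L
    (intervalIntegrable_ex φ.continuous t.2)]
  refine intervalIntegral.integral_congr fun s hs => ?_
  rw [uIcc_of_le t.2.1] at hs
  have hs' : s ∈ Icc 0 T := Icc_subset_Icc_right t.2.2 hs
  simp only [ex_of_mem _ hs']
  rfl

theorem ResolventFamily.inner_J (hJ : ResolventFamily J K) (n : ℕ) (f g : X) :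
    ⟪J n f, g⟫ = ⟪f, J n g⟫ := by
  rw [hJ.eq_add, hJ.eq_add, inner_add_left, inner_add_right, real_inner_smul_left,
    real_inner_smul_right, hJ.symm]

/-- The hypothesis encodes `f₂ = ∂² f`. Then `K_n J_m f = K_m f + ε_n J_n K_m f₂`, whose leading
term does not depend on `n`. -/
theorem ResolventFamily.norm_K_sub_le (hJ : ResolventFamily J K) (n k m : ℕ) {f f₂ : X}
    (hf : ∀ n, K n f = J n f₂) :
    ‖K n (J m f) - K k (J m f)‖ ≤ (eps n + eps k) * ‖K m f₂‖ := by
  have h1 : ∀ n, K n (J m f) = K m f + eps n • J n (K m f₂) := fun n => by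
    rw [hJ.comm, hJ.eq_add, hf, hJ.comm]
  have h2 : ∀ n, ‖eps n • J n (K m f₂)‖ ≤ eps n * ‖K m f₂‖ := fun n => by
    rw [norm_smul, Real.norm_of_nonneg (eps_pos n).le]
    exact mul_le_mul_of_nonneg_left (hJ.norm_le _ _) (eps_pos n).le
  rw [h1, h1, add_sub_add_left_eq_sub, add_mul]
  exact (norm_sub_le _ _).trans (add_le_add (h2 n) (h2 k))

/-- The commutation defect of two Yosida approximations. -/
theorem ResolventFamily.inner_defect (hJ : ResolventFamily J K) (n k : ℕ) (y y' w w' : X) :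
    ⟪y - y', K n w - K k w'⟫ = ⟪K n y - K k y', w - w'⟫ +
      (eps n - eps k) * (⟪K n y, K k w'⟫ - ⟪K k y', K n w⟫) := by
  -- A resolvent identity: writing `y = J_n y - ε_n K_n y` and exchanging `J_n K_k` with `K_n J_k`
  -- produces the factor `ε_k - ε_n`.
  have key : ∀ (n k : ℕ) (y w' : X),
      ⟪y, K k w'⟫ = ⟪K n y, w'⟫ + (eps k - eps n) * ⟪K n y, K k w'⟫ := by
    intro n k y w'
    have h1 : y = J n y - eps n • K n y := by rw [hJ.eq_add]; abel
    have h2 : ⟪J n y, K k w'⟫ = ⟪K n y, w'⟫ + eps k * ⟪K n y, K k w'⟫ := by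
      rw [← hJ.symm, hJ.comm, hJ.inner_J, hJ.eq_add, inner_add_right, real_inner_smul_right]
    conv_lhs => rw [h1]
    rw [inner_sub_left, real_inner_smul_left, h2]
    ring
  simp only [inner_sub_left, inner_sub_right]
  rw [key n k y w', key k n y' w, ← hJ.symm n y w, ← hJ.symm k y' w']
  ring

theorem Coeffs.isRegSol_zero (cf : Coeffs T K) (n : ℕ) : cf.IsRegSol n 0 0 0 where
  deriv_v := HasTimeDeriv.zero.congr (fun _ => rfl) fun _ => by simp
  deriv_w := HasTimeDeriv.zero.congr (fun _ => rfl) fun _ => by simp [Coeffs.lower]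

/-- Uniform bounds for the regularized solutions with smooth data. -/
theorem Coeffs.regSol_bound (cf : Coeffs T K) (hT : 0 < T) (hJ : ResolventFamily J K) (m : ℕ)
    {v₀ v₂ w₀ : X} (hv₀ : ∀ n, K n v₀ = J n v₂) {g g₂ : C(I T, X)}
    (hg : ∀ n t, K n (g t) = J n (g₂ t)) :
    ∃ β, 0 ≤ β ∧ (∀ t, ‖K m (g₂ t)‖ ≤ β) ∧ ‖K m v₂‖ ≤ β ∧ ∀ (n : ℕ) (v w : C(I T, X)),
      cf.IsRegSol n v w (compT (J m) g) →
      v (zeroTime hT) = J m v₀ → w (zeroTime hT) = J m w₀ →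
      ∀ t, ‖K n (K n (v t))‖ ≤ β ∧ ‖K n (w t)‖ ≤ β := by
  obtain ⟨C, hC, H⟩ := cf.regSol_diff hT
  obtain ⟨D, hD, H'⟩ := cf.regSol_second hT hJ
  set γ := ‖v₀‖ ^ 2 + ‖K m v₀‖ ^ 2 + ‖w₀‖ ^ 2 + ‖g‖ ^ 2 + (‖K m‖ * ‖g‖) ^ 2 with hγ
  set β := Real.sqrt (C * γ) + ‖g‖ + ‖K m‖ * ‖g‖ + ‖K m‖ * ‖g₂‖ + ‖K m v₂‖ + ‖K m w₀‖ with hβ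
  have hs := Real.sqrt_nonneg (C * γ)
  have p1 : 0 ≤ ‖K m‖ * ‖g‖ := by positivity
  have p2 : 0 ≤ ‖K m‖ * ‖g₂‖ := by positivity
  have p3 := norm_nonneg g
  have p4 := norm_nonneg (K m v₂)
  have p5 := norm_nonneg (K m w₀)
  have hβ0 : 0 ≤ β := by positivity
  have hDβ : β ≤ D * β + β := by nlinarith
  have hDβ' : D * β ≤ D * β + β := by linarith
  have hKg : ∀ t, ‖K m (g t)‖ ≤ ‖K m‖ * ‖g‖ := fun t =>
    ((K m).le_opNorm _).trans (mul_le_mul_of_nonneg_left (g.norm_coe_le_norm t) (norm_nonneg _))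
  have hKg₂ : ∀ t, ‖K m (g₂ t)‖ ≤ ‖K m‖ * ‖g₂‖ := fun t =>
    ((K m).le_opNorm _).trans (mul_le_mul_of_nonneg_left (g₂.norm_coe_le_norm t) (norm_nonneg _))
  have hKJ : ∀ n f, ‖K n (J m f)‖ ≤ ‖K m f‖ := fun n f => by
    rw [hJ.comm]; exact hJ.norm_le _ _
  -- Smoothing by `J_m` bounds `K_n²` of the data uniformly in `n`; the bound may blow up as `m`
  -- grows.
  have hKKJ : ∀ n (f f₂ : X), (∀ n, K n f = J n f₂) → ‖K n (K n (J m f))‖ ≤ ‖K m f₂‖ := by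
    intro n f f₂ hf
    rw [hJ.comm, hf, hJ.comm, hJ.comm]
    exact (hJ.norm_le _ _).trans (hJ.norm_le _ _)
  refine ⟨D * β + β, by positivity, fun t => (hKg₂ t).trans (by linarith), by linarith, ?_⟩
  intro n v w hsol hv hw
  have hgt : ∀ t, compT (J m) g t = J m (g t) := fun _ => rfl
  -- Comparison with the zero solution at the same `n`, where the defect vanishes by symmetry, gives
  -- the first order bounds required by the second order estimate.
  have hfirst := H n n v w _ 0 0 0 γ hsol (cf.isRegSol_zero n)
    (fun t => by
      simp only [ContinuousMap.zero_apply, map_zero, sub_zero]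
      rw [← hJ.symm]
      have : 0 ≤ γ := by positivity
      linarith)
    (fun t => by
      rw [hgt, ContinuousMap.zero_apply, sub_zero]
      have h1 := pow_le_pow_left₀ (norm_nonneg _)
        ((hJ.norm_le m (g t)).trans (g.norm_coe_le_norm t)) 2
      rw [hγ]
      nlinarith [sq_nonneg ‖v₀‖, sq_nonneg ‖K m v₀‖, sq_nonneg ‖w₀‖, sq_nonneg (‖K m‖ * ‖g‖)])
    (fun t => by
      rw [hgt, ContinuousMap.zero_apply, map_zero, sub_zero]
      have h1 := pow_le_pow_left₀ (norm_nonneg _) ((hKJ n (g t)).trans (hKg t)) 2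
      rw [hγ]
      nlinarith [sq_nonneg ‖v₀‖, sq_nonneg ‖K m v₀‖, sq_nonneg ‖w₀‖, sq_nonneg ‖g‖])
    (by
      rw [hv, ContinuousMap.zero_apply, sub_zero]
      have h1 := pow_le_pow_left₀ (norm_nonneg _) (hJ.norm_le m v₀) 2
      rw [hγ]
      nlinarith [sq_nonneg ‖g‖, sq_nonneg ‖K m v₀‖, sq_nonneg ‖w₀‖, sq_nonneg (‖K m‖ * ‖g‖)])
    (by
      rw [hv, ContinuousMap.zero_apply, map_zero, sub_zero]
      have h1 := pow_le_pow_left₀ (norm_nonneg _) (hKJ n v₀) 2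
      rw [hγ]
      nlinarith [sq_nonneg ‖g‖, sq_nonneg ‖v₀‖, sq_nonneg ‖w₀‖, sq_nonneg (‖K m‖ * ‖g‖)])
    (by
      rw [hw, ContinuousMap.zero_apply, sub_zero]
      have h1 := pow_le_pow_left₀ (norm_nonneg _) (hJ.norm_le m w₀) 2
      rw [hγ]
      nlinarith [sq_nonneg ‖g‖, sq_nonneg ‖v₀‖, sq_nonneg ‖K m v₀‖, sq_nonneg (‖K m‖ * ‖g‖)])
  simp only [ContinuousMap.zero_apply, map_zero, sub_zero] at hfirst
  have hsqrt : ∀ x : ℝ, x ^ 2 ≤ C * γ → x ≤ β := fun x hx => by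
    have := Real.le_sqrt_of_sq_le hx
    linarith
  have hsecond := H' n v w _ β hβ0 hsol
    (fun t => hsqrt _ (by
      nlinarith [hfirst t, sq_nonneg ‖w t‖, sq_nonneg ‖K n (v t)‖]))
    (fun t => hsqrt _ (by nlinarith [hfirst t, sq_nonneg ‖w t‖, sq_nonneg ‖v t‖]))
    (fun t => hsqrt _ (by nlinarith [hfirst t, sq_nonneg ‖v t‖, sq_nonneg ‖K n (v t)‖]))
    (fun t => ((hJ.norm_le m (g t)).trans (g.norm_coe_le_norm t)).trans (by linarith))
    (fun t => ((hKJ n (g t)).trans (hKg t)).trans (by linarith))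
    (fun t => ((hKKJ n (g t) (g₂ t) fun n => hg n t).trans (hKg₂ t)).trans (by linarith))
    (by rw [hv]; exact (hKKJ n v₀ v₂ hv₀).trans (by linarith))
    (by rw [hw]; exact (hKJ n w₀).trans (by linarith))
  exact fun t => ⟨(hsecond t).1.trans hDβ', (hsecond t).2.trans hDβ'⟩

/-- The regularized solutions form a Cauchy sequence. -/
theorem Coeffs.regSol_cauchy (cf : Coeffs T K) (hT : 0 < T) (hJ : ResolventFamily J K)
    {v₀ v₂ w₀ : X} (hv₀ : ∀ n, K n v₀ = J n v₂) {g g₂ : C(I T, X)}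
    (hg : ∀ n t, K n (g t) = J n (g₂ t)) {v w : ℕ → C(I T, X)}
    (hsol : ∀ n, cf.IsRegSol n (v n) (w n) g) (hv : ∀ n, v n (zeroTime hT) = v₀)
    (hw : ∀ n, w n (zeroTime hT) = w₀) {η : ℝ} (hη : 0 < η) :
    ∃ N, ∀ n ≥ N, ∀ k ≥ N, ∀ t,
      ‖v n t - v k t‖ ^ 2 + ‖K n (v n t) - K k (v k t)‖ ^ 2 + ‖w n t - w k t‖ ^ 2 ≤ η := by
  obtain ⟨C, hC, H⟩ := cf.regSol_diff hT
  set Jg : ℕ → C(I T, X) := fun m => compT (J m) g with hJg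
  set Jg₂ : ℕ → C(I T, X) := fun m => compT (J m) g₂ with hJg₂
  -- The cost of replacing the data by their `J_m`-smoothings, measured so as to bound the effect on
  -- the solutions for all `n` at once.
  set γ : ℕ → ℝ := fun m => ‖v₀ - J m v₀‖ ^ 2 + ‖v₂ - J m v₂‖ ^ 2 + ‖w₀ - J m w₀‖ ^ 2 +
    ‖g - Jg m‖ ^ 2 + ‖g₂ - Jg₂ m‖ ^ 2 with hγ
  have hγ0 : ∀ m, 0 ≤ γ m := fun m => by positivity
  have hγlim : Tendsto γ atTop (𝓝 0) := by
    have h1 : ∀ f : X, Tendsto (fun m => ‖f - J m f‖ ^ 2) atTop (𝓝 0) := fun f => by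
      have := ((tendsto_const_nhds (x := f)).sub (hJ.tendsto f)).norm.pow 2
      simpa using this
    have h2 : ∀ f : C(I T, X), Tendsto
        (fun m => ‖f - compT (J m) f‖ ^ 2) atTop (𝓝 0) := fun f => by
      have := ((tendsto_const_nhds (x := f)).sub
        (tendsto_compLeft hJ.norm_le hJ.tendsto f)).norm.pow 2
      simpa using this
    have := ((((h1 v₀).add (h1 v₂)).add (h1 w₀)).add (h2 g)).add (h2 g₂)
    simpa using this
  -- `m` is fixed before `N`: the bound `β` below depends on `m`, and `N` is then chosen to make
  -- `ε_N β²` small. Each of three comparisons costs `η / 9`, tripled by the squared triangle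
  -- inequality.
  obtain ⟨m, hm⟩ : ∃ m, C * γ m < η / 9 := by
    have h1 : Tendsto (fun m => C * γ m) atTop (𝓝 0) := by simpa using hγlim.const_mul C
    exact (h1.eventually_lt_const (by positivity)).exists
  choose v' w' hsol' hv' hw' using fun n => cf.exists_isRegSol hT n (J m v₀) (J m w₀) (Jg m)
  have hclose : ∀ n t, ‖v n t - v' n t‖ ^ 2 + ‖K n (v n t) - K n (v' n t)‖ ^ 2 +
      ‖w n t - w' n t‖ ^ 2 ≤ η / 9 := by
    intro n t
    refine (H n n _ _ _ _ _ _ (γ m) (hsol n) (hsol' n) (fun t => ?_) (fun t => ?_) (fun t => ?_)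
      ?_ ?_ ?_ t).trans hm.le
    · rw [← map_sub, ← map_sub, ← map_sub, ← map_sub, ← hJ.symm]
      linarith [hγ0 m]
    · have h1 : ‖g t - Jg m t‖ ≤ ‖g - Jg m‖ := (g - Jg m).norm_coe_le_norm t
      have h2 := pow_le_pow_left₀ (norm_nonneg _) h1 2
      simp only [hγ]
      nlinarith [sq_nonneg ‖v₀ - J m v₀‖, sq_nonneg ‖v₂ - J m v₂‖, sq_nonneg ‖w₀ - J m w₀‖,
        sq_nonneg ‖g₂ - Jg₂ m‖]
    · have h1 : ‖g₂ t - Jg₂ m t‖ ≤ ‖g₂ - Jg₂ m‖ := (g₂ - Jg₂ m).norm_coe_le_norm t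
      have h3 : ‖K n (g t) - K n (Jg m t)‖ ≤ ‖g₂ t - Jg₂ m t‖ := by
        have e : K n (Jg m t) = J n (Jg₂ m t) := by
          change K n (J m (g t)) = J n (J m (g₂ t))
          rw [hJ.comm, hg]
        rw [hg, e, ← map_sub]
        exact hJ.norm_le _ _
      have h2 := pow_le_pow_left₀ (norm_nonneg _) (h3.trans h1) 2
      simp only [hγ]
      nlinarith [sq_nonneg ‖v₀ - J m v₀‖, sq_nonneg ‖v₂ - J m v₂‖, sq_nonneg ‖w₀ - J m w₀‖,
        sq_nonneg ‖g - Jg m‖]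
    · rw [hv, hv']
      simp only [hγ]
      nlinarith [sq_nonneg ‖v₂ - J m v₂‖, sq_nonneg ‖w₀ - J m w₀‖,
        sq_nonneg ‖g - Jg m‖, sq_nonneg ‖g₂ - Jg₂ m‖]
    · have h3 : ‖K n v₀ - K n (J m v₀)‖ ≤ ‖v₂ - J m v₂‖ := by
        rw [hJ.comm, hv₀, hv₀, ← map_sub]
        exact hJ.norm_le _ _
      have h2 := pow_le_pow_left₀ (norm_nonneg _) h3 2
      rw [hv, hv']
      simp only [hγ]
      nlinarith [sq_nonneg ‖v₀ - J m v₀‖, sq_nonneg ‖w₀ - J m w₀‖,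
        sq_nonneg ‖g - Jg m‖, sq_nonneg ‖g₂ - Jg₂ m‖]
    · rw [hw, hw']
      simp only [hγ]
      nlinarith [sq_nonneg ‖v₀ - J m v₀‖, sq_nonneg ‖v₂ - J m v₂‖,
        sq_nonneg ‖g - Jg m‖, sq_nonneg ‖g₂ - Jg₂ m‖]
  obtain ⟨β, hβ0, hβg, hβv, hβ⟩ := cf.regSol_bound hT hJ m (w₀ := w₀) hv₀ hg
  have hlim : Tendsto (fun n => C * (2 * (eps n + 1 * eps n) * β ^ 2)) atTop (𝓝 0) := by
    have := (((tendsto_eps.add (tendsto_eps.const_mul 1)).const_mul 2).mul_const (β ^ 2)).const_mul C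
    simpa using this
  have hmono : ∀ {n N : ℕ}, N ≤ n → eps n ≤ eps N := fun h => Nat.one_div_le_one_div h
  obtain ⟨N, hN⟩ := (hlim.eventually_lt_const
    (show (0 : ℝ) < η / 9 by positivity)).exists_forall_of_atTop
  refine ⟨N, fun n hn k hk t => ?_⟩
  have hmid : ‖v' n t - v' k t‖ ^ 2 + ‖K n (v' n t) - K k (v' k t)‖ ^ 2 +
      ‖w' n t - w' k t‖ ^ 2 ≤ η / 9 := by
    have e1 := eps_pos n
    have e2 := eps_pos k
    have e3 := eps_le_one n
    have e4 := eps_le_one k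
    have hsmall : ∀ f : X, ‖f‖ ≤ (eps n + eps k) * β → ‖f‖ ^ 2 ≤ 2 * (eps n + eps k) * β ^ 2 := by
      intro f hf
      refine (pow_le_pow_left₀ (norm_nonneg _) hf 2).trans ?_
      rw [mul_pow]
      refine mul_le_mul_of_nonneg_right ?_ (sq_nonneg β)
      nlinarith
    refine (H n k _ _ _ _ _ _ (2 * (eps n + eps k) * β ^ 2) (hsol' n) (hsol' k) (fun t => ?_)
      (fun t => ?_) (fun t => ?_) ?_ ?_ ?_ t).trans ?_
    -- Only here do two different regularizations meet; the defect is paid for by the second order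
    -- bounds on the smoothed solutions.
    · rw [hJ.inner_defect]
      refine add_le_add_right ?_ _
      have b1 := hβ n _ _ (hsol' n) (hv' n) (hw' n) t
      have b2 := hβ k _ _ (hsol' k) (hv' k) (hw' k) t
      have c1 : |⟪K n (K n (v' n t)), K k (w' k t)⟫| ≤ β * β :=
        (abs_real_inner_le_norm _ _).trans (mul_le_mul b1.1 b2.2 (norm_nonneg _) hβ0)
      have c2 : |⟪K k (K k (v' k t)), K n (w' n t)⟫| ≤ β * β :=
        (abs_real_inner_le_norm _ _).trans (mul_le_mul b2.1 b1.2 (norm_nonneg _) hβ0)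
      have c3 : |eps n - eps k| ≤ eps n + eps k := abs_le.2 ⟨by linarith, by linarith⟩
      have c4 := (abs_sub ⟪K n (K n (v' n t)), K k (w' k t)⟫
        ⟪K k (K k (v' k t)), K n (w' n t)⟫).trans (add_le_add c1 c2)
      refine (le_abs_self _).trans ?_
      rw [abs_mul]
      refine (mul_le_mul c3 c4 (abs_nonneg _) (by linarith)).trans (le_of_eq (by ring))
    · rw [sub_self, norm_zero]
      have := mul_nonneg (show 0 ≤ 2 * (eps n + eps k) by linarith) (sq_nonneg β)
      simpa using this
    · refine hsmall _ ((hJ.norm_K_sub_le n k m (f := g t) (f₂ := g₂ t) fun n => hg n t).trans ?_)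
      exact mul_le_mul_of_nonneg_left (hβg t) (by linarith)
    · rw [hv', hv', sub_self, norm_zero]
      have := mul_nonneg (show 0 ≤ 2 * (eps n + eps k) by linarith) (sq_nonneg β)
      simpa using this
    · rw [hv', hv']
      refine hsmall _ ((hJ.norm_K_sub_le n k m hv₀).trans ?_)
      exact mul_le_mul_of_nonneg_left hβv (by linarith)
    · rw [hw', hw', sub_self, norm_zero]
      have := mul_nonneg (show 0 ≤ 2 * (eps n + eps k) by linarith) (sq_nonneg β)
      simpa using this
    · refine le_trans ?_ (hN N le_rfl).le
      refine mul_le_mul_of_nonneg_left (mul_le_mul_of_nonneg_right ?_ (sq_nonneg β)) hC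
      have := hmono hn
      have := hmono hk
      linarith
  have htri : ∀ a b c d : X,
      ‖a - d‖ ^ 2 ≤ 3 * ‖a - b‖ ^ 2 + 3 * ‖b - c‖ ^ 2 + 3 * ‖d - c‖ ^ 2 := by
    intro a b c d
    have h1 : a - d = (a - b) + (b - c) + (c - d) := by abel
    have h2 := norm_add₃_le (a := a - b) (b := b - c) (c := c - d)
    rw [← h1, norm_sub_rev c d] at h2
    have h3 := pow_le_pow_left₀ (norm_nonneg _) h2 2
    nlinarith [sq_nonneg (‖a - b‖ - ‖b - c‖), sq_nonneg (‖b - c‖ - ‖d - c‖),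
      sq_nonneg (‖a - b‖ - ‖d - c‖)]
  have t1 := htri (v n t) (v' n t) (v' k t) (v k t)
  have t2 := htri (K n (v n t)) (K n (v' n t)) (K k (v' k t)) (K k (v k t))
  have t3 := htri (w n t) (w' n t) (w' k t) (w k t)
  have c1 := hclose n t
  have c2 := hclose k t
  linarith

/-- Existence of weak solutions. -/
theorem Coeffs.exists_weak (cf : Coeffs T K) (hT : 0 < T) (hJ : ResolventFamily J K)
    {v₀ v₂ : X} (w₀ : X) (hv₀ : ∀ n, K n v₀ = J n v₂) {g g₂ : C(I T, X)}
    (hg : ∀ n t, K n (g t) = J n (g₂ t)) :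
    ∃ v w y : C(I T, X), v (zeroTime hT) = v₀ ∧ w (zeroTime hT) = w₀ ∧
      HasTimeDeriv v (fun t => w t + g t) ∧ (∀ m t, K m (v t) = J m (y t)) ∧
      ∀ m t, J m (J m (cf.M t (w t + cf.G t (v t)))) =
        J m (J m (cf.M (zeroTime hT) (w₀ + cf.G (zeroTime hT) v₀))) - J m (K m (prim y t)) := by
  choose v w hsol hv hw using fun n => cf.exists_isRegSol hT n v₀ w₀ g
  set y : ℕ → C(I T, X) := fun n => compT (K n) (v n) with hy
  have hyt : ∀ n t, y n t = K n (v n t) := fun _ _ => rfl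
  have hcauchy : ∀ u : ℕ → C(I T, X), (∀ n k t, ‖u n t - u k t‖ ^ 2 ≤ ‖v n t - v k t‖ ^ 2 +
      ‖K n (v n t) - K k (v k t)‖ ^ 2 + ‖w n t - w k t‖ ^ 2) → ∃ l, Tendsto u atTop (𝓝 l) := by
    intro u hu
    refine cauchySeq_tendsto_of_complete (Metric.cauchySeq_iff.2 fun δ hδ => ?_)
    obtain ⟨N, hN⟩ := cf.regSol_cauchy hT hJ hv₀ hg hsol hv hw
      (show 0 < (δ / 2) ^ 2 by positivity)
    refine ⟨N, fun n hn k hk => ?_⟩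
    refine lt_of_le_of_lt ((ContinuousMap.dist_le (C := δ / 2) (by positivity)).2 fun t => ?_)
      (by linarith)
    rw [dist_eq_norm]
    exact le_of_sq_le_sq ((hu n k t).trans (hN n hn k hk t)) (by positivity)
  obtain ⟨v', hv'⟩ := hcauchy v fun n k t => by
    linarith [sq_nonneg ‖K n (v n t) - K k (v k t)‖, sq_nonneg ‖w n t - w k t‖]
  obtain ⟨w', hw'⟩ := hcauchy w fun n k t => by
    linarith [sq_nonneg ‖K n (v n t) - K k (v k t)‖, sq_nonneg ‖v n t - v k t‖]
  obtain ⟨y', hy'⟩ := hcauchy y fun n k t => by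
    rw [hyt, hyt]
    linarith [sq_nonneg ‖v n t - v k t‖, sq_nonneg ‖w n t - w k t‖]
  have hpt : ∀ {u : ℕ → C(I T, X)} {l : C(I T, X)}, Tendsto u atTop (𝓝 l) →
      ∀ t, Tendsto (fun n => u n t) atTop (𝓝 (l t)) := fun h t =>
    ((continuous_eval_const (F := C(I T, X)) t).tendsto _).comp h
  have hv'0 : v' (zeroTime hT) = v₀ :=
    tendsto_nhds_unique (hpt hv' _) (by simp only [hv]; exact tendsto_const_nhds)
  have hw'0 : w' (zeroTime hT) = w₀ :=
    tendsto_nhds_unique (hpt hw' _) (by simp only [hw]; exact tendsto_const_nhds)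
  refine ⟨v', w', y', hv'0, hw'0, ?_, ?_, ?_⟩
  · have h1 : ∀ n t, v n t = v₀ + prim (w n + g) t := fun n t => by
      rw [prim_congr_of_hasTimeDeriv hT (v := w n + g) (hsol n).deriv_v t, hv]
    have h2 : ∀ t, v' t = v₀ + prim (w' + g) t := fun t => by
      refine tendsto_nhds_unique (hpt hv' t) ?_
      simp only [h1]
      refine tendsto_const_nhds.add (hpt (u := fun n => prim (w n + g)) ?_ t)
      exact (primL.continuous.tendsto _).comp (hw'.add tendsto_const_nhds)
    have h3 : HasTimeDeriv (fun _ : I T => v₀) (fun _ => (0 : X)) :=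
      hasTimeDeriv_of_eqOn (f := fun _ => v₀) (fun _ => rfl) fun t => hasDerivWithinAt_const _ _ _
    exact (h3.add (hasTimeDeriv_prim (w' + g))).congr (fun t => (h2 t).symm) fun t => zero_add _
  · intro m t
    -- In the limit this becomes `K_m v = J_m y`, which encodes `y = ∂² v`.
    have h1 : ∀ n, J m (y n t) = K m (v n t) + eps n • K m (y n t) := fun n => by
      rw [hyt, ← hJ.comm, hJ.eq_add, map_add, map_smul]
    have h2 := ((J m).continuous.tendsto _).comp (hpt hy' t)
    have h3 := (((K m).continuous.tendsto _).comp (hpt hv' t)).add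
      (tendsto_eps.smul (((K m).continuous.tendsto _).comp (hpt hy' t)))
    rw [zero_smul, add_zero] at h3
    exact tendsto_nhds_unique (h3.congr fun n => (h1 n).symm) h2
  · intro m t
    set q : ℕ → I T → X := fun n t => cf.M t (w n t + cf.G t (v n t)) with hq
    -- The lower order terms are designed for this: `M(w + G v)` has time derivative exactly `-K_n²
    -- v`.
    have hdq : ∀ n, HasTimeDeriv (q n) (fun t => -K n (K n (v n t))) := by
      intro n
      refine (cf.deriv_M.clm_apply ((hsol n).deriv_w.add
        (cf.deriv_G.clm_apply (hsol n).deriv_v))).congr (fun _ => rfl) fun t => ?_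
      have h1 := cf.M_F t (K n (K n (v n t)))
      simp only [Coeffs.lower, ContinuousLinearMap.comp_apply, map_add, map_neg, h1,
        two_smul]
      abel
    -- `K_n² v = K_n y` need not converge in `X`. One factor `J_m` turns the main term into `K_m J_m
    -- y`; the second bounds the remainder by `ε_n` times a constant depending on `m`.
    set c : ℕ → C(I T, X) := fun n => compT (K m)
      (compT (J m) (y n)) +
        eps n • compT (K m) (compT (K m)
          (compT (J n) (y n))) with hc
    have hct : ∀ n t, c n t = J m (J m (K n (K n (v n t)))) := by
      intro n t
      change K m (J m (y n t)) + eps n • K m (K m (J n (y n t))) = J m (J m (K n (y n t)))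
      rw [← hJ.comm m n, ← hJ.comm m m, hJ.comm m n, hJ.eq_add n (y n t), map_add, map_add,
        map_smul, map_smul]
    have hc' : Tendsto c atTop (𝓝 (compT (J m) (compT (K m) y'))) := by
      have e : compT (J m) (compT (K m) y') = compT (K m) (compT (J m) y') := by
        ext t
        exact (hJ.comm m m _).symm
      rw [e]
      have h1 := ((compT (K m)).comp (compT (J m))).continuous.tendsto y' |>.comp hy'
      obtain ⟨D, hD⟩ := hy'.norm.bddAbove_range
      have h2 : Tendsto (fun n => eps n • compT (K m) (compT (K m) (compT (J n) (y n)))) atTop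
          (𝓝 0) := by
        refine squeeze_zero_norm (a := fun n => eps n *
          (‖compT (T := T) (K m)‖ * (‖compT (T := T) (K m)‖ * D))) (fun n => ?_) ?_
        · rw [norm_smul, Real.norm_of_nonneg (eps_pos n).le]
          refine mul_le_mul_of_nonneg_left ?_ (eps_pos n).le
          refine (ContinuousLinearMap.le_opNorm _ _).trans
            (mul_le_mul_of_nonneg_left ?_ (norm_nonneg _))
          refine (ContinuousLinearMap.le_opNorm _ _).trans
            (mul_le_mul_of_nonneg_left ?_ (norm_nonneg _))
          have h3 : ‖y n‖ ≤ D := hD ⟨n, rfl⟩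
          refine (ContinuousMap.norm_le _ ((norm_nonneg _).trans h3)).2 fun t => ?_
          exact (hJ.norm_le n _).trans ((ContinuousMap.norm_coe_le_norm _ t).trans h3)
        · simpa using tendsto_eps.mul_const (‖compT (T := T) (K m)‖ * (‖compT (T := T) (K m)‖ * D))
      simpa using h1.add h2
    have hq1 : ∀ n, J m (J m (q n t)) = J m (J m (q n (zeroTime hT))) - prim (c n) t := by
      intro n
      have h0 : HasTimeDeriv (fun t => J m (J m (q n t))) (-c n : C(I T, X)) :=
        (((hdq n).clm (J m)).clm (J m)).congr (fun _ => rfl) fun t => by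
          rw [ContinuousMap.neg_apply, hct, map_neg, map_neg]
      have h1 := prim_congr_of_hasTimeDeriv hT (u := ⟨_, h0.continuous⟩) (v := -c n) h0 t
      simp only [ContinuousMap.coe_mk] at h1
      rw [h1, ← primL_apply, map_neg, primL_apply, ContinuousMap.neg_apply, ← sub_eq_add_neg]
    have hqt : ∀ t, Tendsto (fun n => J m (J m (q n t))) atTop
        (𝓝 (J m (J m (cf.M t (w' t + cf.G t (v' t)))))) := fun t =>
      (((J m).comp ((J m).comp (cf.M t))).continuous.tendsto _).comp
        ((hpt hw' t).add (((cf.G t).continuous.tendsto _).comp (hpt hv' t)))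
    have h2 := (hqt (zeroTime hT)).sub (hpt (((primL (T := T)).continuous.tendsto _).comp hc') t)
    rw [hv'0, hw'0] at h2
    rw [prim_clm, prim_clm]
    exact tendsto_nhds_unique (hqt t) (h2.congr fun n => (hq1 n).symm)

end Limit

/-! ### The coefficients of the linear problem -/

section Coefficients

theorem resolventFamily_jo : ResolventFamily jo ko where
  symm := inner_ko_comm
  eq_add := jo_apply
  norm_le := norm_jo_le
  comm := ko_jo
  tendsto := tendsto_jo

variable {θ : ℝ → ℝ}

theorem IsMollifier.one_add_pos (hθ : IsMollifier θ) (x : ℝ) : 0 < 1 + θ x := by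
  linarith [hθ.nonneg x]

theorem IsMollifier.coef (hθ : IsMollifier θ) : Coef θ := .of_compact hθ.smooth hθ.compact

theorem IsMollifier.coefM (hθ : IsMollifier θ) : Coef fun x => 1 + θ x :=
  ⟨contDiff_const.add hθ.smooth, 1, by simpa using hθ.compact⟩

theorem IsMollifier.coefF (hθ : IsMollifier θ) : Coef fun x => 1 / (1 + θ x) :=
  ⟨contDiff_const.div (contDiff_const.add hθ.smooth) fun x => (hθ.one_add_pos x).ne', 1,
    hθ.compact.comp_left (g := fun y => 1 / (1 + y) - 1) (by simp)⟩

theorem IsMollifier.coefG (hθ : IsMollifier θ) : Coef fun x => deriv θ x / (1 + θ x) :=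
  .of_compact ((contDiff_deriv hθ.smooth).div (contDiff_const.add hθ.smooth)
    fun x => (hθ.one_add_pos x).ne') (by
      simp only [div_eq_mul_inv]
      exact hθ.compact.deriv.mul_right)

theorem IsMollifier.hasDerivAt (hθ : IsMollifier θ) (x : ℝ) : HasDerivAt θ (deriv θ x) x :=
  (hθ.smooth.differentiable (by simp) x).hasDerivAt

theorem IsMollifier.coefM_mul_coefG (hθ : IsMollifier θ) (s : ℝ) (f : L2) :
    hθ.coefM.mul s (hθ.coefG.mul s f) = hθ.coefM.deriv.mul s f := by
  rw [Coef.mul, Coef.mul, mulL_mulL, Coef.mul]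
  congr 2
  ext x
  have h1 : deriv (fun x => 1 + θ x) (x - s) = deriv θ (x - s) := by rw [deriv_const_add]
  have := (hθ.one_add_pos (x - s)).ne'
  simp only [BoundedContinuousFunction.mul_apply, Coef.shift_apply, h1]
  field_simp

theorem IsMollifier.coefG_mul_coefF (hθ : IsMollifier θ) (s : ℝ) (f : L2) :
    hθ.coefG.mul s (hθ.coefF.mul s f) = -hθ.coefF.deriv.mul s f := by
  rw [Coef.mul, Coef.mul, mulL_mulL, Coef.mul, ← neg_apply, ← map_neg]
  congr 2
  ext x
  have h0 := (hθ.one_add_pos (x - s)).ne'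
  have h1 : deriv (fun x => 1 / (1 + θ x)) (x - s) = -deriv θ (x - s) / (1 + θ (x - s)) ^ 2 := by
    have := ((hθ.hasDerivAt (x - s)).const_add 1).inv h0
    simp only [one_div]
    exact this.deriv
  simp only [BoundedContinuousFunction.mul_apply, BoundedContinuousFunction.coe_neg, Pi.neg_apply,
    Coef.shift_apply, h1]
  field_simp

theorem IsMollifier.coefM_mul_coefF (hθ : IsMollifier θ) (s : ℝ) (f : L2) :
    hθ.coefM.mul s (hθ.coefF.mul s f) = f := by
  rw [Coef.mul, Coef.mul, mulL_mulL]
  conv_rhs => rw [← mulL_one f]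
  congr 2
  ext x
  have h0 := (hθ.one_add_pos (x - s)).ne'
  simp only [BoundedContinuousFunction.mul_apply, Coef.shift_apply,
    BoundedContinuousFunction.coe_one, Pi.one_apply]
  field_simp

variable {T : ℝ} {ζ : ℝ → ℝ}

theorem hasTimeDeriv_path (hζ : ContDiffOn ℝ 2 ζ (Icc 0 T)) :
    HasTimeDeriv (fun t : I T => ζ t) (fun t => derivWithin ζ (Icc 0 T) t) :=
  hasTimeDeriv_of_eqOn (f := ζ) (fun _ => rfl) fun t =>
    (hζ.differentiableOn (by simp) t t.2).hasDerivWithinAt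

theorem contDiffOn_derivWithin_path (hT : 0 < T) (hζ : ContDiffOn ℝ 2 ζ (Icc 0 T)) :
    ContDiffOn ℝ 1 (derivWithin ζ (Icc 0 T)) (Icc 0 T) :=
  hζ.derivWithin (uniqueDiffOn_Icc hT) (by norm_num)

theorem hasTimeDeriv_derivWithin_path (hT : 0 < T) (hζ : ContDiffOn ℝ 2 ζ (Icc 0 T)) :
    HasTimeDeriv (fun t : I T => derivWithin ζ (Icc 0 T) t)
      (fun t => derivWithin (derivWithin ζ (Icc 0 T)) (Icc 0 T) t) :=
  hasTimeDeriv_of_eqOn (f := derivWithin ζ (Icc 0 T)) (fun _ => rfl) fun t =>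
    ((contDiffOn_derivWithin_path hT hζ).differentiableOn (by simp) t t.2).hasDerivWithinAt

theorem Coef.hasTimeDeriv_mul {Θ : ℝ → ℝ} (h : Coef Θ)
    (hζ : ContDiffOn ℝ 2 ζ (Icc 0 T)) :
    HasTimeDeriv (fun t : I T => h.mul (ζ t))
      (fun t => -derivWithin ζ (Icc 0 T) t • h.deriv.mul (ζ t)) :=
  hasTimeDeriv_of_eqOn (f := fun t => h.mul (ζ t)) (fun _ => rfl) fun t => by
    have := (h.hasDerivAt_mul (ζ t)).scomp_hasDerivWithinAt (t : ℝ)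
      (hζ.differentiableOn (by simp) t t.2).hasDerivWithinAt
    rw [neg_smul, ← smul_neg]
    exact this

/-- The relation behind the abstract hypotheses is `M_t = -ζ̇ θ' = M G`, whence `F_t = -G F`. Two
derivatives of `ζ` are needed because `G` contains `ζ̇` and is itself differentiated. -/
theorem exists_coeffs (hT : 0 < T) (hζ : ContDiffOn ℝ 2 ζ (Icc 0 T)) (hθ : IsMollifier θ) :
    ∃ cf : Coeffs T ko, (∀ t, cf.F t = hθ.coefF.mul (ζ t)) ∧
      (∀ t, cf.G t = -derivWithin ζ (Icc 0 T) t • hθ.coefG.mul (ζ t)) := by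
  have hd := hasTimeDeriv_path hζ
  have hd₁ := hasTimeDeriv_derivWithin_path hT hζ
  have hc₂ : Continuous fun t : I T => derivWithin (derivWithin ζ (Icc 0 T)) (Icc 0 T) t := by
    have := (contDiffOn_derivWithin_path hT hζ).continuousOn_derivWithin
      (uniqueDiffOn_Icc hT) le_rfl
    exact continuousOn_iff_continuous_domRestrict.1 this
  set ζ₁ : C(I T, ℝ) := ⟨fun t => derivWithin ζ (Icc 0 T) t, hd₁.continuous⟩ with hζ₁
  set ζ₂ : C(I T, ℝ) := ⟨fun t => derivWithin (derivWithin ζ (Icc 0 T)) (Icc 0 T) t, hc₂⟩ with hζ₂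
  have hmul : ∀ {Θ : ℝ → ℝ} (h : Coef Θ), Continuous fun t : I T => h.mul (ζ t) := fun h =>
    h.continuous_mul.comp hd.continuous
  obtain ⟨C₁, hC₁⟩ := hθ.coefG.norm_ko_mul_le
  obtain ⟨C₂, hC₂⟩ := hθ.coefG.deriv.norm_ko_mul_le
  set bM := hθ.coefM.bound
  set bF := hθ.coefF.bound
  set bG := hθ.coefG.bound
  set bG' := hθ.coefG.deriv.bound
  have hbM : 0 ≤ bM := hθ.coefM.bound_nonneg
  have hbF : 0 ≤ bF := hθ.coefF.bound_nonneg
  have hbG : 0 ≤ bG := hθ.coefG.bound_nonneg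
  have hbG' : 0 ≤ bG' := hθ.coefG.deriv.bound_nonneg
  have hs : ∀ (a : C(I T, ℝ)) (t : I T) (f : L2) {b : ℝ}, ‖f‖ ≤ b → ‖a t • f‖ ≤ ‖a‖ * b := by
    intro a t f b hf
    rw [norm_smul]
    exact mul_le_mul (a.norm_coe_le_norm t) hf (norm_nonneg _) (norm_nonneg _)
  have hs' : ∀ (a : C(I T, ℝ)) (t : I T) (f : L2) {b : ℝ}, ‖f‖ ≤ b →
      ‖(a t * a t) • f‖ ≤ ‖a‖ ^ 2 * b := by
    intro a t f b hf
    rw [mul_smul, sq, mul_assoc]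
    exact hs a t _ (hs a t f hf)
  set B₁ := ‖ζ₁‖ * bG
  set B₂ := ‖ζ₂‖ * bG + ‖ζ₁‖ ^ 2 * bG'
  set B₃ := ‖ζ₁‖ * |C₁|
  set B₄ := ‖ζ₂‖ * |C₁| + ‖ζ₁‖ ^ 2 * |C₂|
  have hB₁ : 0 ≤ B₁ := by positivity
  have hB₂ : 0 ≤ B₂ := by positivity
  have hB₃ : 0 ≤ B₃ := by positivity
  have hB₄ : 0 ≤ B₄ := by positivity
  have hle : ∀ {x a y : ℝ}, x ≤ a * y → a ≤ bM + bF + B₁ + B₂ + B₃ + B₄ → 0 ≤ y →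
      x ≤ (bM + bF + B₁ + B₂ + B₃ + B₄) * y := fun h h' hy =>
    h.trans (mul_le_mul_of_nonneg_right h' hy)
  have hpos : 0 < 1 + hθ.coef.bound := by linarith [hθ.coef.bound_nonneg]
  have hcle : (1 + hθ.coef.bound)⁻¹ ≤ 1 := inv_le_one_of_one_le₀ (by
    linarith [hθ.coef.bound_nonneg])
  refine ⟨{
    M := ⟨fun t => hθ.coefM.mul (ζ t), hmul _⟩
    F := ⟨fun t => hθ.coefF.mul (ζ t), hmul _⟩
    G := ⟨fun t => -ζ₁ t • hθ.coefG.mul (ζ t), ζ₁.continuous.neg.smul (hmul _)⟩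
    G₁ := ⟨fun t => -ζ₂ t • hθ.coefG.mul (ζ t) + (ζ₁ t * ζ₁ t) • hθ.coefG.deriv.mul (ζ t),
      (ζ₂.continuous.neg.smul (hmul _)).add ((ζ₁.continuous.mul ζ₁.continuous).smul (hmul _))⟩
    deriv_M := (hθ.coefM.hasTimeDeriv_mul hζ).congr (fun _ => rfl) fun t => by
      ext1 f
      change -ζ₁ t • hθ.coefM.deriv.mul (ζ t) f =
        hθ.coefM.mul (ζ t) (-ζ₁ t • hθ.coefG.mul (ζ t) f)
      rw [map_smul, hθ.coefM_mul_coefG]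
    deriv_F := (hθ.coefF.hasTimeDeriv_mul hζ).congr (fun _ => rfl) fun t => by
      ext1 f
      change -ζ₁ t • hθ.coefF.deriv.mul (ζ t) f =
        -(-ζ₁ t • hθ.coefG.mul (ζ t) (hθ.coefF.mul (ζ t) f))
      rw [hθ.coefG_mul_coefF, smul_neg, neg_neg]
    deriv_G := (hd₁.neg.smul (hθ.coefG.hasTimeDeriv_mul hζ)).congr (fun _ => rfl) fun t => by
      change -ζ₁ t • -ζ₁ t • hθ.coefG.deriv.mul (ζ t) + -ζ₂ t • hθ.coefG.mul (ζ t) =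
        -ζ₂ t • hθ.coefG.mul (ζ t) + (ζ₁ t * ζ₁ t) • hθ.coefG.deriv.mul (ζ t)
      rw [smul_smul, neg_mul_neg, add_comm]
    M_F := fun t f => hθ.coefM_mul_coefF _ f
    symm_M := fun t f g => hθ.coefM.inner_mul_comm _ f g
    symm_F := fun t f g => hθ.coefF.inner_mul_comm _ f g
    -- Since `θ ≥ 0`, this bounds both `M ≥ 1` and `F = 1 / (1 + θ)` from below.
    c := (1 + hθ.coef.bound)⁻¹
    c_pos := inv_pos.2 hpos
    c_le := hcle
    M_ge := fun t f => hθ.coefM.inner_mul_ge (fun x => by linarith [hθ.nonneg x]) _ f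
    F_ge := fun t f => hθ.coefF.inner_mul_ge (fun x => by
      rw [one_div]
      refine inv_anti₀ (hθ.one_add_pos x) ?_
      linarith [(le_abs_self _).trans (hθ.coef.norm_le_bound x)]) _ f
    B := bM + bF + B₁ + B₂ + B₃ + B₄
    B_nonneg := by positivity
    norm_M_le := fun t f => hle (hθ.coefM.norm_mul_apply_le _ f) (by linarith) (norm_nonneg _)
    norm_F_le := fun t f => hle (hθ.coefF.norm_mul_apply_le _ f) (by linarith) (norm_nonneg _)
    norm_G_le := fun t f => by
      refine hle (a := B₁) ?_ (by linarith) (norm_nonneg _)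
      change ‖-ζ₁ t • hθ.coefG.mul (ζ t) f‖ ≤ _
      rw [neg_smul, norm_neg, mul_assoc]
      exact hs _ _ _ (hθ.coefG.norm_mul_apply_le _ f)
    norm_G₁_le := fun t f => by
      refine hle (a := B₂) ?_ (by linarith) (norm_nonneg _)
      change ‖-ζ₂ t • hθ.coefG.mul (ζ t) f + (ζ₁ t * ζ₁ t) • hθ.coefG.deriv.mul (ζ t) f‖ ≤ _
      rw [add_mul, mul_assoc, mul_assoc]
      refine (norm_add_le _ _).trans (add_le_add ?_ ?_)
      · rw [neg_smul, norm_neg]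
        exact hs _ _ _ (hθ.coefG.norm_mul_apply_le _ f)
      · exact hs' _ _ _ (hθ.coefG.deriv.norm_mul_apply_le _ f)
    norm_K_G_le := fun n t f => by
      refine hle (a := B₃) ?_ (by linarith) (by positivity)
      change ‖ko n (-ζ₁ t • hθ.coefG.mul (ζ t) f)‖ ≤ _
      rw [map_smul, neg_smul, norm_neg, mul_assoc]
      exact hs _ _ _ ((hC₁ _ n f).trans
        (mul_le_mul_of_nonneg_right (le_abs_self _) (by positivity)))
    norm_K_G₁_le := fun n t f => by
      refine hle (a := B₄) ?_ (by linarith) (by positivity)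
      change ‖ko n (-ζ₂ t • hθ.coefG.mul (ζ t) f +
        (ζ₁ t * ζ₁ t) • hθ.coefG.deriv.mul (ζ t) f)‖ ≤ _
      rw [map_add, map_smul, map_smul, add_mul, mul_assoc, mul_assoc]
      refine (norm_add_le _ _).trans (add_le_add ?_ ?_)
      · rw [neg_smul, norm_neg]
        exact hs _ _ _ ((hC₁ _ n f).trans
          (mul_le_mul_of_nonneg_right (le_abs_self _) (by positivity)))
      · exact hs' _ _ _ ((hC₂ _ n f).trans
          (mul_le_mul_of_nonneg_right (le_abs_self _) (by positivity))) },
    fun t => rfl, fun t => rfl⟩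

end Coefficients

/-! ### Strong solutions of the linear problem -/

section Strong

/-- The second derivative of an `H⁴` function, as an `H²` function. -/
def derTwo (u : H 4) : H 2 :=
  mkH2 (wd 2 u) (wd 3 u) (wd 4 u)
    (IsWeakDeriv.of_trans (i := 2) (j := 1) (isWeakDeriv_wd u 2) (isWeakDeriv_wd u 3))
    (IsWeakDeriv.of_trans (i := 2) (j := 2) (isWeakDeriv_wd u 2) (isWeakDeriv_wd u 4))

/-- An `H²` function whose second derivative is in `H²` is in `H⁴`. -/
def mkH4 (u z : H 2) (h : toL2 z = wd 2 u) : H 4 :=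
  ⟨WithLp.toLp 2 ![toL2 u, wd 1 u, wd 2 u, wd 1 z, wd 2 z], fun j => by
    have h2 := isWeakDeriv_wd u 2
    have h1 := isWeakDeriv_wd z 1
    have h3 := isWeakDeriv_wd z 2
    rw [h] at h1 h3
    fin_cases j
    · exact isWeakDeriv_zero_iff.2 rfl
    · exact isWeakDeriv_wd u 1
    · exact h2
    · exact IsWeakDeriv.trans (i := 2) (j := 1) h2 h1
    · exact IsWeakDeriv.trans (i := 2) (j := 2) h2 h3⟩

theorem continuous_mkH4 {S : Type*} [TopologicalSpace S] {u z : S → H 2} (hu : Continuous u)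
    (hz : Continuous z) (h : ∀ s, toL2 (z s) = wd 2 (u s)) :
    Continuous fun s => mkH4 (u s) (z s) (h s) := by
  refine Continuous.subtype_mk ((PiLp.continuous_toLp 2 _).comp (continuous_pi fun j => ?_)) _
  fin_cases j
  · exact (toL2 (k := 2)).continuous.comp hu
  · exact (wd (k := 2) 1).continuous.comp hu
  · exact (wd (k := 2) 2).continuous.comp hu
  · exact (wd (k := 2) 1).continuous.comp hz
  · exact (wd (k := 2) 2).continuous.comp hz

/-- `M` annihilates `F M f - f`, and coercivity makes it injective, so the right inverse is also a
left inverse. -/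
theorem Coeffs.F_M {T : ℝ} {X : Type*} [NormedAddCommGroup X] [InnerProductSpace ℝ X]
    {K : ℕ → X →L[ℝ] X} (cf : Coeffs T K) (t : I T) (f : X) : cf.F t (cf.M t f) = f := by
  have h1 := cf.M_ge t (cf.F t (cf.M t f) - f)
  rw [map_sub, cf.M_F, sub_self, inner_zero_left] at h1
  have h2 : ‖cf.F t (cf.M t f) - f‖ ^ 2 ≤ 0 := by
    by_contra! h
    exact absurd h1 (not_le.2 (mul_pos cf.c_pos h))
  have h3 := pow_eq_zero_iff (two_ne_zero) |>.1 (le_antisymm h2 (sq_nonneg _))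
  exact sub_eq_zero.1 (norm_eq_zero.1 h3)

variable {T : ℝ}

/-- Linear combinations in `E₀(T)`. -/
def E0.lin (a b : ℝ) (w w' : E0 T) : E0 T where
  u := a • w.u + b • w'.u
  ut := a • w.ut + b • w'.ut
  utt := a • w.utt + b • w'.utt
  hasDeriv_u := ((w.hasDeriv_u.clm (a • ContinuousLinearMap.id ℝ _)).add
    (w'.hasDeriv_u.clm (b • ContinuousLinearMap.id ℝ _))).congr
      (fun t => by simp) fun t => by simp
  hasDeriv_ut := ((w.hasDeriv_ut.clm (a • ContinuousLinearMap.id ℝ _)).add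
    (w'.hasDeriv_ut.clm (b • ContinuousLinearMap.id ℝ _))).congr
      (fun t => by simp) fun t => by simp

theorem E0.ext_u (hT : 0 < T) {w w' : E0 T} (h : w.u = w'.u) : w = w' := by
  obtain ⟨u, ut, utt, h1, h2⟩ := w
  obtain ⟨u', ut', utt', h1', h2'⟩ := w'
  obtain rfl : u = u' := h
  obtain rfl : ut = ut' := DFunLike.coe_injective (h1.unique hT h1')
  obtain rfl : utt = utt' := DFunLike.coe_injective (h2.unique hT h2')
  rfl

/-- The operator form of the linear problem. -/
structure Coeffs.IsStrongSol (cf : Coeffs T ko) (hT : 0 < T) (u₀ : H 4) (u₁ : H 2) (g : E2 T)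
    (w : E0 T) : Prop where
  eq : ∀ t, w.utt t + cf.F t (wd 4 (w.u t)) + cf.G t (toL2 (w.ut t)) = toL2 (g t)
  u_zero : w.u (zeroTime hT) = u₀
  ut_zero : w.ut (zeroTime hT) = u₁

theorem isStrongSolution_iff {θ ζ : ℝ → ℝ} (hT : 0 < T) (hθ : IsMollifier θ) {cf : Coeffs T ko}
    (hF : ∀ t, cf.F t = hθ.coefF.mul (ζ t))
    (hG : ∀ t, cf.G t = -derivWithin ζ (Icc 0 T) t • hθ.coefG.mul (ζ t))
    {u₀ : H 4} {u₁ : H 2} {g : E2 T} {w : E0 T} :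
    IsStrongSolution θ ζ u₀ u₁ g w ↔ cf.IsStrongSol hT u₀ u₁ g w := by
  have key : ∀ t, (w.utt t + cf.F t (wd 4 (w.u t)) + cf.G t (toL2 (w.ut t)) : L2) =ᵐ[volume]
      fun x => w.utt t x + F θ ζ t x * wd 4 (w.u t) x + G T θ ζ t x * toL2 (w.ut t) x := by
    intro t
    rw [hF, hG, smul_apply]
    set a := hθ.coefF.mul (ζ t) (wd 4 (w.u t)) with ha
    set b := hθ.coefG.mul (ζ t) (toL2 (w.ut t)) with hb
    filter_upwards [Lp.coeFn_add (w.utt t + a) (-derivWithin ζ (Icc 0 T) t • b),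
      Lp.coeFn_add (w.utt t) a, Lp.coeFn_smul (-derivWithin ζ (Icc 0 T) t) b,
      hθ.coefF.coeFn_mul (ζ t) (wd 4 (w.u t)), hθ.coefG.coeFn_mul (ζ t) (toL2 (w.ut t))]
      with x h1 h2 h3 h4 h5
    rw [h1, Pi.add_apply, h2, Pi.add_apply, h3, Pi.smul_apply, ha, h4, hb, h5, smul_eq_mul, F, G]
    ring
  constructor
  · intro h
    have h0 := h.2 (zeroTime hT) rfl
    refine ⟨fun t => Lp.ext ?_, h0.1, h0.2⟩
    filter_upwards [key t, h.1 t] with x h1 h2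
    rw [h1, h2]
  · intro h
    refine ⟨fun t => ?_, fun t ht => ?_⟩
    · have h1 := key t
      rw [h.eq t] at h1
      filter_upwards [h1] with x h2
      rw [h2]
    · obtain rfl : t = zeroTime hT := Subtype.ext ht
      exact ⟨h.u_zero, h.ut_zero⟩

theorem Coeffs.IsStrongSol.lin {cf : Coeffs T ko} {hT : 0 < T} {u₀ u₀' : H 4} {u₁ u₁' : H 2}
    {g g' : E2 T} {w w' : E0 T} (h : cf.IsStrongSol hT u₀ u₁ g w)
    (h' : cf.IsStrongSol hT u₀' u₁' g' w') (a b : ℝ) :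
    cf.IsStrongSol hT (a • u₀ + b • u₀') (a • u₁ + b • u₁') (a • g + b • g') (E0.lin a b w w') where
  eq t := by
    have e1 := h.eq t
    have e2 := h'.eq t
    simp only [E0.lin, ContinuousMap.add_apply, ContinuousMap.smul_apply, map_add, map_smul,
      ← e1, ← e2, smul_add]
    abel
  u_zero := by simp [E0.lin, h.u_zero, h'.u_zero]
  ut_zero := by simp [E0.lin, h.ut_zero, h'.ut_zero]

/-- The energy estimate for strong solutions. -/
theorem Coeffs.strongSol_energy (cf : Coeffs T ko) (hT : 0 < T) :
    ∃ C, 0 ≤ C ∧ ∀ {u₀ : H 4} {u₁ : H 2} {g : E2 T} {w : E0 T}, cf.IsStrongSol hT u₀ u₁ g w →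
      ∀ t, ‖toL2 (w.u t)‖ ^ 2 + ‖wd 2 (w.u t)‖ ^ 2 + ‖toL2 (w.ut t)‖ ^ 2 ≤
        C * (‖toL2 u₀‖ ^ 2 + ‖wd 2 u₀‖ ^ 2 + ‖toL2 u₁‖ ^ 2 +
          prim (normSq (compT (toL2 (k := 2)) g)) t) := by
  obtain ⟨C, hC, H⟩ := cf.energy hT (C₀ := 2 * cf.B ^ 2) (by positivity)
  refine ⟨C * 2, by positivity, fun {u₀ u₁ g w} h t => ?_⟩
  -- The energy estimate with `V = u`, `W = u_t`, `Y = u_xx`, `A = u_xxxx`, `Z = u_xxt` and `r = g -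
  -- G u_t`. No defect occurs: `⟨Y, Z⟩ = ⟨A, W⟩` by integration by parts.
  have key := H (fun t => toL2 (w.u t)) (fun t => toL2 (w.ut t)) (fun t => wd 2 (w.u t))
    (fun t => wd 4 (w.u t)) (fun t => wd 2 (w.ut t))
    (fun t => toL2 (g t) - cf.G t (toL2 (w.ut t))) (fun _ => 0) (fun _ => 0)
    ((2 : ℝ) • normSq (compT (toL2 (k := 2)) g))
    ((w.hasDeriv_u.clm toL2).congr (fun _ => rfl) fun t => (add_zero _).symm)
    (w.hasDeriv_ut.congr (fun _ => rfl) fun t => by rw [← h.eq t]; abel)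
    ((w.hasDeriv_u.clm (wd 2)).congr (fun _ => rfl) fun t => (add_zero _).symm)
    (fun t => by
      have h1 : ⟪wd 2 (w.u t), wd 2 (w.ut t)⟫ = ⟪wd 4 (w.u t), toL2 (w.ut t)⟫ :=
        (inner_wd_two_comm (derTwo (w.u t)) (w.ut t)).symm
      rw [h1]
      refine le_add_of_nonneg_right ?_
      simp only [ContinuousMap.smul_apply, normSq_apply, smul_eq_mul]
      positivity)
    (fun t => by
      simp only [ContinuousMap.smul_apply, normSq_apply, smul_eq_mul, compT_apply]
      have h1 := norm_sub_le (toL2 (g t)) (cf.G t (toL2 (w.ut t)))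
      have h2 := cf.norm_G_le t (toL2 (w.ut t))
      have h3 := pow_le_pow_left₀ (norm_nonneg _) (h1.trans (add_le_add_right h2 _)) 2
      nlinarith [sq_nonneg (‖toL2 (g t)‖ - cf.B * ‖toL2 (w.ut t)‖),
        mul_nonneg (sq_nonneg cf.B) (sq_nonneg ‖toL2 (w.u t)‖)])
    (fun t => by
      simp only [ContinuousMap.smul_apply, normSq_apply, smul_eq_mul, norm_zero,
        zero_pow two_ne_zero]
      positivity)
    (fun t => by
      simp only [ContinuousMap.smul_apply, normSq_apply, smul_eq_mul, norm_zero,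
        zero_pow two_ne_zero]
      positivity) t
  rw [h.u_zero, h.ut_zero, ← primL_apply, map_smul, primL_apply, ContinuousMap.smul_apply,
    smul_eq_mul] at key
  refine key.trans ?_
  rw [mul_assoc]
  refine mul_le_mul_of_nonneg_left ?_ hC
  nlinarith [sq_nonneg ‖toL2 u₀‖, sq_nonneg ‖wd 2 u₀‖, sq_nonneg ‖toL2 u₁‖]

theorem Coeffs.IsStrongSol.unique {cf : Coeffs T ko} {hT : 0 < T} {u₀ : H 4} {u₁ : H 2}
    {g : E2 T} {w w' : E0 T} (h : cf.IsStrongSol hT u₀ u₁ g w)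
    (h' : cf.IsStrongSol hT u₀ u₁ g w') : w = w' := by
  obtain ⟨C, hC, H⟩ := cf.strongSol_energy hT
  have h1 := h.lin h' 1 (-1)
  have hg : (1 : ℝ) • g + (-1 : ℝ) • g = 0 := by ext1 t; simp
  rw [hg] at h1
  simp only [one_smul, neg_smul, add_neg_cancel] at h1
  refine E0.ext_u hT (ContinuousMap.ext fun t => toL2_injective ?_)
  have h2 := H h1 t
  have h3 : compT (toL2 (k := 2)) (0 : E2 T) = 0 := map_zero _
  have h4 : normSq (0 : C(I T, L2)) = 0 := by ext; simp
  rw [h3, h4, ← primL_apply, map_zero, map_zero, map_zero, map_zero] at h2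
  simp only [norm_zero, ContinuousMap.zero_apply] at h2
  have h5 : toL2 ((E0.lin 1 (-1) w w').u t) = toL2 (w.u t) - toL2 (w'.u t) := by
    simp [E0.lin, sub_eq_add_neg]
  rw [h5] at h2
  have h6 : ‖toL2 (w.u t) - toL2 (w'.u t)‖ ^ 2 ≤ 0 := by
    nlinarith [sq_nonneg ‖wd 2 ((E0.lin 1 (-1) w w').u t)‖,
      sq_nonneg ‖toL2 ((E0.lin 1 (-1) w w').ut t)‖]
  have h7 := pow_eq_zero_iff (two_ne_zero) |>.1 (le_antisymm h6 (sq_nonneg _))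
  exact sub_eq_zero.1 (norm_eq_zero.1 h7)

/-- Existence of strong solutions. -/
theorem Coeffs.exists_strongSol (cf : Coeffs T ko) (hT : 0 < T) (u₀ : H 4) (u₁ : H 2) (g : E2 T) :
    ∃ w, cf.IsStrongSol hT u₀ u₁ g w := by
  set o := zeroTime hT with ho
  -- Here `v` stands for `u_t` and `w` for `u_tt - g`; the initial value of `w` is dictated by the
  -- equation at time zero.
  obtain ⟨v, w, y, hv0, hw0, hv, hvy, hq⟩ := cf.exists_weak hT resolventFamily_jo
    (v₀ := toL2 u₁) (v₂ := wd 2 u₁) (-(cf.F o (wd 4 u₀)) - cf.G o (toL2 u₁))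
    (fun n => ko_H2 n u₁) (g := compT (toL2 (k := 2)) g) (g₂ := compT (wd (k := 2) 2) g)
    fun n t => ko_H2 n (g t)
  set V : C(I T, H 2) := compT (res (eps 0) (eps_pos 0)) (v - eps 0 • y) with hV
  have hV0 : ∀ t, toL2 (V t) = v t := fun t => (eq_res_of_ko_eq 0 (hvy 0 t)).1.symm
  have hV2 : ∀ t, wd 2 (V t) = y t := fun t => (eq_res_of_ko_eq 0 (hvy 0 t)).2.symm
  set u : C(I T, H 2) := ContinuousMap.const _ (incl (by norm_num) u₀) + prim V with hu
  have hu0 : u o = incl (by norm_num) u₀ := by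
    simp only [hu, ContinuousMap.add_apply, ContinuousMap.const_apply, ho, prim_zeroTime, add_zero]
  have hdu : HasTimeDeriv u V :=
    ((hasTimeDeriv_of_eqOn (f := fun _ => incl (k := 2) (by norm_num) u₀) (fun _ => rfl)
      fun t => hasDerivWithinAt_const _ _ _).add (hasTimeDeriv_prim V)).congr (fun _ => rfl)
      fun t => zero_add _
  have hu2 : ∀ t, wd 2 (u t) = wd 2 u₀ + prim y t := by
    intro t
    have h1 : wd 2 (u t) = wd 2 u₀ + wd 2 (prim V t) := map_add _ _ _
    have h2 : compT (wd (k := 2) 2) V = y := ContinuousMap.ext hV2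
    rw [h1, prim_clm, h2]
  set q : C(I T, L2) := opApply cf.M (w + opApply cf.G v) with hqdef
  -- The integrated weak identity, with one injective `J_0` cancelled. It says that `u''` lies in
  -- `H²` with `u'''' = -M(w + G v)`, the missing spatial regularity.
  have hku : ∀ t, ko 0 (wd 2 (u t)) = jo 0 (-q t) := by
    intro t
    have h1 := hq 0 t
    have h2 : cf.M o (-(cf.F o (wd 4 u₀)) - cf.G o (toL2 u₁) + cf.G o (toL2 u₁)) = -wd 4 u₀ := by
      rw [sub_add_cancel, map_neg, cf.M_F]
    have h3 : jo 0 (wd 4 u₀) = ko 0 (wd 2 u₀) := (ko_H2 0 (derTwo u₀)).symm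
    rw [h2, map_neg, h3, map_neg, ← neg_add', ← map_add, ← map_add, ← hu2, ← map_neg] at h1
    have h4 := jo_injective 0 h1
    rw [map_neg]
    exact neg_eq_iff_eq_neg.1 h4.symm
  set z : C(I T, H 2) := compT (res (eps 0) (eps_pos 0))
    (compT (wd (k := 2) 2) u - eps 0 • (-q)) with hz
  have hz0 : ∀ t, toL2 (z t) = wd 2 (u t) := fun t => (eq_res_of_ko_eq 0 (hku t)).1.symm
  have hz2 : ∀ t, wd 2 (z t) = -q t := fun t => (eq_res_of_ko_eq 0 (hku t)).2.symm
  refine ⟨⟨⟨_, continuous_mkH4 u.continuous z.continuous hz0⟩, V, w + compT (toL2 (k := 2)) g,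
    ?_, ?_⟩, ⟨fun t => ?_, ?_, ?_⟩⟩
  · exact hdu.congr (fun t => toL2_injective rfl) fun _ => rfl
  · exact hv.congr (fun t => (hV0 t).symm) fun _ => rfl
  · have h1 : wd 4 (mkH4 (u t) (z t) (hz0 t)) = -q t := hz2 t
    have h2 : cf.F t (q t) = w t + cf.G t (v t) := cf.F_M t _
    simp only [ContinuousMap.coe_mk, ContinuousMap.add_apply, compT_apply]
    rw [h1, hV0, map_neg, h2]
    abel
  · refine toL2_injective ?_
    have h1 : toL2 (u o) = toL2 u₀ := by rw [hu0, toL2_incl]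
    exact h1
  · refine toL2_injective ?_
    change toL2 (V o) = _
    rw [hV0, hv0]

end Strong

/-! ### The solution operator -/

section Operator

variable {T : ℝ}

theorem prim_le_integral (hT : 0 < T) {f : C(I T, ℝ)} (hf : ∀ t, 0 ≤ f t) (t : I T) :
    prim f t ≤ ∫ s, f s ∂timeMeasure T := by
  have h1 : ∫ s, f s ∂timeMeasure T = ∫ s in Icc 0 T, ex f s := by
    rw [← integral_subtype_comap measurableSet_Icc]
    exact integral_congr_ae (.of_forall fun s => (ex_coe f s).symm)
  rw [h1, prim_apply, intervalIntegral.integral_of_le t.2.1, integral_Icc_eq_integral_Ioc]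
  have hi := intervalIntegrable_ex f.continuous (right_mem_Icc.2 hT.le)
  rw [intervalIntegrable_iff_integrableOn_Ioc_of_le hT.le] at hi
  refine setIntegral_mono_set hi ?_ (Ioc_subset_Ioc_right t.2.2).eventuallyLE
  refine (ae_restrict_iff' measurableSet_Ioc).2 (.of_forall fun s hs => ?_)
  rw [ex_of_mem _ (Ioc_subset_Icc_self hs)]
  exact hf _

theorem E2.toL2L2_eq (g : E2 T) :
    g.toL2L2 = ContinuousMap.toLp 2 (timeMeasure T) ℝ (compT (toL2 (k := 2)) g) := rfl

theorem prim_normSq_le (hT : 0 < T) (g : E2 T) (t : I T) :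
    prim (normSq (compT (toL2 (k := 2)) g)) t ≤ ‖g.toL2L2‖ ^ 2 := by
  refine (prim_le_integral hT (fun t => by simp only [normSq_apply]; positivity) t).trans
    (le_of_eq ?_)
  rw [← real_inner_self_eq_norm_sq, L2.inner_def]
  refine integral_congr_ae ?_
  filter_upwards [ContinuousMap.coeFn_toLp (p := 2) (𝕜 := ℝ) (timeMeasure T)
    (compT (toL2 (k := 2)) g)] with s hs
  rw [E2.toL2L2_eq, hs, real_inner_self_eq_norm_sq, normSq_apply]

/-- The derivative relation is equivalent to its integrated form, which passes to uniform limits. -/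
theorem isClosed_E1 (hT : 0 < T) : IsClosed (E1 T : Set (C(I T, H 2) × C(I T, L2))) := by
  have h : (E1 T : Set (C(I T, H 2) × C(I T, L2))) = {u | ∀ t,
      toL2 (u.1 t) = toL2 (u.1 (zeroTime hT)) + prim u.2 t} := by
    ext u
    constructor
    · intro hu t
      exact prim_congr_of_hasTimeDeriv hT (u := compT (toL2 (k := 2)) u.1) hu t
    · intro hu
      refine HasTimeDeriv.congr ((hasTimeDeriv_of_eqOn
        (f := fun _ => toL2 (u.1 (zeroTime hT))) (fun _ => rfl)
        fun t => hasDerivWithinAt_const _ _ _).add (hasTimeDeriv_prim u.2))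
        (fun t => (hu t).symm) fun t => zero_add _
  rw [h, Set.ofPred_forall]
  refine isClosed_iInter fun t => isClosed_eq ?_ ?_
  · exact (toL2 (k := 2)).continuous.comp ((continuous_eval_const (F := C(I T, H 2)) t).comp
      continuous_fst)
  · refine Continuous.add ?_ ?_
    · exact (toL2 (k := 2)).continuous.comp ((continuous_eval_const (F := C(I T, H 2)) _).comp
        continuous_fst)
    · exact (continuous_eval_const (F := C(I T, L2)) t).comp
        ((primL (T := T)).continuous.comp continuous_snd)

/-- The resolvent commutes with `∂²`, so `J_n u` has its second derivative `J_n u''` in `H²`; hence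
`J_n u` lies in `H⁴`, and it tends to `u` in `H²`. -/
theorem denseRange_incl : DenseRange (incl (by norm_num) : H 4 → H 2) := by
  intro u
  have h : ∀ n, toL2 (res (eps n) (eps_pos n) (wd 2 u)) =
      wd 2 (res (eps n) (eps_pos n) (toL2 u)) := fun n => (wd_two_res_H2 _ u).symm
  refine mem_closure_of_tendsto (b := atTop) (f := fun n => res (eps n) (eps_pos n) (toL2 u)) ?_
    (.of_forall fun n => ⟨mkH4 _ _ (h n), toL2_injective rfl⟩)
  rw [tendsto_iff_norm_sub_tendsto_zero]
  have h1 : Tendsto (fun n => 2 * (‖jo n (toL2 u) - toL2 u‖ + ‖jo n (wd 2 u) - wd 2 u‖)) atTop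
      (𝓝 0) := by
    have := ((tendsto_iff_norm_sub_tendsto_zero.1 (tendsto_jo (toL2 u))).add
      (tendsto_iff_norm_sub_tendsto_zero.1 (tendsto_jo (wd 2 u)))).const_mul 2
    simpa using this
  refine squeeze_zero (fun _ => norm_nonneg _) (fun n => (norm_H2_le _).trans (le_of_eq ?_)) h1
  rw [map_sub, map_sub, ← h]
  rfl

/-- Continuous curves are dense in `L²` in time, and `J_n` smooths a continuous curve in space
uniformly in time. -/
theorem denseRange_toL2L2 : DenseRange (E2.toL2L2 : E2 T → L2L2 T) := by
  have h1 : DenseRange (compT (T := T) (toL2 (k := 2))) := by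
    intro φ
    refine mem_closure_of_tendsto (tendsto_compLeft norm_jo_le tendsto_jo φ)
      (.of_forall fun n => ⟨compT (res (eps n) (eps_pos n)) φ, rfl⟩)
  exact (ContinuousMap.toLp_denseRange L2 (timeMeasure T) ℝ (by norm_num)).comp h1
    (ContinuousMap.toLp 2 (timeMeasure T) ℝ).continuous

/-- The embedding of the regular data into the rough data. -/
def dataL (T : ℝ) : (H 4 × H 2 × E2 T) →ₗ[ℝ] H 2 × L2 × L2L2 T :=
  (incl (k := 2) (by norm_num) : H 4 →L[ℝ] H 2).toLinearMap.prodMap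
    ((toL2 (k := 2)).toLinearMap.prodMap
      ((ContinuousMap.toLp 2 (timeMeasure T) ℝ).comp (compT (toL2 (k := 2)))).toLinearMap)

theorem dataL_apply (u₀ : H 4) (u₁ : H 2) (g : E2 T) :
    dataL T (u₀, u₁, g) = (incl (by norm_num) u₀, toL2 u₁, g.toL2L2) := rfl

theorem denseRange_dataL : DenseRange (dataL T) :=
  denseRange_incl.prodMap (denseRange_toL2_H2.prodMap denseRange_toL2L2)

theorem E0.toE1_lin (a b : ℝ) (w w' : E0 T) :
    (E0.lin a b w w').toE1.1 = a • w.toE1.1 + b • w'.toE1.1 := by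
  refine Prod.ext (ContinuousMap.ext fun t => ?_) (ContinuousMap.ext fun t => ?_)
  · have h := map_add (incl (k := 2) (m := 4) (by norm_num)) (a • w.u t) (b • w'.u t)
    rw [map_smul, map_smul] at h
    exact h
  · have h := map_add (toL2 (k := 2)) (a • w.ut t) (b • w'.ut t)
    rw [map_smul, map_smul] at h
    exact h

/-- The strong solution with given data. -/
def Coeffs.strongSol (cf : Coeffs T ko) (hT : 0 < T) (x : H 4 × H 2 × E2 T) : E0 T :=
  (cf.exists_strongSol hT x.1 x.2.1 x.2.2).choose

theorem Coeffs.strongSol_spec (cf : Coeffs T ko) (hT : 0 < T) (x : H 4 × H 2 × E2 T) :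
    cf.IsStrongSol hT x.1 x.2.1 x.2.2 (cf.strongSol hT x) :=
  (cf.exists_strongSol hT x.1 x.2.1 x.2.2).choose_spec

theorem Coeffs.strongSol_lin (cf : Coeffs T ko) (hT : 0 < T) (a b : ℝ) (x y : H 4 × H 2 × E2 T) :
    cf.strongSol hT (a • x + b • y) = E0.lin a b (cf.strongSol hT x) (cf.strongSol hT y) :=
  (cf.strongSol_spec hT _).unique ((cf.strongSol_spec hT x).lin (cf.strongSol_spec hT y) a b)

theorem Coeffs.strongSol_add (cf : Coeffs T ko) (hT : 0 < T) (x y : H 4 × H 2 × E2 T) :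
    cf.strongSol hT (x + y) = E0.lin 1 1 (cf.strongSol hT x) (cf.strongSol hT y) := by
  have h := cf.strongSol_lin hT 1 1 x y
  rwa [one_smul, one_smul] at h

theorem Coeffs.strongSol_smul (cf : Coeffs T ko) (hT : 0 < T) (c : ℝ) (x : H 4 × H 2 × E2 T) :
    cf.strongSol hT (c • x) = E0.lin c 0 (cf.strongSol hT x) (cf.strongSol hT x) := by
  rw [← cf.strongSol_lin]
  congr 1
  refine Prod.ext ?_ (Prod.ext ?_ ?_)
  · change c • x.1 = c • x.1 + (0 : ℝ) • x.1
    simp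
  · change c • x.2.1 = c • x.2.1 + (0 : ℝ) • x.2.1
    simp
  · change c • x.2.2 = c • x.2.2 + (0 : ℝ) • x.2.2
    ext1 t
    simp

/-- The solution operator on regular data. -/
def Coeffs.strongL (cf : Coeffs T ko) (hT : 0 < T) :
    (H 4 × H 2 × E2 T) →ₗ[ℝ] C(I T, H 2) × C(I T, L2) where
  toFun x := (cf.strongSol hT x).toE1.1
  map_add' x y := by
    rw [cf.strongSol_add, E0.toE1_lin, one_smul, one_smul]
  map_smul' c x := by
    rw [cf.strongSol_smul, E0.toE1_lin, RingHom.id_apply]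
    set z := (cf.strongSol hT x).toE1.1
    refine Prod.ext (ContinuousMap.ext fun t => ?_) (ContinuousMap.ext fun t => ?_)
    · have h : c • z.1 t + (0 : ℝ) • z.1 t = c • z.1 t := by rw [zero_smul, add_zero]
      exact h
    · have h : c • z.2 t + (0 : ℝ) • z.2 t = c • z.2 t := by rw [zero_smul, add_zero]
      exact h

theorem Coeffs.strongL_spec (cf : Coeffs T ko) (hT : 0 < T) (u₀ : H 4) (u₁ : H 2) (g : E2 T) :
    ∃ w, cf.IsStrongSol hT u₀ u₁ g w ∧ cf.strongL hT (u₀, u₁, g) = w.toE1.1 :=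
  ⟨_, cf.strongSol_spec hT (u₀, u₁, g), rfl⟩

/-- The energy estimate uses only the rough norms of the data, which permits the extension by
density. -/
theorem Coeffs.norm_strongL_le (cf : Coeffs T ko) (hT : 0 < T) :
    ∃ C, ∀ x, ‖cf.strongL hT x‖ ≤ C * ‖dataL T x‖ := by
  obtain ⟨C, hC, H⟩ := cf.strongSol_energy hT
  -- Four data terms, each at most `N²`, give `√(4 C)`; the outer `4` comes from bounding the `H²`
  -- norm by `2 (‖u‖ + ‖u''‖)`.
  refine ⟨4 * Real.sqrt (4 * C), ?_⟩
  rintro ⟨u₀, u₁, g⟩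
  obtain ⟨w, hw, he⟩ := cf.strongL_spec hT u₀ u₁ g
  rw [he]
  set N := ‖dataL T (u₀, u₁, g)‖ with hN
  set D := Real.sqrt (4 * C) * N with hD
  have hD0 : 0 ≤ D := by positivity
  have hE : ∀ t, ‖toL2 (w.u t)‖ ^ 2 + ‖wd 2 (w.u t)‖ ^ 2 + ‖toL2 (w.ut t)‖ ^ 2 ≤ D ^ 2 := by
    intro t
    refine (H hw t).trans ?_
    rw [hD, mul_pow, Real.sq_sqrt (by positivity), mul_comm 4 C, mul_assoc]
    refine mul_le_mul_of_nonneg_left ?_ hC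
    have h1 : ‖incl (k := 2) (by norm_num) u₀‖ ≤ N := norm_fst_le (dataL T (u₀, u₁, g))
    have h2 : ‖toL2 u₁‖ ≤ N := (norm_fst_le (dataL T (u₀, u₁, g)).2).trans (norm_snd_le _)
    have h3 : ‖g.toL2L2‖ ≤ N := (norm_snd_le (dataL T (u₀, u₁, g)).2).trans (norm_snd_le _)
    have h4 : ‖toL2 u₀‖ ≤ N := (norm_wd_le 0 (incl (k := 2) (by norm_num) u₀)).trans h1
    have h5 : ‖wd 2 u₀‖ ≤ N := (norm_wd_le 2 (incl (k := 2) (by norm_num) u₀)).trans h1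
    have h6 := prim_normSq_le hT g t
    have hsq : ∀ {a : ℝ}, 0 ≤ a → a ≤ N → a ^ 2 ≤ N ^ 2 := fun ha h => pow_le_pow_left₀ ha h 2
    linarith [hsq (norm_nonneg _) h2, hsq (norm_nonneg _) h3, hsq (norm_nonneg _) h4,
      hsq (norm_nonneg _) h5]
  have hfin : 4 * Real.sqrt (4 * C) * N = 4 * D := by rw [hD, mul_assoc]
  rw [hfin]
  change max ‖w.toE1.1.1‖ ‖w.toE1.1.2‖ ≤ 4 * D
  refine max_le ((ContinuousMap.norm_le _ (by positivity)).2 fun t => ?_)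
    ((ContinuousMap.norm_le _ (by positivity)).2 fun t => ?_)
  · refine (norm_H2_le (w.toE1.1.1 t)).trans ?_
    have h1 : ‖toL2 (w.u t)‖ ≤ D := le_of_sq_le_sq (by
      linarith [hE t, sq_nonneg ‖wd 2 (w.u t)‖, sq_nonneg ‖toL2 (w.ut t)‖]) hD0
    have h2 : ‖wd 2 (w.u t)‖ ≤ D := le_of_sq_le_sq (by
      linarith [hE t, sq_nonneg ‖toL2 (w.u t)‖, sq_nonneg ‖toL2 (w.ut t)‖]) hD0
    change 2 * (‖toL2 (w.u t)‖ + ‖wd 2 (w.u t)‖) ≤ _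
    linarith
  · have h1 : ‖toL2 (w.ut t)‖ ≤ D := le_of_sq_le_sq (by
      linarith [hE t, sq_nonneg ‖wd 2 (w.u t)‖, sq_nonneg ‖toL2 (w.u t)‖]) hD0
    change ‖toL2 (w.ut t)‖ ≤ _
    linarith

/-- The continuous extension of the solution operator to rough data. -/
def Coeffs.solL (cf : Coeffs T ko) (hT : 0 < T) :
    (H 2 × L2 × L2L2 T) →L[ℝ] C(I T, H 2) × C(I T, L2) :=
  (cf.strongL hT).extendOfNorm (dataL T)

theorem Coeffs.solL_dataL (cf : Coeffs T ko) (hT : 0 < T) (x : H 4 × H 2 × E2 T) :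
    cf.solL hT (dataL T x) = cf.strongL hT x :=
  LinearMap.extendOfNorm_eq denseRange_dataL (cf.norm_strongL_le hT) x

theorem Coeffs.solL_mem (cf : Coeffs T ko) (hT : 0 < T) (x : H 2 × L2 × L2L2 T) :
    cf.solL hT x ∈ E1 T :=
  denseRange_dataL.induction_on (p := fun x => cf.solL hT x ∈ E1 T) x
    ((isClosed_E1 hT).preimage (cf.solL hT).continuous) fun x => by
      rw [cf.solL_dataL]
      exact (cf.strongSol hT x).toE1.2

/-- The solution operator with values in `E₁(T)`. -/
def Coeffs.sol (cf : Coeffs T ko) (hT : 0 < T) (x : H 2 × L2 × L2L2 T) : E1 T :=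
  ⟨cf.solL hT x, cf.solL_mem hT x⟩

/-- Causal estimate for the solution with a given right hand side. -/
theorem Coeffs.norm_solL_sub_le (cf : Coeffs T ko) (hT : 0 < T) :
    ∃ C, 0 ≤ C ∧ ∀ (u₀ : H 2) (u₁ : L2) (g g' : E2 T) (t : I T),
      ‖toL2 ((cf.sol hT (u₀, u₁, g.toL2L2)).1.1 t) -
        toL2 ((cf.sol hT (u₀, u₁, g'.toL2L2)).1.1 t)‖ ^ 2 ≤
        C * prim (normSq (compT (toL2 (k := 2)) g - compT (toL2 (k := 2)) g')) t := by
  obtain ⟨C, hC, H⟩ := cf.strongSol_energy hT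
  refine ⟨C, hC, fun u₀ u₁ g g' t => ?_⟩
  -- Even for rough `u₀, u₁` the difference has zero initial data and a source in `E2 T`, so it is a
  -- strong solution and obeys the estimate up to time `t`.
  obtain ⟨w, hw, he⟩ := cf.strongL_spec hT 0 0 (g - g')
  have h1 : cf.solL hT (u₀, u₁, g.toL2L2) - cf.solL hT (u₀, u₁, g'.toL2L2) =
      w.toE1.1 := by
    have hd : (u₀, u₁, g.toL2L2) - (u₀, u₁, g'.toL2L2) = dataL T (0, 0, g - g') := by
      rw [dataL_apply, map_zero, map_zero, Prod.mk_sub_mk, Prod.mk_sub_mk, sub_self, sub_self,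
        E2.toL2L2_eq, E2.toL2L2_eq, E2.toL2L2_eq, map_sub, map_sub]
    have hs := (cf.solL hT).map_sub (u₀, u₁, g.toL2L2) (u₀, u₁, g'.toL2L2)
    rw [hd, cf.solL_dataL, he] at hs
    exact hs.symm
  have h2 : toL2 ((cf.sol hT (u₀, u₁, g.toL2L2)).1.1 t) -
      toL2 ((cf.sol hT (u₀, u₁, g'.toL2L2)).1.1 t) = toL2 (w.u t) := by
    have := congrArg (fun z : E2 T × C(I T, L2) => toL2 (z.1 t)) h1
    refine Eq.trans ?_ this
    exact (map_sub (toL2 (k := 2)) _ _).symm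
  have h3 := H hw t
  rw [map_sub, map_zero, map_zero, map_zero, norm_zero] at h3
  rw [h2]
  linarith [sq_nonneg ‖wd 2 (w.u t)‖, sq_nonneg ‖toL2 (w.ut t)‖]

variable {θ ζ : ℝ → ℝ}

theorem isSolutionOperator_sol (hT : 0 < T) (hθ : IsMollifier θ) {cf : Coeffs T ko}
    (hF : ∀ t, cf.F t = hθ.coefF.mul (ζ t))
    (hG : ∀ t, cf.G t = -derivWithin ζ (Icc 0 T) t • hθ.coefG.mul (ζ t)) :
    IsSolutionOperator θ ζ (cf.sol hT) := by
  refine ⟨(cf.solL hT).continuous.subtype_mk _, fun u₀ u₁ g => ?_⟩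
  obtain ⟨w, hw, he⟩ := cf.strongL_spec hT u₀ u₁ g
  refine ⟨w, fun w' => ?_, Subtype.ext ((cf.solL_dataL hT _).trans he)⟩
  rw [isStrongSolution_iff hT hθ hF hG]
  exact ⟨fun h => h.unique hw, fun h => h ▸ hw⟩

/-- Two such operators agree on the regular data by uniqueness of strong solutions, and these are
dense. -/
theorem IsSolutionOperator.unique {A A' : H 2 × L2 × L2L2 T → E1 T}
    (h : IsSolutionOperator θ ζ A) (h' : IsSolutionOperator θ ζ A') : A = A' := by
  refine (denseRange_dataL (T := T)).equalizer h.1 h'.1 (funext ?_)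
  rintro ⟨u₀, u₁, g⟩
  obtain ⟨w, hw, he⟩ := h.2 u₀ u₁ g
  obtain ⟨w', hw', he'⟩ := h'.2 u₀ u₁ g
  obtain rfl : w = w' := (hw' w).1 ((hw w).2 rfl)
  exact he.trans he'.symm

end Operator

/-! ### The nonlinearity -/

section Nonlinearity

/-- Cauchy–Schwarz against the reflected translate of `ψ`, whose `L²` norm does not depend on `x`.
-/
theorem abs_conv_le (f : L2) {ψ : ℝ → ℝ} (hψ : ContDiff ℝ ∞ ψ) (hs : HasCompactSupport ψ)
    (x : ℝ) : |conv f ψ x| ≤ ‖testL2 ψ hψ hs‖ * ‖f‖ := by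
  have hψ' : ContDiff ℝ ∞ fun y => ψ (x - y) := hψ.comp (contDiff_const.sub contDiff_id)
  have hs' := hasCompactSupport_const_sub hs x
  have h1 : conv f ψ x = ⟪f, testL2 _ hψ' hs'⟫ := by
    rw [inner_testL2]
    rfl
  have h2 : ∀ {χ : ℝ → ℝ} (hχ : ContDiff ℝ ∞ χ) (hc : HasCompactSupport χ),
      ‖testL2 χ hχ hc‖ ^ 2 = ∫ y, χ y * χ y := by
    intro χ hχ hc
    rw [← real_inner_self_eq_norm_sq, inner_testL2]
    refine integral_congr_ae ?_
    filter_upwards [MemLp.coeFn_toLp (hχ.continuous.memLp_of_hasCompactSupport (p := 2)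
      (μ := volume) hc)] with y hy
    simp only [testL2]
    rw [hy]
  have h3 : ‖testL2 _ hψ' hs'‖ = ‖testL2 ψ hψ hs‖ := by
    refine (sq_eq_sq₀ (norm_nonneg _) (norm_nonneg _)).1 ?_
    rw [h2, h2]
    exact integral_sub_left_eq_self (fun y => ψ y * ψ y) volume x
  rw [h1, ← h3, mul_comm]
  exact abs_real_inner_le_norm _ _

/-- Convolution with a test function, with values in the bounded continuous functions. -/
def convB (ψ : ℝ → ℝ) (hψ : ContDiff ℝ ∞ ψ) (hs : HasCompactSupport ψ) : L2 →L[ℝ] (ℝ →ᵇ ℝ) :=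
  LinearMap.mkContinuous
    { toFun := fun f => BoundedContinuousFunction.ofNormedAddCommGroup (conv f ψ)
        (continuous_conv (locallyIntegrable_coe f) hψ.continuous hs) _
        (abs_conv_le f hψ hs)
      map_add' := fun f g => by
        ext x
        exact congrFun (conv_add_left f g hψ.continuous hs) x
      map_smul' := fun c f => by
        ext x
        exact congrFun (conv_smul_left c f ψ) x }
    ‖testL2 ψ hψ hs‖
    (fun f => BoundedContinuousFunction.norm_ofNormedAddCommGroup_le _ (by positivity)
      (abs_conv_le f hψ hs))

theorem convB_apply {ψ : ℝ → ℝ} (hψ : ContDiff ℝ ∞ ψ) (hs : HasCompactSupport ψ) (f : L2)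
    (x : ℝ) : convB ψ hψ hs f x = conv f ψ x := rfl

theorem isWeakDeriv_convL {ψ : ℝ → ℝ} (hψ : ContDiff ℝ ∞ ψ) (hs : HasCompactSupport ψ) (f : L2) :
    IsWeakDeriv 1 (convL ψ hψ.continuous hs f)
      (convL (deriv ψ) (contDiff_deriv hψ).continuous hs.deriv f) := by
  intro χ hχ hc
  have hcont : ∀ {ψ : ℝ → ℝ}, ContDiff ℝ ∞ ψ → HasCompactSupport ψ → Continuous (conv f ψ) :=
    fun hψ hs => continuous_conv (locallyIntegrable_coe f) hψ.continuous hs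
  have hint : ∀ {a b : ℝ → ℝ}, Continuous a → Continuous b → HasCompactSupport b →
      Integrable (a * b) := fun ha hb hb' =>
    (ha.mul hb).integrable_of_hasCompactSupport hb'.mul_left
  have h1 := integral_mul_deriv_eq_deriv_mul_of_integrable (u := conv f ψ) (v := χ)
    (fun x _ => hasDerivAt_conv f hψ hs x)
    (fun x _ => (hχ.differentiable (by simp) x).hasDerivAt)
    (hint (hcont hψ hs) (contDiff_deriv hχ).continuous hc.deriv)
    (hint (hcont (contDiff_deriv hψ) hs.deriv) hχ.continuous hc)
    (hint (hcont hψ hs) hχ.continuous hc)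
  have e : ∀ {ψ : ℝ → ℝ} (hψ : ContDiff ℝ ∞ ψ) (hs : HasCompactSupport ψ) (χ : ℝ → ℝ),
      ∫ x, convL ψ hψ.continuous hs f x * χ x = ∫ x, conv f ψ x * χ x := by
    intro ψ hψ hs χ
    refine integral_congr_ae ?_
    filter_upwards [coeFn_convL hψ.continuous hs f] with x hx
    rw [hx]
  rw [iteratedDeriv_one, e hψ hs, e (contDiff_deriv hψ) hs.deriv, h1]
  ring

/-- Convolution with a test function, with values in `H²(ℝ)`. -/
def convH (ψ : ℝ → ℝ) (hψ : ContDiff ℝ ∞ ψ) (hs : HasCompactSupport ψ) : L2 →L[ℝ] H 2 :=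
  mkH2L (convL ψ hψ.continuous hs) (convL (deriv ψ) (contDiff_deriv hψ).continuous hs.deriv)
    (convL (deriv (deriv ψ)) (contDiff_deriv (contDiff_deriv hψ)).continuous hs.deriv.deriv)
    (isWeakDeriv_convL hψ hs) fun f =>
      IsWeakDeriv.trans (i := 1) (j := 1) (isWeakDeriv_convL hψ hs f)
        (isWeakDeriv_convL (contDiff_deriv hψ) hs.deriv f)

variable {R : ℝ} {φ θ ζ : ℝ → ℝ}

theorem IsTruncation.coef (hφ : IsTruncation R φ) : Coef φ :=
  ⟨hφ.smooth, (R + 1) ^ 2, HasCompactSupport.intro (isCompact_Icc (a := -(R + 2)) (b := R + 2))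
    fun x hx => by
      have h : R + 2 ≤ |x| := by
        by_contra! h
        exact hx ⟨(abs_lt.1 h).1.le, (abs_lt.1 h).2.le⟩
      rw [hφ.eq_const x h, sub_self]⟩

/-- Vanishing at the origin, with the Lipschitz bound, makes composition with `φ` act on `L²`. -/
theorem IsTruncation.map_zero (hφ : IsTruncation R φ) (hR : 0 < R) : φ 0 = 0 := by
  rw [hφ.eq_sq 0 (by simpa using hR.le)]
  simp

theorem IsTruncation.lipschitzWith (hφ : IsTruncation R φ) :
    LipschitzWith hφ.coef.deriv.bound.toNNReal φ := by
  refine lipschitzWith_of_nnnorm_deriv_le (hφ.smooth.differentiable (by simp)) fun x => ?_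
  rw [← NNReal.coe_le_coe, coe_nnnorm, Real.coe_toNNReal _ hφ.coef.deriv.bound_nonneg]
  exact hφ.coef.deriv.norm_le_bound x

/-- `(φ(v ⋆ θ') - ν p) (v ⋆ θ'')` as a function of `v, p ∈ L²(ℝ)`. -/
def react (hθ : IsMollifier θ) (hR : 0 < R) (hφ : IsTruncation R φ) (ν : ℝ) (v p : L2) : L2 :=
  mulL (convB (deriv (deriv θ)) (contDiff_deriv (contDiff_deriv hθ.smooth))
    hθ.compact.deriv.deriv v)
    (hφ.lipschitzWith.compLp (hφ.map_zero hR)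
      (convL (deriv θ) (contDiff_deriv hθ.smooth).continuous hθ.compact.deriv v) - ν • p)

theorem coeFn_react (hθ : IsMollifier θ) (hR : 0 < R) (hφ : IsTruncation R φ) (ν : ℝ) (v p : L2) :
    react hθ hR hφ ν v p =ᵐ[volume] fun y =>
      (φ (conv v (deriv θ) y) - ν * p y) * conv v (iteratedDeriv 2 θ) y := by
  rw [react]
  set a := convL (deriv θ) (contDiff_deriv hθ.smooth).continuous hθ.compact.deriv v
  filter_upwards [coeFn_mulL (convB (deriv (deriv θ)) (contDiff_deriv (contDiff_deriv hθ.smooth))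
    hθ.compact.deriv.deriv v) (hφ.lipschitzWith.compLp (hφ.map_zero hR) a - ν • p),
    Lp.coeFn_sub (hφ.lipschitzWith.compLp (hφ.map_zero hR) a) (ν • p),
    hφ.lipschitzWith.coeFn_compLp (hφ.map_zero hR) a, Lp.coeFn_smul ν p,
    coeFn_convL (contDiff_deriv hθ.smooth).continuous hθ.compact.deriv v] with y h1 h2 h3 h4 h5
  rw [h1, h2, Pi.sub_apply, h3, h4, Function.comp_apply, h5, convB_apply, iteratedDeriv_succ,
    iteratedDeriv_one, Pi.smul_apply, smul_eq_mul, mul_comm]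

theorem continuous_react (hθ : IsMollifier θ) (hR : 0 < R) (hφ : IsTruncation R φ) (ν : ℝ)
    {S : Type*} [TopologicalSpace S] {v p : S → L2} (hv : Continuous v) (hp : Continuous p) :
    Continuous fun s => react hθ hR hφ ν (v s) (p s) := by
  refine (mulL.continuous.comp ((ContinuousLinearMap.continuous _).comp hv)).clm_apply ?_
  exact ((hφ.lipschitzWith.continuous_compLp (hφ.map_zero hR)).comp
    ((ContinuousLinearMap.continuous _).comp hv)).sub (hp.const_smul ν)

theorem react_zero (hθ : IsMollifier θ) (hR : 0 < R) (hφ : IsTruncation R φ) (ν : ℝ) (p : L2) :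
    react hθ hR hφ ν 0 p = 0 := by
  rw [react, map_zero, map_zero, zero_apply]

/-- Thanks to the truncation, the nonlinearity grows at most linearly. -/
theorem exists_norm_react_le (hθ : IsMollifier θ) (hR : 0 < R) (hφ : IsTruncation R φ) (ν : ℝ) :
    ∃ K, 0 ≤ K ∧ ∀ v p, ‖react hθ hR hφ ν v p‖ ≤ K * (1 + ‖p‖) * ‖v‖ := by
  set b := convB (deriv (deriv θ)) (contDiff_deriv (contDiff_deriv hθ.smooth))
    hθ.compact.deriv.deriv with hb
  set d := convL (deriv (deriv θ)) (contDiff_deriv (contDiff_deriv hθ.smooth)).continuous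
    hθ.compact.deriv.deriv with hd
  have hM := hφ.coef.bound_nonneg
  refine ⟨hφ.coef.bound * ‖d‖ + ‖b‖ * |ν|, by positivity, fun v p => ?_⟩
  set a := hφ.lipschitzWith.compLp (hφ.map_zero hR)
      (convL (deriv θ) (contDiff_deriv hθ.smooth).continuous hθ.compact.deriv v) with ha
  -- Here `φ` is bounded by a constant and the `L²` norm is put on `v ⋆ θ''`; the Lipschitz bound
  -- for `φ` would only give quadratic growth.
  have h1 : ‖mulL (b v) a‖ ≤ hφ.coef.bound * ‖d v‖ := by
    refine Lp.norm_le_mul_norm_of_ae_le_mul ?_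
    filter_upwards [coeFn_mulL (b v) a, coeFn_convL (contDiff_deriv (contDiff_deriv
      hθ.smooth)).continuous hθ.compact.deriv.deriv v, hφ.lipschitzWith.coeFn_compLp
      (hφ.map_zero hR) (convL (deriv θ) (contDiff_deriv hθ.smooth).continuous
        hθ.compact.deriv v)] with x h1 h2 h3
    rw [h1, hd, h2, ha, h3, norm_mul]
    exact (mul_comm _ _).le.trans
      (mul_le_mul_of_nonneg_right (hφ.coef.norm_le_bound _) (norm_nonneg (conv v _ x)))
  have h2 : ‖mulL (b v) (ν • p)‖ ≤ ‖b‖ * ‖v‖ * (|ν| * ‖p‖) := by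
    refine (norm_mulL_apply_le _ _).trans ?_
    rw [norm_smul, Real.norm_eq_abs]
    exact mul_le_mul_of_nonneg_right (b.le_opNorm v) (by positivity)
  rw [react, map_sub]
  refine (norm_sub_le _ _).trans ((add_le_add h1 h2).trans ?_)
  have h3 : hφ.coef.bound * ‖d v‖ ≤ hφ.coef.bound * ‖d‖ * ‖v‖ := by
    rw [mul_assoc]
    exact mul_le_mul_of_nonneg_left (d.le_opNorm v) hM
  have e1 : 0 ≤ hφ.coef.bound * ‖d‖ * ‖v‖ * ‖p‖ := by positivity
  have e2 : 0 ≤ ‖b‖ * |ν| * ‖v‖ := by positivity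
  nlinarith

/-- A product of two Lipschitz factors is only locally Lipschitz: the constant grows with the size
of `v` and `v'`. -/
theorem exists_norm_react_sub_le (hθ : IsMollifier θ) (hR : 0 < R) (hφ : IsTruncation R φ)
    (ν : ℝ) : ∃ K, 0 ≤ K ∧ ∀ v v' p, ‖react hθ hR hφ ν v p - react hθ hR hφ ν v' p‖ ≤
      K * (‖v‖ + ‖v'‖ + ‖p‖) * ‖v - v'‖ := by
  set b := convB (deriv (deriv θ)) (contDiff_deriv (contDiff_deriv hθ.smooth))
    hθ.compact.deriv.deriv with hb
  set d := convL (deriv θ) (contDiff_deriv hθ.smooth).continuous hθ.compact.deriv with hd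
  set L := hφ.coef.deriv.bound with hL
  have hL0 : 0 ≤ L := hφ.coef.deriv.bound_nonneg
  have hcoe : (L.toNNReal : ℝ) = L := Real.coe_toNNReal _ hL0
  refine ⟨‖b‖ * (L * ‖d‖ + |ν|), by positivity, fun v v' p => ?_⟩
  set a := hφ.lipschitzWith.compLp (hφ.map_zero hR) (d v) with ha
  set a' := hφ.lipschitzWith.compLp (hφ.map_zero hR) (d v') with ha'
  have e : react hθ hR hφ ν v p - react hθ hR hφ ν v' p =
      mulL (b (v - v')) (a - ν • p) + mulL (b v') (a - a') := by
    change mulL (b v) (a - ν • p) - mulL (b v') (a' - ν • p) = _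
    rw [map_sub b, map_sub mulL, sub_apply, ← sub_sub_sub_cancel_right a a' (ν • p),
      map_sub (mulL (b v')) (a - ν • p)]
    abel
  have h1 : ‖a‖ ≤ L * ‖d‖ * ‖v‖ := by
    have := hφ.lipschitzWith.norm_compLp_le (hφ.map_zero hR) (d v)
    rw [hcoe] at this
    refine this.trans ?_
    rw [mul_assoc]
    exact mul_le_mul_of_nonneg_left (d.le_opNorm v) hL0
  have h2 : ‖a - a'‖ ≤ L * ‖d‖ * ‖v - v'‖ := by
    have := hφ.lipschitzWith.norm_compLp_sub_le (hφ.map_zero hR) (d v) (d v')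
    rw [hcoe, ← map_sub] at this
    refine this.trans ?_
    rw [mul_assoc]
    exact mul_le_mul_of_nonneg_left (d.le_opNorm _) hL0
  have h3 : ‖a - ν • p‖ ≤ L * ‖d‖ * ‖v‖ + |ν| * ‖p‖ := by
    refine (norm_sub_le _ _).trans (add_le_add h1 (le_of_eq ?_))
    rw [norm_smul, Real.norm_eq_abs]
  have h4 : ‖mulL (b (v - v')) (a - ν • p)‖ ≤
      ‖b‖ * ‖v - v'‖ * (L * ‖d‖ * ‖v‖ + |ν| * ‖p‖) :=
    (norm_mulL_apply_le _ _).trans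
      (mul_le_mul (b.le_opNorm _) h3 (norm_nonneg _) (by positivity))
  have h5 : ‖mulL (b v') (a - a')‖ ≤ ‖b‖ * ‖v'‖ * (L * ‖d‖ * ‖v - v'‖) :=
    (norm_mulL_apply_le _ _).trans
      (mul_le_mul (b.le_opNorm _) h2 (norm_nonneg _) (by positivity))
  rw [e]
  refine (norm_add_le _ _).trans ((add_le_add h4 h5).trans ?_)
  have e1 : 0 ≤ ‖b‖ * (L * ‖d‖) * ‖p‖ * ‖v - v'‖ := by positivity
  have e2 : 0 ≤ ‖b‖ * |ν| * (‖v‖ + ‖v'‖) * ‖v - v'‖ := by positivity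
  linarith

theorem continuous_H2 {S : Type*} [TopologicalSpace S] {f : S → H 2}
    (h : Continuous fun s => toL2 (f s)) (h₁ : Continuous fun s => wd 1 (f s))
    (h₂ : Continuous fun s => wd 2 (f s)) : Continuous f := by
  have e : f = fun s => mkH2 (toL2 (f s)) (wd 1 (f s)) (wd 2 (f s)) (isWeakDeriv_wd (f s) 1)
      (isWeakDeriv_wd (f s) 2) := funext fun s => toL2_injective rfl
  rw [e]
  refine Continuous.subtype_mk ((PiLp.continuous_toLp 2 _).comp (continuous_pi fun j => ?_)) _
  fin_cases j
  exacts [h, h₁, h₂]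

theorem Coef.continuous_mulH {Θ : ℝ → ℝ} (c : Coef Θ) {S : Type*} [TopologicalSpace S]
    {s : S → ℝ} {f : S → H 2} (hs : Continuous s) (hf : Continuous f) :
    Continuous fun r => c.mulH (s r) (f r) := by
  have hm : ∀ {Θ : ℝ → ℝ} (c : Coef Θ) (j : Fin 3),
      Continuous fun r => c.mul (s r) (wd (k := 2) j (f r)) := fun c j =>
    (c.continuous_mul.comp hs).clm_apply ((wd (k := 2) j).continuous.comp hf)
  refine continuous_H2 (hm c 0) ?_ ?_
  · exact (hm c.deriv 0).add (hm c 1)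
  · exact ((hm c.deriv.deriv 0).add ((hm c.deriv 1).const_smul (2 : ℝ))).add (hm c 2)

variable {T : ℝ}

/-- The right hand side `([(φ(v ⋆ θ') - ν p)(v ⋆ θ'')] ⋆ θ + h) F`. -/
def source (hζ : ContDiffOn ℝ 2 ζ (Icc 0 T)) (hθ : IsMollifier θ) (hR : 0 < R)
    (hφ : IsTruncation R φ) (ν : ℝ) (p h : E2 T) (v : C(I T, L2)) : E2 T :=
  ⟨fun t => hθ.coefF.mulH (ζ t)
    (convH θ hθ.smooth hθ.compact (react hθ hR hφ ν (v t) (toL2 (p t))) + h t),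
    hθ.coefF.continuous_mulH (hasTimeDeriv_path hζ).continuous
      (((ContinuousLinearMap.continuous _).comp (continuous_react hθ hR hφ ν v.continuous
        ((ContinuousLinearMap.continuous _).comp p.continuous))).add h.continuous)⟩

theorem toL2_source (hζ : ContDiffOn ℝ 2 ζ (Icc 0 T)) (hθ : IsMollifier θ) (hR : 0 < R)
    (hφ : IsTruncation R φ) (ν : ℝ) (p h : E2 T) (v : C(I T, L2)) (t : I T) :
    toL2 (source hζ hθ hR hφ ν p h v t) = hθ.coefF.mul (ζ t)
      (convL θ hθ.smooth.continuous hθ.compact (react hθ hR hφ ν (v t) (toL2 (p t))) +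
        toL2 (h t)) := rfl

theorem isNonlinearOperator_source (hζ : ContDiffOn ℝ 2 ζ (Icc 0 T)) (hθ : IsMollifier θ)
    (hR : 0 < R) (hφ : IsTruncation R φ) (ν : ℝ) (p h : E2 T) :
    IsNonlinearOperator θ ζ φ ν p h
      fun v => source hζ hθ hR hφ ν p h (compT (toL2 (k := 2)) v.1.1) := by
  intro v t
  rw [toL2_source]
  set r := react hθ hR hφ ν (compT (toL2 (k := 2)) v.1.1 t) (toL2 (p t)) with hr
  have h1 := conv_congr_left (coeFn_react hθ hR hφ ν (compT (toL2 (k := 2)) v.1.1 t)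
    (toL2 (p t))) θ
  filter_upwards [hθ.coefF.coeFn_mul (ζ t) (convL θ hθ.smooth.continuous hθ.compact r +
    toL2 (h t)), Lp.coeFn_add (convL θ hθ.smooth.continuous hθ.compact r) (toL2 (h t)),
    coeFn_convL hθ.smooth.continuous hθ.compact r] with x h2 h3 h4
  rw [h2, h3, Pi.add_apply, h4, hr, h1, mul_comm]
  rfl

theorem IsNonlinearOperator.unique {ν : ℝ} {p h : E2 T} {C C' : E1 T → E2 T}
    (hC : IsNonlinearOperator θ ζ φ ν p h C) (hC' : IsNonlinearOperator θ ζ φ ν p h C') :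
    C = C' := by
  refine funext fun v => ContinuousMap.ext fun t => toL2_injective (Lp.ext ?_)
  filter_upwards [hC v t, hC' v t] with x h1 h2
  rw [h1, h2]

theorem norm_toL2_source_sub_le (hζ : ContDiffOn ℝ 2 ζ (Icc 0 T)) (hθ : IsMollifier θ)
    (hR : 0 < R) (hφ : IsTruncation R φ) (ν : ℝ) (p h : E2 T) : ∃ K, 0 ≤ K ∧
    ∀ (v v' : C(I T, L2)) (t : I T),
      ‖toL2 (source hζ hθ hR hφ ν p h v t) - toL2 (source hζ hθ hR hφ ν p h v' t)‖ ≤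
        K * ‖react hθ hR hφ ν (v t) (toL2 (p t)) - react hθ hR hφ ν (v' t) (toL2 (p t))‖ := by
  set c := convL θ hθ.smooth.continuous hθ.compact with hc
  have hF := hθ.coefF.bound_nonneg
  refine ⟨hθ.coefF.bound * ‖c‖, by positivity, fun v v' t => ?_⟩
  rw [toL2_source, toL2_source, ← map_sub, add_sub_add_right_eq_sub, ← map_sub, mul_assoc]
  exact (hθ.coefF.norm_mul_apply_le _ _).trans
    (mul_le_mul_of_nonneg_left (c.le_opNorm _) hF)

end Nonlinearity

/-! ### The fixed point -/

section FixedPoint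

variable {T : ℝ}

/-- A causal, locally Lipschitz map of linear growth has a fixed point. -/
theorem exists_fixedPoint_of_growth {X : Type*} [NormedAddCommGroup X] [NormedSpace ℝ X]
    [CompleteSpace X] (hT : 0 < T) {Ψ : C(I T, X) → C(I T, X)} {K : ℝ} (hK : 0 ≤ K)
    (hgrow : ∀ w t, ‖Ψ w t - Ψ 0 t‖ ^ 2 ≤ K * prim (normSq w) t)
    (hlip : ∀ ρ, ∃ L, 0 < L ∧ ∀ w w' : C(I T, X), (∀ t, ‖w t‖ ≤ ρ) → (∀ t, ‖w' t‖ ≤ ρ) →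
      ∀ t, ‖Ψ w t - Ψ w' t‖ ^ 2 ≤ L * prim (normSq (w - w')) t) : ∃ w, Ψ w = w := by
  -- This rate gives `K / lam ≤ 1 / 2`. With `D = 2 ‖Ψ 0‖²`, squaring the triangle inequality yields
  -- `‖Ψ w‖² ≤ D + D (e^{lam t} - 1)`, so `S` is invariant.
  set lam := 2 * K + 1 with hlam
  have hlam0 : 0 < lam := by positivity
  set D := 2 * ‖Ψ 0‖ ^ 2 with hD
  have hD0 : 0 ≤ D := by positivity
  set S : Set C(I T, X) := {w | ∀ t : I T, ‖w t‖ ^ 2 ≤ D * Real.exp (lam * t)} with hS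
  have hclosed : IsClosed S := by
    rw [hS, Set.ofPred_forall]
    refine isClosed_iInter fun t => isClosed_le ?_ continuous_const
    exact (continuous_eval_const (F := C(I T, X)) t).norm.pow 2
  have hne : S.Nonempty := ⟨0, fun t => by
    rw [ContinuousMap.zero_apply, norm_zero, zero_pow two_ne_zero]; positivity⟩
  have hmaps : MapsTo Ψ S S := by
    intro w hw t
    have h1 : ‖Ψ w t‖ ≤ ‖Ψ w t - Ψ 0 t‖ + ‖Ψ 0‖ := by
      have h2 := norm_add_le (Ψ w t - Ψ 0 t) (Ψ 0 t)
      rw [sub_add_cancel] at h2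
      linarith [(Ψ 0).norm_coe_le_norm t]
    have h2 := pow_le_pow_left₀ (norm_nonneg _) h1 2
    have h3 := prim_exp_le hlam0 hT t (φ := normSq w) fun s _ => hw s
    have h4 := mul_le_mul_of_nonneg_left h3 hK
    have hexp : 0 ≤ Real.exp (lam * t) - 1 := by
      have := Real.one_le_exp (mul_nonneg hlam0.le t.2.1)
      linarith
    have h5 : K * (D / lam * (Real.exp (lam * t) - 1)) ≤ D * (Real.exp (lam * t) - 1) / 2 := by
      have h6 : K / lam ≤ 1 / 2 := by
        rw [div_le_div_iff₀ hlam0 two_pos]; linarith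
      calc K * (D / lam * (Real.exp (lam * t) - 1))
          = K / lam * (D * (Real.exp (lam * t) - 1)) := by ring
        _ ≤ 1 / 2 * (D * (Real.exp (lam * t) - 1)) :=
            mul_le_mul_of_nonneg_right h6 (mul_nonneg hD0 hexp)
        _ = _ := by ring
    have h7 := hgrow w t
    nlinarith [sq_nonneg (‖Ψ w t - Ψ 0 t‖ - ‖Ψ 0‖)]
  -- `S` is bounded, so the local Lipschitz constant at radius `ρ` serves on all of it.
  set ρ := Real.sqrt (D * Real.exp (lam * T)) with hρ
  have hbound : ∀ w ∈ S, ∀ t, ‖w t‖ ≤ ρ := by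
    intro w hw t
    refine Real.le_sqrt_of_sq_le ((hw t).trans (mul_le_mul_of_nonneg_left ?_ hD0))
    exact Real.exp_le_exp.2 (mul_le_mul_of_nonneg_left t.2.2 hlam0.le)
  obtain ⟨L, hL, H⟩ := hlip ρ
  obtain ⟨w, -, hw⟩ := exists_fixedPoint_volterra hT hclosed hne hmaps hL
    fun w hw w' hw' t => H w w' (hbound w hw) (hbound w' hw') t
  exact ⟨w, hw⟩

theorem prim_normSq_le_mul {X Y : Type*} [NormedAddCommGroup X] [NormedAddCommGroup Y]
    {φ : C(I T, X)} {ψ : C(I T, Y)} {K : ℝ} (h : ∀ t, ‖φ t‖ ≤ K * ‖ψ t‖) (t : I T) :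
    prim (normSq φ) t ≤ K ^ 2 * prim (normSq ψ) t := by
  have h1 : prim (K ^ 2 • normSq ψ) t = K ^ 2 * prim (normSq ψ) t := by
    rw [← primL_apply, map_smul]
    rfl
  rw [← h1]
  refine prim_mono t fun s _ => ?_
  change ‖φ s‖ ^ 2 ≤ K ^ 2 * ‖ψ s‖ ^ 2
  rw [← mul_pow]
  exact pow_le_pow_left₀ (norm_nonneg _) (h s) 2

/-- The source sees `u` only as a curve in `L²`, so the problem reduces to a fixed point in
`C([0,T]; L²)`; the solution operator then supplies the `E₁(T)` regularity. -/
theorem Coeffs.exists_fixedPoint {R : ℝ} {φ θ ζ : ℝ → ℝ} (cf : Coeffs T ko) (hT : 0 < T)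
    (hζ : ContDiffOn ℝ 2 ζ (Icc 0 T)) (hθ : IsMollifier θ) (hR : 0 < R) (hφ : IsTruncation R φ)
    (ν : ℝ) (p h : E2 T) (u₀ : H 2) (u₁ : L2) :
    ∃ u : E1 T, cf.sol hT (u₀, u₁,
      (source hζ hθ hR hφ ν p h (compT (toL2 (k := 2)) u.1.1)).toL2L2) = u := by
  set N := source hζ hθ hR hφ ν p h with hN
  set A : C(I T, L2) → E1 T := fun w => cf.sol hT (u₀, u₁, (N w).toL2L2) with hA
  set Ψ : C(I T, L2) → C(I T, L2) := fun w => compT (toL2 (k := 2)) (A w).1.1 with hΨ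
  obtain ⟨C, hC, hsol⟩ := cf.norm_solL_sub_le hT
  obtain ⟨K, hK, hsrc⟩ := norm_toL2_source_sub_le hζ hθ hR hφ ν p h
  obtain ⟨K₁, hK₁, hgrow⟩ := exists_norm_react_le hθ hR hφ ν
  obtain ⟨K₂, hK₂, hlip⟩ := exists_norm_react_sub_le hθ hR hφ ν
  have hp : ∀ t, ‖toL2 (p t)‖ ≤ ‖p‖ := fun t =>
    (norm_wd_le 0 (p t)).trans (p.norm_coe_le_norm t)
  have key : ∀ (w w' : C(I T, L2)) {M : ℝ} (ψ : C(I T, L2)),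
      (∀ t, ‖react hθ hR hφ ν (w t) (toL2 (p t)) - react hθ hR hφ ν (w' t) (toL2 (p t))‖ ≤
        M * ‖ψ t‖) → ∀ t, ‖Ψ w t - Ψ w' t‖ ^ 2 ≤ C * (K * M) ^ 2 * prim (normSq ψ) t := by
    intro w w' M ψ hM t
    refine (hsol u₀ u₁ (N w) (N w') t).trans ?_
    rw [mul_assoc]
    refine mul_le_mul_of_nonneg_left (prim_normSq_le_mul (fun s => ?_) t) hC
    refine (hsrc w w' s).trans ?_
    rw [mul_assoc]
    exact mul_le_mul_of_nonneg_left (hM s) hK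
  obtain ⟨w, hw⟩ := exists_fixedPoint_of_growth hT (Ψ := Ψ)
    (K := C * (K * (K₁ * (1 + ‖p‖))) ^ 2) (by positivity)
    (fun w => key w 0 w fun t => by
      rw [ContinuousMap.zero_apply, react_zero, sub_zero]
      refine (hgrow _ _).trans (mul_le_mul_of_nonneg_right ?_ (norm_nonneg _))
      exact mul_le_mul_of_nonneg_left (by linarith [hp t]) hK₁)
    (fun ρ => by
      -- The added `1` only ensures positivity of the Lipschitz constant.
      refine ⟨C * (K * (K₂ * (ρ + ρ + ‖p‖))) ^ 2 + 1, by positivity, fun w w' hw hw' t => ?_⟩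
      have h1 := key w w' (w - w') (M := K₂ * (ρ + ρ + ‖p‖)) (fun t =>
        (hlip _ _ _).trans (mul_le_mul_of_nonneg_right
          (mul_le_mul_of_nonneg_left (by linarith [hp t, hw t, hw' t]) hK₂) (norm_nonneg _))) t
      have h2 := prim_nonneg (φ := normSq (w - w')) (fun t => sq_nonneg _) t
      linarith)
  refine ⟨A w, ?_⟩
  have h1 : compT (toL2 (k := 2)) (A w).1.1 = w := hw
  rw [h1]

end FixedPoint

end Beam

end

/-! ### The main theorem -/

theorem proposition3 (T : ℝ) (hT : 0 < T)
    (ζ : ℝ → ℝ) (hζ : ContDiffOn ℝ 2 ζ (Set.Icc 0 T))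
    (θ : ℝ → ℝ) (hθ : Beam.IsMollifier θ)
    (R : ℝ) (hR : 0 < R) (φ : ℝ → ℝ) (hφ : Beam.IsTruncation R φ)
    (ν : ℝ) (p h : Beam.E2 T) :
    (∃! A : Beam.H 2 × Beam.L2 × Beam.L2L2 T → Beam.E1 T, Beam.IsSolutionOperator θ ζ A) ∧
    (∃! C : Beam.E1 T → Beam.E2 T, Beam.IsNonlinearOperator θ ζ φ ν p h C) ∧
    ∀ (A : Beam.H 2 × Beam.L2 × Beam.L2L2 T → Beam.E1 T) (C : Beam.E1 T → Beam.E2 T),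
      Beam.IsSolutionOperator θ ζ A → Beam.IsNonlinearOperator θ ζ φ ν p h C →
      ∀ (u₀ : Beam.H 2) (u₁ : Beam.L2),
        ∃ u : Beam.E1 T, Function.IsFixedPt (fun v => A (u₀, u₁, (C v).toL2L2)) u := by
  obtain ⟨cf, hF, hG⟩ := Beam.exists_coeffs hT hζ hθ
  have hA := Beam.isSolutionOperator_sol hT hθ hF hG
  have hC := Beam.isNonlinearOperator_source hζ hθ hR hφ ν p h
  refine ⟨⟨_, hA, fun A hA' => hA'.unique hA⟩, ⟨_, hC, fun C hC' => hC'.unique hC⟩, ?_⟩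
  intro A C hA' hC' u₀ u₁
  -- Uniqueness reduces arbitrary operators to the constructed ones.
  obtain rfl := hA'.unique hA
  obtain rfl := hC'.unique hC
  exact cf.exists_fixedPoint hT hζ hθ hR hφ ν p h u₀ u₁
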